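/- **Setting.** Let $P$ be a polygonal curve in $\mathbb R^d$ with $n\ge 2$ vertices, parametrized over $[0,1]$; let $e$ be an edge (a linearly parametrized segment over $[0,1]$), $\alpha\ge 1$ and $\Delta\ge 0$. The *cells* are the rectangles $[v_i,v_{i+1}]\times[0,1]$, where $[v_i,v_{i+1}]$ is the parameter interval of the $i$-th edge of $P$. Let $A\subseteq[0,1]^2$ be a closed $(\alpha,\Delta)$-free space of $e$ and $P$: $A$ contains $\{(x,y):\|P(x)-e(y)\|\le\Delta\}$ and is contained in $\{(x,y):\|P(x)-e(y)\|\le\alpha\Delta\}$, it is convex in the interior of every cell, and a point on the boundary of a cell lies in $A$ iff, for every cell containing it, it lies in the closure of the part of $A$ in the interior of that cell. For a cell $i$ let $l_i(y)$, $r_i(y)$ be the $x$-coordinates of the left-most and right-most point of $A$ in cell $i$ at height $y$ ($\infty$ if there is none). Let $\varepsilon_1<\dots<\varepsilon_m$ be values in $[0,1]$, $m=O(n)$, containing the heights of all extremal points of $A$ (per cell: the top-most and bottom-most points, and the end points of the vertical segments of left-most and of right-most points). For $0\le s\le t\le1$: * $\mathcal R(e[s,t])$ is the set of inclusion-wise maximal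 pairs $(i,j)$ such that $A$ contains a path, monotone in both coordinates, from a point at height $s$ on the $i$-th edge of $P$ to a point at height $t$ on the $j$-th edge; here $(i,j)$ includes $(i',j')$ if $i\le i'$ and $j'\le j$. The *global group* $\mathcal G(e[s,t])$ consists of its pairs with $i<j$, the *local group* $\mathcal L(e[s,t])$ of its pairs $(i,i)$. * $i$ is *bad* for $e[s,t]$ if $l_i(s),r_i(t)\neq\infty$, all top-most points of $A$ in cell $i$ have $x$-coordinate at most $l_i(s)$ and at most $r_i(t)$, and all bottom-most points have $x$-coordinate at least $l_i(s)$ and at least $r_i(t)$; otherwise $i$ is *good*. The *good local group* is the set of $(i,i)\in\mathcal L(e[s,t])$ with $i$ good. * The *reduced global group* $\widetilde{\mathcal G}(e[s,t])$ results from $\mathcal G(e[s,t])$ by merging pairs $(a,b)$, $(c,d)$ into $(a,d)$ whenever $a<c<b<d$, or $b=c$ is good for $e[s,t]$ (i.e. every class of the equivalence relation generated by this is replaced by its smallest start and its largest end). A *sweep-sequence* is a list $\mathfrak s$ of pairs $(\varepsilon_a,\varepsilon_b)$ with $a\le b$ such that from each pair to the next one each of the two indices stays the same or increases by one. Assume that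 $\mathfrak s$ has $O(n)$ entries and that its last pair has two equal entries. **Algorithm (Maintain).** The input is $\mathfrak s$, the values $\varepsilon_k$, and $A$, given by the extreme heights of every cell, the $x$-coordinates of its right-most top-most and its left-most bottom-most point, the end points of the free space intervals between adjacent cells, and the functions $l_i,r_i$, all accessible in $O(1)$ time. The algorithm first sorts the changes between good and bad indices (found by binary search) and the other events by height. It computes $\mathcal L,\mathcal G,\widetilde{\mathcal G}$ for the last pair $(s,t)$ of $\mathfrak s$, and the set $\mathcal U$ of inclusion-wise maximal pairs $(i,j)$ such that $i=j$ and $l_i(s)\ne\infty$, or there is a monotone path from cell $i$ at height $s$ to cell $j$ at some height at most $t$. Then it loops over the pairs $(s',t')$ of $\mathfrak s$ in reverse order. If $s'\neq s$ it executes *AdvanceStart* and sets $s\gets s'$, and then, if $t'\ne t$, it executes *AdvanceEnd* and sets $t\gets t'$. These update $\mathcal U,\mathcal G$ at the affected cells: AdvanceStart moves the start of pairs starting at a cell whose lowest point has been passed to the next cell with $l_j(s')\neq\infty$, adds cells whose highest point has been reached, and extends pairs to the left through free space intervals whose highest point has been reached; AdvanceEnd splits pairs at free space intervals whose lowest point has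 been passed, and adds to $\mathcal G$ the pair ending in a cell whose highest point has been reached. Dominated pairs are removed. After each change of $\mathcal G$, and at all indices changing between good and bad, $\widetilde{\mathcal G}$ is updated by merging or separating neighbouring pairs, and the membership of the affected $(i,i)$ in $\mathcal L$ is recomputed. All sets are stored in balanced search trees. **Theorem.** Initially $(s,t)$ is the last pair of $\mathfrak s$, and after each iteration of the main loop $(s,t)$ is the pair that has just been processed. At the beginning and at the end of every iteration, the maintained set $\widetilde{\mathcal G}$ equals the reduced global group $\widetilde{\mathcal G}(e[s,t])$, and the maintained set $\mathcal L$ equals the good local group of $e[s,t]$. The execution of Maintain takes $O(n\log n)$ time; that is, for every $c$ there is a $C$ such that, if $m\le cn$ and $|\mathfrak s|\le cn$, at most $C\,n\log n$ elementary steps are executed, irrespective of $d,P,e,\alpha,\Delta,A,\varepsilon,\mathfrak s$. -/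

import Mathlib

open Set

namespace SubtrajSweep

/-! # Geometry: curves, free spaces, the groups of index-pairs -/

section Geometry

noncomputable section

/-- A polygonal curve in `ℝ^d`, parametrized over `[0,1]`, with `numEdges ≥ 1` edges. The vertices
are `vertex 0, …, vertex numEdges`; the vertex `vertex i` is attained at the parameter `knot i`.
Edges (and hence cells) are numbered from `0` to `numEdges - 1`; the values of `vertex` and `knot`
beyond `numEdges` play no role. -/
structure PolygonalCurve (d : ℕ) where
  numEdges : ℕ
  numEdges_pos : 0 < numEdges
  vertex : ℕ → EuclideanSpace ℝ (Fin d)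
  knot : ℕ → ℝ
  knot_zero : knot 0 = 0
  knot_last : knot numEdges = 1
  knot_strictMono : StrictMonoOn knot (Iic numEdges)

variable {d : ℕ}

namespace PolygonalCurve

/-- The complexity of a curve: its number of vertices. -/
def complexity (P : PolygonalCurve d) : ℕ := P.numEdges + 1

/-- The fraction of edge `i` that has been traversed at parameter `x`, as a number in `[0,1]`. -/
def fraction (P : PolygonalCurve d) (i : ℕ) (x : ℝ) : ℝ :=
  max 0 (min 1 ((x - P.knot i) / (P.knot (i + 1) - P.knot i)))

/-- The point of the curve at parameter `x ∈ [0,1]`: on `[knot i, knot (i+1)]` this is the linear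
interpolation between `vertex i` and `vertex (i+1)`. -/
def point (P : PolygonalCurve d) (x : ℝ) : EuclideanSpace ℝ (Fin d) :=
  P.vertex 0 + ∑ i ∈ Finset.range P.numEdges, P.fraction i x • (P.vertex (i + 1) - P.vertex i)

/-- The `i`-th cell of the free space diagram of an edge and `P`. -/
def cell (P : PolygonalCurve d) (i : ℕ) : Set (ℝ × ℝ) :=
  Icc (P.knot i) (P.knot (i + 1)) ×ˢ Icc 0 1

/-- The interior of the `i`-th cell. -/
def openCell (P : PolygonalCurve d) (i : ℕ) : Set (ℝ × ℝ) :=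
  Ioo (P.knot i) (P.knot (i + 1)) ×ˢ Ioo 0 1

end PolygonalCurve

/-- The edge from `p` to `q`. -/
def edgePoint (p q : EuclideanSpace ℝ (Fin d)) (y : ℝ) : EuclideanSpace ℝ (Fin d) :=
  AffineMap.lineMap p q y

/-- The `Δ`-free space of the edge from `p` to `q` and the curve `P`. The `x`-coordinate is the
parameter on `P`, the `y`-coordinate is the parameter on the edge. -/
def freeSpace (p q : EuclideanSpace ℝ (Fin d)) (P : PolygonalCurve d) (Δ : ℝ) : Set (ℝ × ℝ) :=
  {z | z.1 ∈ Icc (0 : ℝ) 1 ∧ z.2 ∈ Icc (0 : ℝ) 1 ∧ ‖P.point z.1 - edgePoint p q z.2‖ ≤ Δ}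

/-- `A` is an `(α, Δ)`-free space of the edge from `p` to `q` and the curve `P`. -/
structure IsApproxFreeSpace (p q : EuclideanSpace ℝ (Fin d)) (P : PolygonalCurve d)
    (α Δ : ℝ) (A : Set (ℝ × ℝ)) : Prop where
  freeSpace_subset : freeSpace p q P Δ ⊆ A
  subset_freeSpace : A ⊆ freeSpace p q P (α * Δ)
  convex_cell : ∀ i < P.numEdges, Convex ℝ (A ∩ P.openCell i)
  boundary_iff : ∀ z : ℝ × ℝ, (∃ i < P.numEdges, z ∈ P.cell i \ P.openCell i) →
    (z ∈ A ↔ ∀ i < P.numEdges, z ∈ P.cell i → z ∈ closure (A ∩ P.openCell i))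

variable (P : PolygonalCurve d) (A : Set (ℝ × ℝ))

/-- The part of `A` in cell `i`. -/
def cellPart (i : ℕ) : Set (ℝ × ℝ) := A ∩ P.cell i

/-- The top-most points of `A` in cell `i`. -/
def topmost (i : ℕ) : Set (ℝ × ℝ) := {z ∈ cellPart P A i | ∀ w ∈ cellPart P A i, w.2 ≤ z.2}

/-- The bottom-most points of `A` in cell `i`. -/
def bottommost (i : ℕ) : Set (ℝ × ℝ) := {z ∈ cellPart P A i | ∀ w ∈ cellPart P A i, z.2 ≤ w.2}

/-- The vertical segment of the left-most points of `A` in cell `i`. -/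
def leftmost (i : ℕ) : Set (ℝ × ℝ) := {z ∈ cellPart P A i | ∀ w ∈ cellPart P A i, z.1 ≤ w.1}

/-- The vertical segment of the right-most points of `A` in cell `i`. -/
def rightmost (i : ℕ) : Set (ℝ × ℝ) := {z ∈ cellPart P A i | ∀ w ∈ cellPart P A i, w.1 ≤ z.1}

/-- The `y`-coordinates of the extremal points of `A`: in every cell the common height of the
top-most points, that of the bottom-most points, and the heights of the two end points of the
vertical segments of left-most and of right-most points. -/
def extremalHeights : Set ℝ :=
  {y | ∃ i < P.numEdges,
    y ∈ Prod.snd '' topmost P A i ∨ y ∈ Prod.snd '' bottommost P A i ∨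
    IsLeast (Prod.snd '' leftmost P A i) y ∨ IsGreatest (Prod.snd '' leftmost P A i) y ∨
    IsLeast (Prod.snd '' rightmost P A i) y ∨ IsGreatest (Prod.snd '' rightmost P A i) y}

/-- There is a monotone path from `a` to `b` inside `A`; the order on `ℝ × ℝ` is the
componentwise one. -/
def HasMonotonePath (a b : ℝ × ℝ) : Prop :=
  ∃ γ : ℝ → ℝ × ℝ, ContinuousOn γ (Icc 0 1) ∧ MonotoneOn γ (Icc 0 1) ∧ γ 0 = a ∧ γ 1 = b ∧
    ∀ u ∈ Icc (0 : ℝ) 1, γ u ∈ A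

/-- There is a monotone path in `A` from edge `i` of `P` at height `s` to edge `j` at height `t`. -/
def Reaches (s t : ℝ) (i j : ℕ) : Prop :=
  ∃ x ∈ Icc (P.knot i) (P.knot (i + 1)), ∃ x' ∈ Icc (P.knot j) (P.knot (j + 1)),
    HasMonotonePath A (x, s) (x', t)

/-- The index-pair `p` includes the index-pair `q`. -/
def Includes (p q : ℕ × ℕ) : Prop := p.1 ≤ q.1 ∧ q.2 ≤ p.2

/-- The combinatorial representation of the coverage of `e[s,t]`: all inclusion-wise maximal
index-pairs `(i, j)` of edges of `P` such that there is a monotone path from edge `i` at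
height `s` to edge `j` at height `t`. -/
def combinatorialRep (s t : ℝ) : Set (ℕ × ℕ) :=
  {p | p.1 < P.numEdges ∧ p.2 < P.numEdges ∧ Reaches P A s t p.1 p.2 ∧
    ∀ q : ℕ × ℕ, q.1 < P.numEdges → q.2 < P.numEdges → Reaches P A s t q.1 q.2 →
      Includes q p → q = p}

/-- The global group of `e[s,t]`. -/
def globalGroup (s t : ℝ) : Set (ℕ × ℕ) := {p ∈ combinatorialRep P A s t | p.1 < p.2}

/-- The local group of `e[s,t]`. -/
def localGroup (s t : ℝ) : Set (ℕ × ℕ) := {p ∈ combinatorialRep P A s t | p.1 = p.2}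

/-- The function `l_i`: the `x`-coordinate of the left-most point of `A` in cell `i` at height `y`,
and `∞ = ⊤` if there is no point of `A` in cell `i` at height `y`. (For a closed set `A` the infimum
is attained.) -/
def cellLeft (i : ℕ) (y : ℝ) : WithTop ℝ :=
  open Classical in
  if ∃ x, (x, y) ∈ cellPart P A i then ((sInf {x | (x, y) ∈ cellPart P A i} : ℝ) : WithTop ℝ) else ⊤

/-- The function `r_i`: the `x`-coordinate of the right-most point of `A` in cell `i` at height `y`,
and `∞ = ⊤` if there is no point of `A` in cell `i` at height `y`. -/
def cellRight (i : ℕ) (y : ℝ) : WithTop ℝ :=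
  open Classical in
  if ∃ x, (x, y) ∈ cellPart P A i then ((sSup {x | (x, y) ∈ cellPart P A i} : ℝ) : WithTop ℝ) else ⊤

/-- The index `i` is bad for `e[s,t]`: all top-most points in cell `i` are to the left of
`l_i(s)` and `r_i(t)`, and both of these are to the left of all bottom-most points in cell `i`. -/
def IsBad (s t : ℝ) (i : ℕ) : Prop :=
  ∃ x x' : ℝ, cellLeft P A i s = (x : WithTop ℝ) ∧ cellRight P A i t = (x' : WithTop ℝ) ∧
    (∀ z ∈ topmost P A i, z.1 ≤ x ∧ z.1 ≤ x') ∧ (∀ z ∈ bottommost P A i, x ≤ z.1 ∧ x' ≤ z.1)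

/-- Two index-pairs `(a, b)` and `(c, d)` of the global group are to be merged if `a < c < b < d`,
or if `b = c` is good for `e[s,t]`. -/
def ShouldMerge (s t : ℝ) (p q : ℕ × ℕ) : Prop :=
  p ∈ globalGroup P A s t ∧ q ∈ globalGroup P A s t ∧
    ((p.1 < q.1 ∧ q.1 < p.2 ∧ p.2 < q.2) ∨ (p.2 = q.1 ∧ ¬ IsBad P A s t q.1))

/-- The class of all index-pairs of the global group which are merged together with `p`. -/
def mergeClass (s t : ℝ) (p : ℕ × ℕ) : Set (ℕ × ℕ) :=
  {q | Relation.EqvGen (ShouldMerge P A s t) p q}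

/-- The reduced global group of `e[s,t]`: every class of merged index-pairs of the global group is
replaced by the index-pair of its first start and its last end. -/
def reducedGlobalGroup (s t : ℝ) : Set (ℕ × ℕ) :=
  {q | ∃ p ∈ globalGroup P A s t, IsLeast (Prod.fst '' mergeClass P A s t p) q.1 ∧
    IsGreatest (Prod.snd '' mergeClass P A s t p) q.2}

/-- The good local group of `e[s,t]`: the index-pairs `(i, i)` of the local group such that
`i` is good for `e[s,t]`. -/
def goodLocalGroup (s t : ℝ) : Set (ℕ × ℕ) := {p ∈ localGroup P A s t | ¬ IsBad P A s t p.1}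

end

end Geometry

/-- `𝔰` is a sweep-sequence (of pairs in forward orientation) of a sorted list of `m` values; an
entry `(a, b)` of `𝔰` stands for the pair of the `a`-th and the `b`-th value. -/
def IsSweepSequence (m : ℕ) (𝔰 : List (ℕ × ℕ)) : Prop :=
  (∀ p ∈ 𝔰, p.1 ≤ p.2 ∧ p.2 < m) ∧
  𝔰.IsChain fun p q => (q.1 = p.1 ∨ q.1 = p.1 + 1) ∧ (q.2 = p.2 ∨ q.2 = p.2 + 1)

/-! # Programs with a step count

A program of type `Timed α` has a result and a number of executed steps. Every procedure of this
type below spends one step (`tick`) each time it is entered, every loop is a recursive procedure,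
and between two steps only a bounded number of elementary operations is carried out: arithmetic and
comparisons of indices and of coordinates, reading an entry of the input (in particular one
evaluation of a function `l_i` or `r_i`), reading or building a bounded number of tree nodes, list
cells or record fields. The few auxiliary functions without step count are constant-time
combinations of such operations. -/

/-- A computation with a result and a number of steps. -/
structure Timed (α : Type*) where
  val : α
  steps : ℕ

instance : Monad Timed where
  pure a := ⟨a, 0⟩
  bind x f := let y := f x.val; ⟨y.val, x.steps + y.steps⟩

/-- One step. -/
def tick : Timed PUnit := ⟨⟨⟩, 1⟩

/-! ## Ordered maps

Finite maps from indices to values, stored in a complete binary tree. An inner node stores the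
number of keys of its left subtree and the value at the largest key below it. -/

inductive Trie (β : Type) where
  | leaf (v : Option β) : Trie β
  | node (half : ℕ) (last : Option β) (l r : Trie β) : Trie β

namespace Trie

variable {β : Type}

/-- The value at the largest key (constant time). -/
def last : Trie β → Option β
  | leaf v => v
  | node _ c _ _ => c

/-- Build an inner node (constant time). -/
def mk (half : ℕ) (l r : Trie β) : Trie β :=
  match r.last with
  | some v => node half (some v) l r
  | none => node half l.last l r

/-- Shift the key of an entry (constant time). -/
def shift (h : ℕ) : Option (ℕ × β) → Option (ℕ × β)
  | some (k, v) => some (k + h, v)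
  | none => none

/-- The empty map of depth `D`, with room for the keys `0, …, 2 ^ D - 1`. -/
def empty : ℕ → Timed (Trie β)
  | 0 => do
    tick
    return leaf none
  | D + 1 => do
    tick
    let t ← empty D
    return node (2 ^ D) none t t

/-- Look up a key. -/
def find : Trie β → ℕ → Timed (Option β)
  | leaf v, k => do
    tick
    return if k = 0 then v else none
  | node h _ l r, k => do
    tick
    if k < h then l.find k else r.find (k - h)

/-- Insert, overwrite (`some`) or erase (`none`) the value at a key. -/
def set : Trie β → ℕ → Option β → Timed (Trie β)
  | leaf v, k, w => do
    tick
    return leaf (if k = 0 then w else v)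
  | node h _ l r, k, w => do
    tick
    if k < h then
      let l' ← l.set k w
      return mk h l' r
    else
      let r' ← r.set (k - h) w
      return mk h l r'

/-- The entry with the largest key. -/
def maxEntry : Trie β → Timed (Option (ℕ × β))
  | leaf v => do
    tick
    return v.map fun x => (0, x)
  | node h c l r => do
    tick
    if c.isNone then return none
    else if r.last.isSome then return shift h (← r.maxEntry)
    else l.maxEntry

/-- The entry with the smallest key. -/
def minEntry : Trie β → Timed (Option (ℕ × β))
  | leaf v => do
    tick
    return v.map fun x => (0, x)
  | node h c l r => do
    tick
    if c.isNone then return none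
    else if l.last.isSome then l.minEntry
    else return shift h (← r.minEntry)

/-- The entry with the largest key that is at most `k`. -/
def pred : Trie β → ℕ → Timed (Option (ℕ × β))
  | leaf v, _ => do
    tick
    return v.map fun x => (0, x)
  | node h _ l r, k => do
    tick
    if k < h then l.pred k
    else
      match ← r.pred (k - h) with
      | some e => return shift h (some e)
      | none => l.maxEntry

/-- The entry with the smallest key that is at least `k`. -/
def succ : Trie β → ℕ → Timed (Option (ℕ × β))
  | leaf v, k => do
    tick
    return if k = 0 then v.map fun x => (0, x) else none
  | node h _ l r, k => do
    tick
    if k < h then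
      match ← l.succ k with
      | some e => return some e
      | none => return shift h (← r.minEntry)
    else return shift h (← r.succ (k - h))

/-- For a map whose values increase with the keys: the entry with the smallest key among those
of value at least `j`. -/
def firstGE : Trie ℕ → ℕ → Timed (Option (ℕ × ℕ))
  | leaf v, j => do
    tick
    match v with
    | some x => return if j ≤ x then some (0, x) else none
    | none => return none
  | node h _ l r, j => do
    tick
    match l.last with
    | some x => if j ≤ x then l.firstGE j else return shift h (← r.firstGE j)
    | none => return shift h (← r.firstGE j)

/-- The set of index-pairs `(i, j)` such that the map has the value `j` at the key `i`. -/
def pairs (t : Trie ℕ) : Set (ℕ × ℕ) := {p | (t.find p.1).val = some p.2}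

end Trie

/-- Smallest `x` in `[lo, hi)` with `p x`, by binary search for a monotone test `p`; `hi` if there
is none. The first argument bounds the recursion depth and is not the step count;
`hi - lo` always suffices. -/
def bisect (p : ℕ → Bool) : ℕ → ℕ → ℕ → Timed ℕ
  | 0, lo, _ => do
    tick
    return lo
  | fuel + 1, lo, hi => do
    tick
    if lo < hi then
      if p ((lo + hi) / 2) then bisect p fuel lo ((lo + hi) / 2)
      else bisect p fuel ((lo + hi) / 2 + 1) hi
    else return lo

/-- Reversal of a list onto an accumulator. -/
def reverseOnto {β : Type} : List β → List β → Timed (List β)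
  | [], acc => do
    tick
    return acc
  | x :: xs, acc => do
    tick
    reverseOnto xs (x :: acc)

/-- `for x in xs do σ ← f x σ`. -/
def forList {σ : Type} (f : ℕ → σ → Timed σ) : List ℕ → σ → Timed σ
  | [], s => do
    tick
    return s
  | x :: xs, s => do
    tick
    let s' ← f x s
    forList f xs s'

/-- `for x in [from, from + count) do σ ← f x σ`. -/
def forRange {σ : Type} (f : ℕ → σ → Timed σ) : (count : ℕ) → (start : ℕ) → σ → Timed σ
  | 0, _, s => do
    tick
    return s
  | c + 1, x, s => do
    tick
    let s' ← f x s
    forRange f c (x + 1) s'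

/-- The least `D` with `n ≤ 2 ^ D`, by repeated doubling from `size = 2 ^ D`. The first argument
bounds the recursion depth and is not the step count; `n` always suffices. -/
def depthFor (n : ℕ) : (fuel : ℕ) → (size : ℕ) → (D : ℕ) → Timed ℕ
  | 0, _, D => do
    tick
    return D
  | fuel + 1, size, D => do
    tick
    if n ≤ size then return D else depthFor n fuel (2 * size) (D + 1)

/-! # The sweep algorithm -/

/-- The input of the algorithm besides the sweep-sequence, with coordinates in `K`; every entry can
be read in constant time.
* `range i`: heights of the bottom-most and of the top-most points of cell `i`, if there are any;
* `topX i`: `x`-coordinate of the right-most top-most point of cell `i`;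
* `botX i`: `x`-coordinate of the left-most bottom-most point of cell `i`;
* `gate i`: lowest and highest point of the free space interval between the cells `i` and `i + 1`;
* `left i y`, `right i y`: the functions `l_i` and `r_i`;
* `height 0 < … < height (numHeights - 1)`: the sorted list of heights containing the heights of all
  extremal points. -/
structure SweepInput (K : Type) where
  numCells : ℕ
  range : ℕ → Option (K × K)
  topX : ℕ → K
  botX : ℕ → K
  gate : ℕ → Option (K × K)
  left : ℕ → K → WithTop K
  right : ℕ → K → WithTop K
  numHeights : ℕ
  height : ℕ → K

/-- The events, sorted into lists by (indices of) heights.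
* `botAt`, `topAt`: cells whose bottom-most, top-most points have this height;
* `loAt`, `hiAt`: gates whose lowest, highest point has this height;
* `flipS`, `flipT`: cells `i` which may appear, disappear or change between good and bad when the
  start (resp. the end) of the subedge moves from this height to the next lower one, or
  arrives at this height from above. -/
structure Events where
  botAt : Trie (List ℕ)
  topAt : Trie (List ℕ)
  loAt : Trie (List ℕ)
  hiAt : Trie (List ℕ)
  flipS : Trie (List ℕ)
  flipT : Trie (List ℕ)

/-- The state of the sweep at the subedge `e[height s, height t]`. Sets of index-pairs in which no
two pairs have the same start are stored as maps from the start to the end.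
* `U`: the set `𝒰` of inclusion-wise maximal index-pairs `(i, j)` such that either `i = j` and
  `l_i(s) ≠ ∞`, or there is a path from cell `i` at height `s` to cell `j` at some height `≤ t`;
* `L`: the good local group, `G`: the global group, `Gr`: the reduced global group;
* `starts`: the cells `i` with `l_i(s) ≠ ∞`;
* `cuts`: the gates which do not contain the height `s`. -/
structure State where
  s : ℕ
  t : ℕ
  U : Trie ℕ
  L : Trie ℕ
  G : Trie ℕ
  Gr : Trie ℕ
  starts : Trie ℕ
  cuts : Trie ℕ

section Algorithm

variable {K : Type} [LinearOrder K] (I : SweepInput K)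

/-- Constant-time test whether `i` is bad for the current subedge. -/
def testBad (σ : State) (i : ℕ) : Bool :=
  match I.left i (I.height σ.s), I.right i (I.height σ.t) with
  | some x, some x' => I.topX i ≤ x && I.topX i ≤ x' && x ≤ I.botX i && x' ≤ I.botX i
  | _, _ => false

/-! ## Events -/

/-- Add `x` to the list at index `k`. -/
def addEvent (T : Trie (List ℕ)) (k x : ℕ) : Timed (Trie (List ℕ)) := do
  tick
  match ← T.find k with
  | some xs => T.set k (some (x :: xs))
  | none => T.set k (some [x])

/-- The list at index `k`. -/
def eventsAt (T : Trie (List ℕ)) (k : ℕ) : Timed (List ℕ) := do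
  tick
  match ← T.find k with
  | some xs => return xs
  | none => return []

/-- The index of a height. -/
def heightIndex (y : K) : Timed ℕ := do
  tick
  bisect (fun k => decide (y ≤ I.height k)) I.numHeights 0 I.numHeights

/-- Sort in the events of cell `i`. Between the bottom and the top of the cell, `l_i(s)` is to the
right of the top-most points up to some height, and `r_i(t)` is to the left of the bottom-most
points from some height on; both heights are found by binary search. -/
def addCellEvents (i : ℕ) (ev : Events) : Timed Events := do
  tick
  match I.range i with
  | none => return ev
  | some (lo, hi) =>
    let a ← heightIndex I lo
    let b ← heightIndex I hi
    let p ← bisect (fun k => decide (¬ (I.topX i : WithTop K) ≤ I.left i (I.height k))) (b - a) a b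
    let q ← bisect (fun k => decide (I.right i (I.height k) ≤ (I.botX i : WithTop K)))
      (b - a) (a + 1) (b + 1)
    let botAt ← addEvent ev.botAt a i
    let topAt ← addEvent ev.topAt b i
    let flipS ← addEvent ev.flipS a i
    let flipS ← addEvent flipS b i
    let flipS ← addEvent flipS p i
    let flipT ← addEvent ev.flipT a i
    let flipT ← addEvent flipT b i
    let flipT ← addEvent flipT q i
    return { ev with botAt := botAt, topAt := topAt, flipS := flipS, flipT := flipT }

/-- Sort in the events of gate `i`. -/
def addGateEvents (i : ℕ) (ev : Events) : Timed Events := do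
  tick
  match I.gate i with
  | none => return ev
  | some (lo, hi) =>
    let a ← heightIndex I lo
    let b ← heightIndex I hi
    let loAt ← addEvent ev.loAt a i
    let hiAt ← addEvent ev.hiAt b i
    return { ev with loAt := loAt, hiAt := hiAt }

/-- Sort in the events of the cells and gates `c - 1, …, 0`, so that every list is increasing. -/
def addAllEvents : (c : ℕ) → Events → Timed Events
  | 0, ev => do
    tick
    return ev
  | i + 1, ev => do
    tick
    let ev ← addCellEvents I i ev
    let ev ← addGateEvents I i ev
    addAllEvents i ev

/-- Compute all events. -/
def computeEvents : Timed Events := do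
  tick
  let D ← depthFor (I.numHeights + 1) (I.numHeights + 1) 1 0
  let T ← Trie.empty D
  addAllEvents I I.numCells ⟨T, T, T, T, T, T⟩

/-! ## The reduced global group

An index-pair of `G` is merged with the preceding one if and only if its start is not a start
in `Gr`. -/

/-- The index-pair of `G` preceding the start `a`. -/
def prevPair (σ : State) (a : ℕ) : Timed (Option (ℕ × ℕ)) := do
  tick
  if a = 0 then return none else σ.G.pred (a - 1)

/-- Separate the index-pair of `G` with start `a` from the preceding one, if they are merged. -/
def cutAt (σ : State) (a : ℕ) : Timed State := do
  tick
  match ← prevPair σ a with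
  | none => return σ
  | some (_, d) =>
    match ← σ.Gr.find a with
    | some _ => return σ
    | none =>
      match ← σ.Gr.pred a with
      | none => return σ
      | some (x, z) =>
        let Gr ← σ.Gr.set x (some d)
        let Gr ← Gr.set a (some z)
        return { σ with Gr := Gr }

/-- Merge the index-pair of `G` with start `a` with the preceding one, if they are separate. -/
def joinAt (σ : State) (a : ℕ) : Timed State := do
  tick
  match ← prevPair σ a with
  | none => return σ
  | some (c, _) =>
    match ← σ.Gr.find a with
    | none => return σ
    | some z =>
      match ← σ.Gr.pred c with
      | none => return σ
      | some (x, _) =>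
        let Gr ← σ.Gr.set a none
        let Gr ← Gr.set x (some z)
        return { σ with Gr := Gr }

/-- Merge the index-pair of `G` with start `a` (if any) with the preceding index-pair `(c, d)`, or
separate the two, according to the rule for merging. -/
def fixLink (σ : State) (a : ℕ) : Timed State := do
  tick
  match ← σ.G.find a with
  | none => return σ
  | some _ =>
    match ← prevPair σ a with
    | none => return σ
    | some (_, d) =>
      if a < d ∨ (a = d ∧ testBad I σ a = false) then joinAt σ a else cutAt σ a

/-- Insert `(a, b)` into `G` and update `Gr`. -/
def insertPair (σ : State) (a b : ℕ) : Timed State := do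
  tick
  let next ← σ.G.succ (a + 1)
  let σ ← match next with
    | some (c, _) => cutAt σ c
    | none => pure σ
  let G ← σ.G.set a (some b)
  let Gr ← σ.Gr.set a (some b)
  let σ ← fixLink I { σ with G := G, Gr := Gr } a
  match next with
  | some (c, _) => fixLink I σ c
  | none => return σ

/-- Remove the index-pair with start `a` (if any) from `G` and update `Gr`. -/
def removePair (σ : State) (a : ℕ) : Timed State := do
  tick
  match ← σ.G.find a with
  | none => return σ
  | some _ =>
    let σ ← cutAt σ a
    let next ← σ.G.succ (a + 1)
    let σ ← match next with
      | some (c, _) => cutAt σ c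
      | none => pure σ
    let G ← σ.G.set a none
    let Gr ← σ.Gr.set a none
    let σ : State := { σ with G := G, Gr := Gr }
    match next with
    | some (c, _) => fixLink I σ c
    | none => return σ

/-! ## The good local group -/

/-- Recompute whether `(i, i)` is in the good local group: cell `i` has points at both heights,
`i` is good, and `(i, i)` is not included in an index-pair of `G`. -/
def refreshLocal (σ : State) (i : ℕ) : Timed State := do
  tick
  let covered ← match ← σ.G.pred i with
    | some (_, b) => pure (decide (i ≤ b))
    | none => pure false
  let L ← σ.L.set i
    (if I.left i (I.height σ.s) ≠ ⊤ ∧ I.right i (I.height σ.t) ≠ ⊤ ∧ testBad I σ i = false ∧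
      covered = false then some i else none)
  return { σ with L := L }

/-- Update the merging at `i` and the membership of `(i, i)` in the good local group. -/
def refresh (i : ℕ) (σ : State) : Timed State := do
  tick
  let σ ← fixLink I σ i
  refreshLocal I σ i

/-! ## Moving the start of the subedge downwards -/

/-- The start has moved below the lowest point of gate `k`. -/
def leaveGate (k : ℕ) (σ : State) : Timed State := do
  tick
  let cuts ← σ.cuts.set k (some k)
  return { σ with cuts := cuts }

/-- The start has moved below the bottom-most points of cell `i`: index-pairs starting at `i` start
at the smallest `j > i` with `l_j(s) ≠ ∞` instead. -/
def leaveCell (i : ℕ) (σ : State) : Timed State := do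
  tick
  let starts ← σ.starts.set i none
  let σ : State := { σ with starts := starts }
  let next ← starts.succ (i + 1)
  let σ ← match ← σ.U.find i with
    | none => pure σ
    | some b => do
      let U ← σ.U.set i none
      match next with
      | none => pure { σ with U := U }
      | some (j, _) =>
        if j ≤ b ∧ (← U.find j).isNone then
          let U ← U.set j (some b)
          pure { σ with U := U }
        else pure { σ with U := U }
  match ← σ.G.find i with
  | none => return σ
  | some b =>
    let σ ← removePair I σ i
    let σ ← match next with
      | none => pure σ
      | some (j, _) =>
        if j < b ∧ (← σ.G.find j).isNone then insertPair I σ j b else pure σ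
    refreshLocal I σ b

/-- The start has reached the top-most points of cell `i`. -/
def enterCell (i : ℕ) (σ : State) : Timed State := do
  tick
  let starts ← σ.starts.set i (some i)
  let U ← σ.U.set i (some i)
  return { σ with starts := starts, U := U }

/-- The start has reached the highest point of gate `k`: index-pairs starting at `k + 1` start at
the left-most cell `j` from which the gate `k` can be reached horizontally. -/
def openGate (k : ℕ) (σ : State) : Timed State := do
  tick
  let cuts ← σ.cuts.set k none
  let σ : State := { σ with cuts := cuts }
  let j ← if k = 0 then pure 0 else do
    match ← cuts.pred (k - 1) with
    | some (c, _) => pure (c + 1)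
    | none => pure 0
  let σ ← match ← σ.U.find (k + 1) with
    | none => pure σ
    | some e => do
      let U ← σ.U.set (k + 1) none
      let U ← U.set j (some e)
      pure { σ with U := U }
  let target ← match ← σ.G.find (k + 1) with
    | some e => pure (some e)
    | none => pure (if I.right (k + 1) (I.height σ.t) ≠ ⊤ then some (k + 1) else none)
  match target with
  | none => return σ
  | some e =>
    let σ ← removePair I σ (k + 1)
    let σ ← removePair I σ j
    let σ ← insertPair I σ j e
    let σ ← refreshLocal I σ j
    refreshLocal I σ (k + 1)

/-- `AdvanceStart`: the start of the subedge moves from height number `σ.s` to the next lower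
height, which has number `s'`. -/
def advanceStart (ev : Events) (σ : State) (s' : ℕ) : Timed State := do
  tick
  let s := σ.s
  let σ : State := { σ with s := s' }
  let σ ← forList leaveGate (← eventsAt ev.loAt s) σ
  let σ ← forList (leaveCell I) (← eventsAt ev.botAt s) σ
  let σ ← forList enterCell (← eventsAt ev.topAt s') σ
  let σ ← forList (openGate I) (← eventsAt ev.hiAt s') σ
  let σ ← forList (refresh I) (← eventsAt ev.flipS s) σ
  forList (refresh I) (← eventsAt ev.flipS s') σ

/-! ## Moving the end of the subedge downwards -/

/-- The end has moved below the lowest point of gate `k`: an index-pair `(a, b)` with `a ≤ k < b`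
is replaced by `(a, k)` and `(j, b)`, where `j > k` is the smallest index with `l_j(s) ≠ ∞`. -/
def closeGate (k : ℕ) (σ : State) : Timed State := do
  tick
  let next ← σ.starts.succ (k + 1)
  let σ ← match ← σ.U.pred k with
    | none => pure σ
    | some (a, b) =>
      if k < b then do
        let U ← σ.U.set a (some k)
        match next with
        | none => pure { σ with U := U }
        | some (j, _) =>
          if j ≤ b ∧ (← U.find j).isNone then
            let U ← U.set j (some b)
            pure { σ with U := U }
          else pure { σ with U := U }
      else pure σ
  match ← σ.G.pred k with
  | none => return σ
  | some (a, b) =>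
    if k < b then
      let σ ← removePair I σ a
      let σ ← if a < k then insertPair I σ a k else pure σ
      let σ ← match next with
        | none => pure σ
        | some (j, _) =>
          if j < b ∧ (← σ.G.find j).isNone then insertPair I σ j b else pure σ
      let σ ← refreshLocal I σ k
      refreshLocal I σ b
    else return σ

/-- The end has reached the top-most points of cell `j`: add `(i, j)` to `G`, where `i < j` is the
smallest index such that there is a path from cell `i` at height `s` to cell `j`, if there
is one. -/
def enterCellEnd (j : ℕ) (σ : State) : Timed State := do
  tick
  match ← σ.U.firstGE j with
  | none => return σ
  | some (i, _) =>
    if i < j then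
      match ← σ.G.find i with
      | some c =>
        if c < j then
          let σ ← removePair I σ i
          let σ ← insertPair I σ i j
          refreshLocal I σ i
        else return σ
      | none =>
        let σ ← insertPair I σ i j
        refreshLocal I σ i
    else return σ

/-- `AdvanceEnd`: the end of the subedge moves from height number `σ.t` to the next lower
height, which has number `t'`. -/
def advanceEnd (ev : Events) (σ : State) (t' : ℕ) : Timed State := do
  tick
  let t := σ.t
  let σ : State := { σ with t := t' }
  let σ ← forList (closeGate I) (← eventsAt ev.loAt t) σ
  let σ ← forList (enterCellEnd I) (← eventsAt ev.topAt t') σ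
  let σ ← forList (refresh I) (← eventsAt ev.flipT t) σ
  forList (refresh I) (← eventsAt ev.flipT t') σ

/-! ## The whole sweep -/

/-- Enter the cell `i` if it has a point at the initial height. -/
def initCell (i : ℕ) (σ : State) : Timed State := do
  tick
  if I.left i (I.height σ.s) ≠ ⊤ then enterCell i σ else return σ

/-- Open the gate `k` if it contains the initial height. -/
def initGate (k : ℕ) (σ : State) : Timed State := do
  tick
  match I.gate k with
  | none => return σ
  | some (lo, hi) =>
    if lo ≤ I.height σ.s ∧ I.height σ.s ≤ hi then openGate I k σ else return σ

/-- Compute the state for the subedge `e[s,t]` where `s = t` is the height number `a`. -/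
def initialState (a : ℕ) : Timed State := do
  tick
  let D ← depthFor I.numCells I.numCells 1 0
  let T ← Trie.empty D
  let σ ← forRange leaveGate I.numCells 0 ⟨a, a, T, T, T, T, T, T⟩
  let σ ← forRange (initCell I) I.numCells 0 σ
  let σ ← forRange (initGate I) I.numCells 0 σ
  forRange (fun i σ => refreshLocal I σ i) I.numCells 0 σ

/-- The body of the main loop, for the pair `(s', t')`. -/
def loopBody (ev : Events) (p : ℕ × ℕ) (σ : State) : Timed State := do
  tick
  let σ ← if p.1 ≠ σ.s then advanceStart I ev σ p.1 else pure σ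
  if p.2 ≠ σ.t then advanceEnd I ev σ p.2 else return σ

/-- The main loop. The result is the list of the states before the first iteration and after each
iteration. -/
def mainLoop (ev : Events) : List (ℕ × ℕ) → State → Timed (List State)
  | [], σ => do
    tick
    return [σ]
  | p :: ps, σ => do
    tick
    let σ' ← loopBody I ev p σ
    let rest ← mainLoop ev ps σ'
    return σ :: rest

/-- `Maintain`: the sweep along the sweep-sequence `𝔰`, which is processed from its last pair to its
first one. The result is the list of the states before the first iteration and after each
iteration of the main loop. -/
def maintain (𝔰 : List (ℕ × ℕ)) : Timed (List State) := do
  tick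
  let rev ← reverseOnto 𝔰 []
  match rev with
  | [] => return []
  | (a, _) :: _ =>
    let ev ← computeEvents I
    let σ ← initialState I a
    mainLoop I ev rev σ

end Algorithm

/-- The input of the algorithm for the curve `P`, the approximate free space `A`, and the heights
`ε 0 < … < ε (m - 1)`. -/
noncomputable def sweepInput {d : ℕ} (P : PolygonalCurve d) (A : Set (ℝ × ℝ)) (m : ℕ) (ε : ℕ → ℝ) :
    SweepInput ℝ :=
  open Classical in
  { numCells := P.numEdges
    range := fun i =>
      if i < P.numEdges ∧ (cellPart P A i).Nonempty then
        some (sInf (Prod.snd '' cellPart P A i), sSup (Prod.snd '' cellPart P A i))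
      else none
    topX := fun i => sSup (Prod.fst '' topmost P A i)
    botX := fun i => sInf (Prod.fst '' bottommost P A i)
    gate := fun i =>
      if i + 1 < P.numEdges ∧ ∃ y, (P.knot (i + 1), y) ∈ A then
        some (sInf {y | (P.knot (i + 1), y) ∈ A}, sSup {y | (P.knot (i + 1), y) ∈ A})
      else none
    left := cellLeft P A
    right := cellRight P A
    numHeights := m
    height := ε }

end SubtrajSweep

open SubtrajSweep

namespace SubtrajSweep

/-! # Specifications of timed programs -/

/-- The program `x` takes at most `c` steps and its result satisfies `Q`. -/
def Timed.Spec {α : Type*} (x : Timed α) (c : ℕ) (Q : α → Prop) : Prop :=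
  Q x.val ∧ x.steps ≤ c

theorem Timed.Spec.bind {α β : Type} {x : Timed α} {f : α → Timed β} {c c' : ℕ} {Q : α → Prop}
    {R : β → Prop} (hx : x.Spec c' Q) (hc : c' ≤ c) (hf : ∀ a, Q a → (f a).Spec (c - c') R) :
    (x >>= f).Spec c R := by
  obtain ⟨h1, h2⟩ := hx
  obtain ⟨h3, h4⟩ := hf _ h1
  refine ⟨h3, ?_⟩
  change x.steps + (f x.val).steps ≤ c
  omega

theorem Timed.Spec.pure {α : Type} {a : α} {c : ℕ} {Q : α → Prop} (h : Q a) :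
    (Pure.pure a : Timed α).Spec c Q := ⟨h, Nat.zero_le _⟩

theorem Timed.Spec.tick {β : Type} {f : PUnit → Timed β} {c : ℕ} {R : β → Prop} (hc : 1 ≤ c)
    (hf : (f ⟨⟩).Spec (c - 1) R) : (SubtrajSweep.tick >>= f).Spec c R :=
  Timed.Spec.bind (Q := fun _ => True) ⟨trivial, le_refl _⟩ hc fun _ _ => hf

theorem Timed.Spec.mono {α : Type*} {x : Timed α} {c c' : ℕ} {Q R : α → Prop} (h : x.Spec c Q)
    (hc : c ≤ c') (hQ : ∀ a, Q a → R a) : x.Spec c' R := ⟨hQ _ h.1, h.2.trans hc⟩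

/-! # Tries -/

namespace Trie

variable {β : Type}

/-- The finite map that is represented by a trie. -/
def fn (t : Trie β) (k : ℕ) : Option β := (t.find k).val

/-- `t` is a complete binary tree of depth `D` whose inner nodes store correct data. -/
def WF : ℕ → Trie β → Prop
  | 0, leaf _ => True
  | 0, node _ _ _ _ => False
  | _ + 1, leaf _ => False
  | D + 1, node h c l r => h = 2 ^ D ∧ WF D l ∧ WF D r ∧
      c = (match r.last with | some v => some v | none => l.last)

theorem fn_leaf (v : Option β) (k : ℕ) : (leaf v).fn k = if k = 0 then v else none := rfl

theorem find_node (h : ℕ) (c : Option β) (l r : Trie β) (k : ℕ) :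
    (node h c l r).find k = (do tick; if k < h then l.find k else r.find (k - h)) := rfl

theorem maxEntry_node (h : ℕ) (c : Option β) (l r : Trie β) :
    (node h c l r).maxEntry = (do
      tick
      if c.isNone then return none
      else if r.last.isSome then return shift h (← r.maxEntry)
      else l.maxEntry) := rfl

theorem minEntry_node (h : ℕ) (c : Option β) (l r : Trie β) :
    (node h c l r).minEntry = (do
      tick
      if c.isNone then return none
      else if l.last.isSome then l.minEntry
      else return shift h (← r.minEntry)) := rfl

theorem pred_node (h : ℕ) (c : Option β) (l r : Trie β) (k : ℕ) :
    (node h c l r).pred k = (do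
      tick
      if k < h then l.pred k
      else
        match ← r.pred (k - h) with
        | some e => return shift h (some e)
        | none => l.maxEntry) := rfl

theorem succ_node (h : ℕ) (c : Option β) (l r : Trie β) (k : ℕ) :
    (node h c l r).succ k = (do
      tick
      if k < h then
        match ← l.succ k with
        | some e => return some e
        | none => return shift h (← r.minEntry)
      else return shift h (← r.succ (k - h))) := rfl

theorem last_node (h : ℕ) (c : Option β) (l r : Trie β) : (node h c l r).last = c := rfl

theorem last_leaf (v : Option β) : (leaf v).last = v := rfl

theorem fn_node (h : ℕ) (c : Option β) (l r : Trie β) (k : ℕ) :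
    (node h c l r).fn k = if k < h then l.fn k else r.fn (k - h) := by
  unfold fn
  conv_lhs => unfold find
  split <;> rfl

theorem fn_eq_none {D : ℕ} {t : Trie β} (ht : t.WF D) {k : ℕ} (hk : 2 ^ D ≤ k) :
    t.fn k = none := by
  induction D generalizing t k with
  | zero =>
    cases t with
    | leaf v => rw [fn_leaf, if_neg (by simp at hk; omega)]
    | node => exact ht.elim
  | succ D ih =>
    cases t with
    | leaf v => exact ht.elim
    | node h c l r =>
      obtain ⟨rfl, hl, hr, -⟩ := ht
      rw [pow_succ] at hk
      rw [fn_node, if_neg (by omega)]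
      exact ih hr (by omega)

theorem lt_of_fn_eq_some {D : ℕ} {t : Trie β} (ht : t.WF D) {k : ℕ} {v : β} (h : t.fn k = some v) :
    k < 2 ^ D := by
  by_contra hk
  simp [fn_eq_none ht (not_lt.1 hk)] at h

theorem steps_find {D : ℕ} {t : Trie β} (ht : t.WF D) (k : ℕ) : (t.find k).steps ≤ D + 1 := by
  induction D generalizing t k with
  | zero =>
    cases t with
    | leaf v => exact le_refl 1
    | node => exact ht.elim
  | succ D ih =>
    cases t with
    | leaf v => exact ht.elim
    | node h c l r =>
      obtain ⟨rfl, hl, hr, -⟩ := ht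
      rw [find_node]
      have h1 := ih hl k
      have h2 := ih hr (k - 2 ^ D)
      by_cases hk : k < 2 ^ D
      · simp only [if_pos hk]; change 1 + (l.find k).steps ≤ _; omega
      · simp only [if_neg hk]; change 1 + (r.find (k - 2 ^ D)).steps ≤ _; omega

theorem find_spec {D : ℕ} {t : Trie β} (ht : t.WF D) (k : ℕ) :
    (t.find k).Spec (D + 1) fun r => r = t.fn k := ⟨rfl, steps_find ht k⟩

theorem wf_mk {D : ℕ} {l r : Trie β} (hl : l.WF D) (hr : r.WF D) : (mk (2 ^ D) l r).WF (D + 1) := by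
  unfold mk
  split <;> exact ⟨rfl, hl, hr, by simp [*]⟩

theorem fn_mk (h : ℕ) (l r : Trie β) (k : ℕ) :
    (mk h l r).fn k = if k < h then l.fn k else r.fn (k - h) := by
  unfold mk
  split <;> exact fn_node ..

theorem set_spec {D : ℕ} {t : Trie β} (ht : t.WF D) (k : ℕ) (w : Option β) :
    (t.set k w).Spec (D + 1) fun t' => t'.WF D ∧
      (k < 2 ^ D → t'.fn = Function.update t.fn k w) := by
  induction D generalizing t k with
  | zero =>
    cases t with
    | leaf v =>
      unfold set
      refine .tick le_add_self <| .pure ⟨trivial, fun hk => ?_⟩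
      funext j
      simp at hk
      subst hk
      rcases eq_or_ne j 0 with rfl | hj
      · simp [fn_leaf]
      · simp [fn_leaf, hj]
    | node => exact ht.elim
  | succ D ih =>
    cases t with
    | leaf v => exact ht.elim
    | node h c l r =>
      obtain ⟨rfl, hl, hr, -⟩ := ht
      unfold set
      refine .tick (by omega) ?_
      split_ifs with hk
      · refine .bind (ih hl k) (by omega) fun l' hl' => .pure ⟨wf_mk hl'.1 hr, fun _ => ?_⟩
        funext j
        rw [fn_mk, hl'.2 hk, Function.update_apply, Function.update_apply, fn_node]
        split_ifs <;> first | rfl | omega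
      · refine .bind (ih hr (k - 2 ^ D)) (by omega)
          fun r' hr' => .pure ⟨wf_mk hl hr'.1, fun hk' => ?_⟩
        rw [pow_succ] at hk'
        funext j
        rw [fn_mk, hr'.2 (by omega), Function.update_apply, Function.update_apply, fn_node]
        split_ifs <;> first | rfl | omega

theorem empty_spec (D : ℕ) :
    (empty D : Timed (Trie β)).Spec (D + 1) fun t => t.WF D ∧ t.last = none ∧
      t.fn = fun _ => none := by
  induction D with
  | zero =>
    refine .tick (by omega) <| .pure ⟨trivial, rfl, ?_⟩
    funext k
    simp [fn_leaf]
  | succ D ih =>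
    refine .tick (by omega) <| .bind ih (by omega) fun t ht => .pure ⟨⟨rfl, ht.1, ht.1, ?_⟩, rfl, ?_⟩
    · simp [ht.2.1]
    · funext k
      simp [fn_node, ht.2.2]

/-- What is stored at the root: the value at the largest key. -/
theorem last_spec {D : ℕ} {t : Trie β} (ht : t.WF D) :
    (t.last = none → ∀ k, t.fn k = none) ∧
    (∀ v, t.last = some v → ∃ a, t.fn a = some v ∧ ∀ k, a < k → t.fn k = none) := by
  induction D generalizing t with
  | zero =>
    cases t with
    | leaf v =>
      refine ⟨fun h k => ?_, fun w h => ⟨0, ?_, fun k hk => ?_⟩⟩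
      · rw [fn_leaf]; rw [last_leaf] at h; simp [h]
      · rw [fn_leaf]; rw [last_leaf] at h; simp [h]
      · rw [fn_leaf, if_neg (by omega)]
    | node => exact ht.elim
  | succ D ih =>
    cases t with
    | leaf v => exact ht.elim
    | node h c l r =>
      obtain ⟨rfl, hl, hr, hc⟩ := ht
      rw [last_node]
      cases hrl : r.last with
      | some v =>
        simp only [hrl] at hc
        subst hc
        refine ⟨by simp, fun w hw => ?_⟩
        obtain ⟨a, h1, h2⟩ := (ih hr).2 w (hrl.trans hw)
        refine ⟨a + 2 ^ D, ?_, fun k hk => ?_⟩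
        · rw [fn_node, if_neg (by omega)]; simpa using h1
        · rw [fn_node, if_neg (by omega)]; exact h2 _ (by omega)
      | none =>
        simp only [hrl] at hc
        have hr0 := (ih hr).1 hrl
        refine ⟨fun h k => ?_, fun w hw => ?_⟩
        · rw [fn_node, hr0, (ih hl).1 (hc ▸ h)]; simp
        · obtain ⟨a, h1, h2⟩ := (ih hl).2 w (hc ▸ hw)
          refine ⟨a, ?_, fun k hk => ?_⟩
          · rw [fn_node, if_pos (lt_of_fn_eq_some hl h1)]; exact h1
          · rw [fn_node, hr0, h2 _ hk]; simp

/-- `e` is the entry with the largest key among those in `s`. -/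
def IsMaxEntry (f : ℕ → Option β) (s : Set ℕ) : Option (ℕ × β) → Prop
  | none => ∀ k ∈ s, f k = none
  | some (a, v) => a ∈ s ∧ f a = some v ∧ ∀ k ∈ s, a < k → f k = none

/-- `e` is the entry with the smallest key among those in `s`. -/
def IsMinEntry (f : ℕ → Option β) (s : Set ℕ) : Option (ℕ × β) → Prop
  | none => ∀ k ∈ s, f k = none
  | some (a, v) => a ∈ s ∧ f a = some v ∧ ∀ k ∈ s, k < a → f k = none

theorem isSome_last {D : ℕ} {t : Trie β} (ht : t.WF D) (h : t.last.isSome) :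
    ∃ k v, t.fn k = some v := by
  obtain ⟨v, hv⟩ := Option.isSome_iff_exists.1 h
  obtain ⟨a, ha, -⟩ := (last_spec ht).2 v hv
  exact ⟨a, v, ha⟩

theorem maxEntry_spec {D : ℕ} {t : Trie β} (ht : t.WF D) :
    t.maxEntry.Spec (if t.last = none then 1 else D + 1) (IsMaxEntry t.fn univ) := by
  induction D generalizing t with
  | zero =>
    cases t with
    | leaf v =>
      refine .tick (by split_ifs <;> omega) <| .pure ?_
      cases v with
      | none => intro k _; simp [fn_leaf]
      | some v => exact ⟨trivial, by simp [fn_leaf], fun k _ hk => by rw [fn_leaf, if_neg (by omega)]⟩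
    | node => exact ht.elim
  | succ D ih =>
    cases t with
    | leaf v => exact ht.elim
    | node h c l r =>
      have hlast := last_spec ht
      obtain ⟨rfl, hl, hr, hc⟩ := ht
      simp only [last_node, maxEntry_node] at hlast ⊢
      refine .tick ?_ ?_
      · cases c <;> simp
      cases c with
      | none =>
        simp only [Option.isNone_none, if_true]
        exact .pure fun k _ => hlast.1 rfl k
      | some v =>
        simp only [Option.isNone_some, Bool.false_eq_true, if_false, reduceCtorEq]
        split_ifs with h1
        · refine .bind (ih hr) (by split_ifs <;> omega) fun e he => .pure ?_
          cases e with
          | none =>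
            obtain ⟨k, w, hk⟩ := isSome_last hr h1
            simp [he k trivial] at hk
          | some e =>
            refine ⟨trivial, ?_, fun k _ hk => ?_⟩
            · rw [fn_node, if_neg (by omega)]; simpa using he.2.1
            · rw [fn_node, if_neg (by omega)]; exact he.2.2 _ trivial (by omega)
        · simp only [Option.not_isSome_iff_eq_none] at h1
          have hr0 := (last_spec hr).1 h1
          refine (ih hl).mono (by split_ifs <;> omega) fun e he => ?_
          cases e with
          | none => intro k _; rw [fn_node, hr0, he k trivial]; simp
          | some e =>
            refine ⟨trivial, ?_, fun k _ hk => ?_⟩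
            · rw [fn_node, if_pos (lt_of_fn_eq_some hl he.2.1)]; exact he.2.1
            · rw [fn_node, hr0, he.2.2 k trivial hk]; simp

theorem minEntry_spec {D : ℕ} {t : Trie β} (ht : t.WF D) :
    t.minEntry.Spec (if t.last = none then 1 else D + 1) (IsMinEntry t.fn univ) := by
  induction D generalizing t with
  | zero =>
    cases t with
    | leaf v =>
      refine .tick (by split_ifs <;> omega) <| .pure ?_
      cases v with
      | none => intro k _; simp [fn_leaf]
      | some v => exact ⟨trivial, by simp [fn_leaf], fun k _ hk => by omega⟩
    | node => exact ht.elim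
  | succ D ih =>
    cases t with
    | leaf v => exact ht.elim
    | node h c l r =>
      have hlast := last_spec ht
      obtain ⟨rfl, hl, hr, hc⟩ := ht
      simp only [last_node, minEntry_node] at hlast ⊢
      refine .tick ?_ ?_
      · cases c <;> simp
      cases c with
      | none =>
        simp only [Option.isNone_none, if_true]
        exact .pure fun k _ => hlast.1 rfl k
      | some v =>
        simp only [Option.isNone_some, Bool.false_eq_true, if_false, reduceCtorEq]
        split_ifs with h1
        · refine (ih hl).mono (by split_ifs <;> omega) fun e he => ?_
          cases e with
          | none =>
            obtain ⟨k, w, hk⟩ := isSome_last hl h1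
            simp [he k trivial] at hk
          | some e =>
            have := lt_of_fn_eq_some hl he.2.1
            refine ⟨trivial, ?_, fun k _ hk => ?_⟩
            · rw [fn_node, if_pos this]; exact he.2.1
            · rw [fn_node, if_pos (by omega), he.2.2 k trivial hk]
        · simp only [Option.not_isSome_iff_eq_none] at h1
          have hl0 := (last_spec hl).1 h1
          refine .bind (ih hr) (by split_ifs <;> omega) fun e he => .pure ?_
          cases e with
          | none => intro k _; rw [fn_node, hl0, he _ trivial]; simp
          | some e =>
            refine ⟨trivial, ?_, fun k _ hk => ?_⟩
            · rw [fn_node, if_neg (by omega)]; simpa using he.2.1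
            · rw [fn_node, hl0]
              split_ifs with hk'
              · rfl
              · exact he.2.2 _ trivial (by omega)

theorem isMaxEntry_of_empty {f : ℕ → Option β} {s : Set ℕ} {e : Option (ℕ × β)}
    (he : IsMaxEntry f s e) (h : ∀ k ∈ s, f k = none) : e = none := by
  cases e with
  | none => rfl
  | some e => have := he.2.1; simp [h _ he.1] at this

theorem isMinEntry_of_empty {f : ℕ → Option β} {s : Set ℕ} {e : Option (ℕ × β)}
    (he : IsMinEntry f s e) (h : ∀ k ∈ s, f k = none) : e = none := by
  cases e with
  | none => rfl
  | some e => have := he.2.1; simp [h _ he.1] at this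

theorem exists_of_last_ne_none {D : ℕ} {t : Trie β} (ht : t.WF D) (h : t.last ≠ none) :
    ∃ k v, t.fn k = some v := isSome_last ht (Option.isSome_iff_ne_none.2 h)

open Classical in
theorem pred_spec' {D : ℕ} {t : Trie β} (ht : t.WF D) (k : ℕ) :
    (t.pred k).Spec (2 * D + 1 + if ∀ a ∈ Iic k, t.fn a = none then 0 else D)
      (IsMaxEntry t.fn (Iic k)) := by
  induction D generalizing t k with
  | zero =>
    cases t with
    | leaf v =>
      refine .tick (by omega) <| .pure ?_
      cases v with
      | none => intro k _; simp [fn_leaf]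
      | some v => exact ⟨Nat.zero_le _, by simp [fn_leaf],
          fun k _ hk => by rw [fn_leaf, if_neg (by omega)]⟩
    | node => exact ht.elim
  | succ D ih =>
    cases t with
    | leaf v => exact ht.elim
    | node h c l r =>
      obtain ⟨rfl, hl, hr, hc⟩ := ht
      rw [pred_node]
      refine .tick (by omega) ?_
      by_cases hk : k < 2 ^ D
      · rw [if_pos hk]
        have hl' : ∀ a ∈ Iic k, (node (2 ^ D) c l r).fn a = l.fn a := by
          intro a ha
          rw [fn_node, if_pos (by simp at ha; omega)]
        have : (∀ a ∈ Iic k, (node (2 ^ D) c l r).fn a = none) ↔ ∀ a ∈ Iic k, l.fn a = none :=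
          forall₂_congr fun a ha => by rw [hl' a ha]
        simp only [this]
        refine (ih hl k).mono (by split_ifs <;> omega) fun e he => ?_
        cases e with
        | none => intro j hj; rw [hl' j hj]; exact he j hj
        | some e =>
          refine ⟨he.1, (hl' _ he.1).trans he.2.1, fun j hj hj' => ?_⟩
          rw [hl' j hj]; exact he.2.2 j hj hj'
      rw [if_neg hk]
      by_cases hr0 : ∀ a ∈ Iic (k - 2 ^ D), r.fn a = none
      · refine .bind (ih hr _) (by simp only [if_pos hr0]; omega) fun e he => ?_
        obtain rfl := isMaxEntry_of_empty he hr0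
        simp only [if_pos hr0]
        refine (maxEntry_spec hl).mono ?_ fun e' he' => ?_
        · by_cases h1 : l.last = none
          · rw [if_pos h1]; omega
          · rw [if_neg h1, if_neg]
            · omega
            · intro h2
              obtain ⟨j, w, hw⟩ := exists_of_last_ne_none hl h1
              have := lt_of_fn_eq_some hl hw
              have := h2 j (by simp; omega)
              rw [fn_node, if_pos (by omega)] at this
              simp [this] at hw
        · cases e' with
          | none =>
            intro j hj
            rw [fn_node]
            split_ifs with hj'
            · exact he' j trivial
            · exact he (j - 2 ^ D) (by simp at hj ⊢; omega)
          | some e' =>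
            have := lt_of_fn_eq_some hl he'.2.1
            refine ⟨by simp; omega, ?_, fun j hj hj' => ?_⟩
            · rw [fn_node, if_pos this]; exact he'.2.1
            · rw [fn_node]
              split_ifs with hj''
              · exact he'.2.2 j trivial hj'
              · exact he (j - 2 ^ D) (by simp at hj ⊢; omega)
      · have h0 : ¬ ∀ a ∈ Iic k, (node (2 ^ D) c l r).fn a = none := by
          intro h0
          refine hr0 fun a ha => ?_
          have := h0 (a + 2 ^ D) (by simp at ha ⊢; omega)
          rw [fn_node, if_neg (by omega)] at this
          simpa using this
        simp only [if_neg h0]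
        refine .bind (ih hr _) (by split_ifs; omega) fun e he => ?_
        cases e with
        | none => exact absurd he hr0
        | some e =>
          refine .pure ?_
          have := he.1
          refine ⟨by simp at this ⊢; omega, ?_, fun j hj hj' => ?_⟩
          · rw [fn_node, if_neg (by omega)]; simpa using he.2.1
          · rw [fn_node, if_neg (by omega)]
            exact he.2.2 _ (by simp at hj ⊢; omega) (by omega)

theorem pred_spec {D : ℕ} {t : Trie β} (ht : t.WF D) (k : ℕ) :
    (t.pred k).Spec (3 * (D + 1)) (IsMaxEntry t.fn (Iic k)) :=
  (pred_spec' ht k).mono (by split_ifs <;> omega) fun _ h => h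

open Classical in
theorem succ_spec' {D : ℕ} {t : Trie β} (ht : t.WF D) (k : ℕ) :
    (t.succ k).Spec (2 * D + 1 + if ∀ a ∈ Ici k, t.fn a = none then 0 else D)
      (IsMinEntry t.fn (Ici k)) := by
  induction D generalizing t k with
  | zero =>
    cases t with
    | leaf v =>
      refine .tick (by omega) <| .pure ?_
      by_cases hk : k = 0
      · rw [if_pos hk]
        cases v with
        | none => intro k _; simp [fn_leaf]
        | some v => exact ⟨by simp [hk], by simp [fn_leaf], fun k _ hk => by omega⟩
      · rw [if_neg hk]
        intro j hj
        rw [fn_leaf, if_neg (by simp at hj; omega)]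
    | node => exact ht.elim
  | succ D ih =>
    cases t with
    | leaf v => exact ht.elim
    | node h c l r =>
      obtain ⟨rfl, hl, hr, hc⟩ := ht
      rw [succ_node]
      refine .tick (by omega) ?_
      by_cases hk : ¬ k < 2 ^ D
      · rw [if_neg hk]
        have hiff : (∀ a ∈ Ici k, (node (2 ^ D) c l r).fn a = none) ↔
            ∀ a ∈ Ici (k - 2 ^ D), r.fn a = none := by
          constructor
          · intro h a ha
            have := h (a + 2 ^ D) (by simp at ha ⊢; omega)
            rw [fn_node, if_neg (by omega)] at this
            simpa using this
          · intro h a ha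
            simp at ha
            rw [fn_node, if_neg (by omega)]
            exact h _ (by simp; omega)
        simp only [hiff]
        refine .bind (ih hr _) (by split_ifs <;> omega) fun e he => .pure ?_
        cases e with
        | none => exact hiff.2 he
        | some e =>
          have := he.1
          simp at this
          refine ⟨by simp; omega, ?_, fun j hj hj' => ?_⟩
          · rw [fn_node, if_neg (by omega)]; simpa using he.2.1
          · simp at hj
            rw [fn_node, if_neg (by omega)]
            exact he.2.2 _ (by simp; omega) (by omega)
      rw [not_not] at hk
      rw [if_pos hk]
      by_cases hl0 : ∀ a ∈ Ici k, l.fn a = none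
      · refine .bind (ih hl _) (by simp only [if_pos hl0]; omega) fun e he => ?_
        obtain rfl := isMinEntry_of_empty he hl0
        simp only [if_pos hl0]
        refine .bind (minEntry_spec hr) ?_ fun e' he' => .pure ?_
        · by_cases h1 : r.last = none
          · rw [if_pos h1]; omega
          · rw [if_neg h1, if_neg]
            · omega
            · intro h2
              obtain ⟨j, w, hw⟩ := exists_of_last_ne_none hr h1
              have := h2 (j + 2 ^ D) (by simp; omega)
              rw [fn_node, if_neg (by omega)] at this
              simp [hw] at this
        · cases e' with
          | none =>
            intro j hj
            rw [fn_node]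
            split_ifs with hj'
            · exact hl0 j hj
            · exact he' _ trivial
          | some e' =>
            refine ⟨by simp; omega, ?_, fun j hj hj' => ?_⟩
            · rw [fn_node, if_neg (by omega)]; simpa using he'.2.1
            · rw [fn_node]
              split_ifs
              · exact hl0 j hj
              · exact he'.2.2 _ trivial (by omega)
      · have h0 : ¬ ∀ a ∈ Ici k, (node (2 ^ D) c l r).fn a = none := by
          intro h0
          refine hl0 fun a ha => ?_
          by_cases ha' : a < 2 ^ D
          · have := h0 a ha
            rwa [fn_node, if_pos ha'] at this
          · exact fn_eq_none hl (by omega)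
        simp only [if_neg h0]
        refine .bind (ih hl _) (by split_ifs; omega) fun e he => ?_
        cases e with
        | none => exact absurd he hl0
        | some e =>
          have h1 := lt_of_fn_eq_some hl he.2.1
          refine .pure ⟨he.1, ?_, fun j hj hj' => ?_⟩
          · rw [fn_node, if_pos h1]; exact he.2.1
          · rw [fn_node, if_pos (by omega)]; exact he.2.2 j hj hj'

theorem succ_spec {D : ℕ} {t : Trie β} (ht : t.WF D) (k : ℕ) :
    (t.succ k).Spec (3 * (D + 1)) (IsMinEntry t.fn (Ici k)) :=
  (succ_spec' ht k).mono (by split_ifs <;> omega) fun _ h => h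

/-- `e` is the entry with the smallest key among those of value at least `j`. -/
def IsFirstGE (f : ℕ → Option ℕ) (j : ℕ) : Option (ℕ × ℕ) → Prop
  | none => ∀ k v, f k = some v → v < j
  | some (a, v) => f a = some v ∧ j ≤ v ∧ ∀ k w, f k = some w → k < a → w < j

theorem firstGE_spec {D : ℕ} {t : Trie ℕ} (ht : t.WF D)
    (hmono : ∀ a a' v v', t.fn a = some v → t.fn a' = some v' → a < a' → v < v') (j : ℕ) :
    (t.firstGE j).Spec (D + 1) (IsFirstGE t.fn j) := by
  induction D generalizing t with
  | zero =>
    cases t with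
    | leaf v =>
      refine .tick (by omega) ?_
      cases v with
      | none => refine .pure ?_; intro k w h; simp [fn_leaf] at h
      | some v =>
        simp only
        split_ifs with h
        · exact .pure ⟨by simp [fn_leaf], h, fun k w _ hk => by omega⟩
        · refine .pure ?_
          intro k w h'
          simp [fn_leaf] at h'
          omega
    | node => exact ht.elim
  | succ D ih =>
    cases t with
    | leaf v => exact ht.elim
    | node h c l r =>
      obtain ⟨rfl, hl, hr, hc⟩ := ht
      have hml : ∀ a a' v v', l.fn a = some v → l.fn a' = some v' → a < a' → v < v' := by
        intro a a' v v' h1 h2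
        refine hmono a a' v v' ?_ ?_
        · rw [fn_node, if_pos (lt_of_fn_eq_some hl h1), h1]
        · rw [fn_node, if_pos (lt_of_fn_eq_some hl h2), h2]
      have hmr : ∀ a a' v v', r.fn a = some v → r.fn a' = some v' → a < a' → v < v' := by
        intro a a' v v' h1 h2 h3
        refine hmono (a + 2 ^ D) (a' + 2 ^ D) v v' ?_ ?_ (by omega)
        · rw [fn_node, if_neg (by omega)]; simpa using h1
        · rw [fn_node, if_neg (by omega)]; simpa using h2
      have key : (∀ k v, l.fn k = some v → v < j) → ∀ e, IsFirstGE r.fn j e →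
          IsFirstGE (node (2 ^ D) c l r).fn j (shift (2 ^ D) e) := by
        intro hl0 e he
        cases e with
        | none =>
          intro k v h
          rw [fn_node] at h
          split_ifs at h
          · exact hl0 _ _ h
          · exact he _ _ h
        | some e =>
          refine ⟨?_, he.2.1, fun k w h hk => ?_⟩
          · rw [fn_node, if_neg (by omega)]; simpa using he.1
          · rw [fn_node] at h
            split_ifs at h
            · exact hl0 _ _ h
            · exact he.2.2 _ _ h (by omega)
      refine .tick (by omega) ?_
      have hls := last_spec hl
      cases hll : l.last with
      | none =>
        refine .bind (ih hr hmr) (by omega) fun e he => .pure (key ?_ e he)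
        intro k v h
        simp [hls.1 hll] at h
      | some x =>
        obtain ⟨a, ha, ha'⟩ := hls.2 x hll
        simp only
        split_ifs with h
        · refine (ih hl hml).mono (by omega) fun e he => ?_
          cases e with
          | none => have := he _ _ ha; omega
          | some e =>
            refine ⟨?_, he.2.1, fun k w h hk => ?_⟩
            · rw [fn_node, if_pos (lt_of_fn_eq_some hl he.1)]; exact he.1
            · have := lt_of_fn_eq_some hl he.1
              rw [fn_node, if_pos (by omega)] at h
              exact he.2.2 _ _ h hk
        · refine .bind (ih hr hmr) (by omega) fun e he => .pure (key ?_ e he)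
          intro k v hk
          rcases lt_trichotomy k a with h1 | h1 | h1
          · have := hml _ _ _ _ hk ha h1; omega
          · subst h1; rw [ha] at hk; cases hk; omega
          · simp [ha' k h1] at hk

end Trie

end SubtrajSweep

namespace SubtrajSweep

/-! # Merging neighbouring index-pairs -/

/-- `H` represents a partition of the index-pairs of `G` into runs: a run whose first start is `x`
and whose last end is `z` is stored as `H x = some z`. -/
structure IsRunMap (G H : ℕ → Option ℕ) : Prop where
  sub : ∀ a, H a ≠ none → G a ≠ none
  first : ∀ a, G a ≠ none → (∀ a' < a, G a' = none) → H a ≠ none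
  val : ∀ x z, H x = some z → ∃ y, x ≤ y ∧ G y = some z ∧ (∀ w, x < w → w ≤ y → H w = none) ∧
    ∀ y', y < y' → G y' ≠ none → ∃ w, y < w ∧ w ≤ y' ∧ H w ≠ none

/-- The runs of `H` are separated according to the rule for merging, except possibly at starts
in `pend`. -/
def LinkOK (bad : ℕ → Bool) (pend : Set ℕ) (G H : ℕ → Option ℕ) : Prop :=
  ∀ c d a, G c = some d → G a ≠ none → c < a → (∀ w, c < w → w < a → G w = none) →
    a ∉ pend → (H a = none ↔ a < d ∨ a = d ∧ bad a = false)

theorem IsRunMap.exists_head_le {G H : ℕ → Option ℕ} (h : IsRunMap G H) {a : ℕ} (ha : G a ≠ none) :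
    ∃ x ≤ a, H x ≠ none := by
  classical
  have hex : ∃ x, G x ≠ none := ⟨a, ha⟩
  exact ⟨Nat.find hex, Nat.find_min' hex ha, h.first _ (Nat.find_spec hex) fun a' ha' => by
    simpa using Nat.find_min hex ha'⟩

theorem IsRunMap.cut {G H : ℕ → Option ℕ} (h : IsRunMap G H) {a c d x z : ℕ} (ha : G a ≠ none)
    (hc : G c = some d) (hca : c < a) (hcons : ∀ w, c < w → w < a → G w = none)
    (hHa : H a = none) (hx : H x = some z) (hxa : x ≤ a) (hmax : ∀ w, x < w → w ≤ a → H w = none) :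
    IsRunMap G (Function.update (Function.update H x (some d)) a (some z)) := by
  have hxa' : x < a := lt_of_le_of_ne hxa (by rintro rfl; simp [hHa] at hx)
  have hxc : x ≤ c := by
    by_contra hxc
    exact h.sub x (by simp [hx]) (hcons x (by omega) hxa')
  have hup : ∀ w, H w ≠ none →
      (Function.update (Function.update H x (some d)) a (some z)) w ≠ none := by
    intro w hw
    simp only [Function.update_apply]
    split_ifs <;> simp [hw]
  refine ⟨fun w hw => ?_, fun w h1 h2 => hup _ (h.first w h1 h2), fun x0 z0 h0 => ?_⟩
  · simp only [Function.update_apply] at hw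
    split_ifs at hw with h1 h2
    · exact h1 ▸ ha
    · exact h.sub w (by rw [h2, hx]; simp)
    · exact h.sub w hw
  obtain ⟨y, hy1, hy2, hy3, hy4⟩ := h.val x z hx
  have hay : a ≤ y := by
    by_contra hay
    obtain ⟨w, h1, h2, h3⟩ := hy4 a (by omega) ha
    exact h3 (hmax w (by omega) h2)
  simp only [Function.update_apply] at h0
  split_ifs at h0 with h1 h2
  · subst h1
    obtain rfl : z = z0 := by simpa using h0
    refine ⟨y, hay, hy2, fun w h3 h4 => ?_, fun y' h3 h4 => ?_⟩
    · simp only [Function.update_apply]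
      rw [if_neg (by omega), if_neg (by omega)]
      exact hy3 w (by omega) h4
    · obtain ⟨w, h5, h6, h7⟩ := hy4 y' h3 h4
      exact ⟨w, h5, h6, hup w h7⟩
  · subst h2
    obtain rfl : d = z0 := by simpa using h0
    refine ⟨c, hxc, hc, fun w h3 h4 => ?_, fun y' h3 h4 => ⟨a, hca, ?_, by simp⟩⟩
    · simp only [Function.update_apply]
      rw [if_neg (by omega), if_neg (by omega)]
      exact hmax w h3 (by omega)
    · by_contra h5
      exact h4 (hcons y' h3 (by omega))
  · obtain ⟨y0, h3, h4, h5, h6⟩ := h.val x0 z0 h0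
    refine ⟨y0, h3, h4, fun w h7 h8 => ?_, fun y' h7 h8 => ?_⟩
    · have hwx : w ≠ x := by
        rintro rfl
        simp [h5 w h7 h8] at hx
      have hwa : w ≠ a := by
        rintro rfl
        rcases lt_or_ge x x0 with h9 | h9
        · simp [hmax x0 h9 (by omega)] at h0
        · simp [h5 x (by omega) (by omega)] at hx
      simp only [Function.update_apply]
      rw [if_neg hwa, if_neg hwx]
      exact h5 w h7 h8
    · obtain ⟨w, h9, h10, h11⟩ := h6 y' h7 h8
      exact ⟨w, h9, h10, hup w h11⟩

theorem IsRunMap.join {G H : ℕ → Option ℕ} (h : IsRunMap G H) {a c d x z x' : ℕ}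
    (hc : G c = some d) (hca : c < a) (hcons : ∀ w, c < w → w < a → G w = none)
    (hHa : H a = some z) (hx : H x = some x') (hxc : x ≤ c)
    (hmax : ∀ w, x < w → w ≤ c → H w = none) :
    IsRunMap G (Function.update (Function.update H a none) x (some z)) := by
  have hmax' : ∀ w, x < w → w < a → H w = none := by
    intro w h1 h2
    by_contra h3
    rcases le_or_gt w c with h4 | h4
    · exact h3 (hmax w h1 h4)
    · exact h.sub w h3 (hcons w h4 h2)
  have hup : ∀ w, w ≠ a → H w ≠ none →
      (Function.update (Function.update H a none) x (some z)) w ≠ none := by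
    intro w hw hw'
    simp only [Function.update_apply]
    split_ifs <;> simp [hw']
  refine ⟨fun w hw => ?_, fun w h1 h2 => hup _ ?_ (h.first w h1 h2), fun x0 z0 h0 => ?_⟩
  · simp only [Function.update_apply] at hw
    split_ifs at hw with h1 h2
    · exact h.sub w (by rw [h1, hx]; simp)
    · exact absurd rfl hw
    · exact h.sub w hw
  · rintro rfl
    simp [h2 c hca] at hc
  obtain ⟨y, hy1, hy2, hy3, hy4⟩ := h.val a z hHa
  simp only [Function.update_apply] at h0
  split_ifs at h0 with h1 h2
  · subst h1
    obtain rfl : z = z0 := by simpa using h0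
    refine ⟨y, by omega, hy2, fun w h3 h4 => ?_, fun y' h3 h4 => ?_⟩
    · simp only [Function.update_apply]
      rw [if_neg (by omega)]
      split_ifs with h5
      · rfl
      · rcases lt_or_ge w a with h6 | h6
        · exact hmax' w h3 h6
        · exact hy3 w (by omega) h4
    · obtain ⟨w, h5, h6, h7⟩ := hy4 y' h3 h4
      exact ⟨w, h5, h6, hup w (by omega) h7⟩
  · obtain ⟨y0, h3, h4, h5, h6⟩ := h.val x0 z0 h0
    have hcase : y0 < x ∨ a < x0 := by
      by_contra! hcon
      rcases lt_or_ge x x0 with h9 | h9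
      · simp [hmax' x0 h9 (by omega)] at h0
      · simp [h5 x (by omega) (by omega)] at hx
    refine ⟨y0, h3, h4, fun w h7 h8 => ?_, fun y' h7 h8 => ?_⟩
    · simp only [Function.update_apply]
      rw [if_neg (by omega)]
      split_ifs
      · rfl
      · exact h5 w h7 h8
    · obtain ⟨w, h9, h10, h11⟩ := h6 y' h7 h8
      rcases eq_or_ne w a with rfl | hw
      · exact ⟨x, by omega, by omega, by simp⟩
      · exact ⟨w, h9, h10, hup w hw h11⟩

theorem IsRunMap.insert {G H : ℕ → Option ℕ} (h : IsRunMap G H) {a : ℕ} (b : ℕ) (ha : G a = none)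
    (hnext : ∀ y', a < y' → G y' ≠ none → ∃ w, a < w ∧ w ≤ y' ∧ H w ≠ none) :
    IsRunMap (Function.update G a (some b)) (Function.update H a (some b)) := by
  have hup : ∀ w, H w ≠ none → Function.update H a (some b) w ≠ none := by
    intro w hw
    simp only [Function.update_apply]
    split_ifs <;> simp [hw]
  refine ⟨fun w hw => ?_, fun w h1 h2 => ?_, fun x z hx => ?_⟩
  · simp only [Function.update_apply] at hw ⊢
    split_ifs at hw ⊢
    · simp
    · exact h.sub w hw
  · rcases eq_or_ne w a with rfl | hw
    · simp
    · refine hup w (h.first w (by simpa [hw] using h1) fun a' ha' => ?_)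
      have := h2 a' ha'
      simp only [Function.update_apply] at this
      split_ifs at this
      exact this
  · simp only [Function.update_apply] at hx
    split_ifs at hx with h1
    · subst h1
      obtain rfl : b = z := by simpa using hx
      refine ⟨x, le_rfl, by simp, fun w h1 h2 => by omega, fun y' h1 h2 => ?_⟩
      rw [Function.update_of_ne (by omega)] at h2
      obtain ⟨w, h3, h4, h5⟩ := hnext y' h1 h2
      exact ⟨w, h3, h4, hup w h5⟩
    · obtain ⟨y, h3, h4, h5, h6⟩ := h.val x z hx
      have hya : y ≠ a := by rintro rfl; simp [ha] at h4
      have hay : ¬ (x < a ∧ a ≤ y) := by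
        rintro ⟨h7, h8⟩
        obtain ⟨w, h9, h10, h11⟩ := hnext y (by omega) (by simp [h4])
        exact h11 (h5 w (by omega) h10)
      refine ⟨y, h3, by simpa [hya] using h4, fun w h7 h8 => ?_, fun y' h7 h8 => ?_⟩
      · rw [Function.update_of_ne (by rintro rfl; exact hay ⟨h7, h8⟩)]
        exact h5 w h7 h8
      · rcases eq_or_ne y' a with rfl | hy'
        · exact ⟨y', h7, le_rfl, by simp⟩
        · rw [Function.update_of_ne hy'] at h8
          obtain ⟨w, h9, h10, h11⟩ := h6 y' h7 h8
          exact ⟨w, h9, h10, hup w h11⟩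

theorem IsRunMap.remove {G H : ℕ → Option ℕ} (h : IsRunMap G H) {a : ℕ} (ha : H a ≠ none)
    (hnext : ∀ y', a < y' → G y' ≠ none → ∃ w, a < w ∧ w ≤ y' ∧ H w ≠ none) :
    IsRunMap (Function.update G a none) (Function.update H a none) := by
  refine ⟨fun w hw => ?_, fun w h1 h2 => ?_, fun x z hx => ?_⟩
  · simp only [Function.update_apply] at hw ⊢
    split_ifs at hw ⊢
    · exact absurd rfl hw
    · exact h.sub w hw
  · have hwa : w ≠ a := by rintro rfl; simp at h1
    rw [Function.update_of_ne hwa] at h1 ⊢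
    have h2' : ∀ a' < w, a' ≠ a → G a' = none := by
      intro a' h3 h4
      have := h2 a' h3
      rwa [Function.update_of_ne h4] at this
    rcases lt_or_ge a w with h3 | h3
    · obtain ⟨w', h4, h5, h6⟩ := hnext w h3 h1
      rcases eq_or_ne w' w with rfl | h7
      · exact h6
      · exact absurd (h2' w' (by omega) (by omega)) (h.sub _ h6)
    · exact h.first w h1 fun a' h4 => h2' a' h4 (by omega)
  · simp only [Function.update_apply] at hx
    split_ifs at hx with h1
    · obtain ⟨y, h3, h4, h5, h6⟩ := h.val x z hx
      have hya : y ≠ a := by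
        rintro rfl
        exact ha (h5 y (by omega) le_rfl)
      refine ⟨y, h3, by simpa [hya] using h4, fun w h7 h8 => ?_, fun y' h7 h8 => ?_⟩
      · simp only [Function.update_apply]
        split_ifs
        · rfl
        · exact h5 w h7 h8
      · have hy' : y' ≠ a := by rintro rfl; simp at h8
        rw [Function.update_of_ne hy'] at h8
        obtain ⟨w, h9, h10, h11⟩ := h6 y' h7 h8
        rcases eq_or_ne w a with rfl | hw
        · obtain ⟨w', h12, h13, h14⟩ := hnext y' (by omega) h8
          exact ⟨w', by omega, h13, by rwa [Function.update_of_ne (by omega)]⟩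
        · exact ⟨w, h9, h10, by rwa [Function.update_of_ne hw]⟩

/-! # Updating the reduced global group -/

/-- All tries of the state are complete binary trees of depth `D`. -/
structure State.WF (D : ℕ) (σ : State) : Prop where
  U : σ.U.WF D
  L : σ.L.WF D
  G : σ.G.WF D
  Gr : σ.Gr.WF D
  starts : σ.starts.WF D
  cuts : σ.cuts.WF D

variable {K : Type} [LinearOrder K] (I : SweepInput K)

/-- The test whether `i` is bad, as a function of the indices of the heights. -/
def badAt (s t i : ℕ) : Bool :=
  match I.left i (I.height s), I.right i (I.height t) with
  | some x, some x' => I.topX i ≤ x && I.topX i ≤ x' && x ≤ I.botX i && x' ≤ I.botX i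
  | _, _ => false

theorem testBad_eq (σ : State) (i : ℕ) : testBad I σ i = badAt I σ.s σ.t i := rfl

variable {D : ℕ} {σ : State}

theorem prevPair_spec (hσ : σ.WF D) (a : ℕ) :
    (prevPair σ a).Spec (4 * (D + 1)) (Trie.IsMaxEntry σ.G.fn (Iio a)) := by
  refine .tick (by omega) ?_
  split_ifs with h
  · refine .pure ?_
    subst h
    intro k hk
    simp at hk
  · refine (Trie.pred_spec hσ.G _).mono (by omega) fun e he => ?_
    convert he using 1
    ext k
    simp
    omega

/-- The result of a procedure which changes only the reduced global group. -/
structure OnlyGr (D : ℕ) (σ σ' : State) (heads : ℕ → Prop) : Prop where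
  eq : σ' = { σ with Gr := σ'.Gr }
  wf : σ'.WF D
  run : IsRunMap σ.G.fn σ'.Gr.fn
  heads_iff : ∀ w, σ'.Gr.fn w ≠ none ↔ heads w

theorem cutAt_spec (hσ : σ.WF D) (hr : IsRunMap σ.G.fn σ.Gr.fn) {a : ℕ} (ha : σ.G.fn a ≠ none) :
    (cutAt σ a).Spec (11 * (D + 1))
      fun σ' => OnlyGr D σ σ' fun w => w = a ∨ σ.Gr.fn w ≠ none := by
  have haD : a < 2 ^ D := by
    obtain ⟨b, hb⟩ := Option.ne_none_iff_exists'.1 ha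
    exact Trie.lt_of_fn_eq_some hσ.G hb
  have hself : σ.Gr.fn a ≠ none → OnlyGr D σ σ fun w => w = a ∨ σ.Gr.fn w ≠ none :=
    fun h => ⟨rfl, hσ, hr, fun w => ⟨.inr, fun h' => h'.elim (fun h' => h' ▸ h) id⟩⟩
  refine .tick (by omega) <| .bind (prevPair_spec hσ a) (by omega) fun e he => ?_
  rcases e with _ | ⟨c, d⟩
  · exact .pure (hself (hr.first a ha he))
  refine .bind (Trie.find_spec hσ.Gr a) (by omega) fun e h => ?_
  subst h
  cases hGa : σ.Gr.fn a with
  | some => exact .pure (hself (by simp [hGa]))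
  | none =>
    refine .bind (Trie.pred_spec hσ.Gr a) (by omega) fun e h => ?_
    rcases e with _ | ⟨x, z⟩
    · obtain ⟨x, h1, h2⟩ := hr.exists_head_le ha
      exact absurd (h x h1) h2
    have hxD := Trie.lt_of_fn_eq_some hσ.Gr h.2.1
    refine .bind (Trie.set_spec hσ.Gr x (some d)) (by omega) fun T hT => ?_
    refine .bind (Trie.set_spec hT.1 a (some z)) (by omega) fun T' hT' => .pure ?_
    have hT'' := hT'.2 haD
    rw [hT.2 hxD] at hT''
    refine ⟨rfl, ⟨hσ.U, hσ.L, hσ.G, hT'.1, hσ.starts, hσ.cuts⟩, ?_, fun w => ?_⟩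
    · simp only [hT'']
      exact hr.cut ha he.2.1 he.1 (fun w h1 h2 => he.2.2 w h2 h1) hGa h.2.1 h.1
        fun w h1 h2 => h.2.2 w h2 h1
    · simp only [hT'', Function.update_apply]
      split_ifs with h1 h2
      · simp [h1]
      · simp [h2, h.2.1]
      · simp [h1]

theorem joinAt_spec (hσ : σ.WF D) (hr : IsRunMap σ.G.fn σ.Gr.fn) {a c d : ℕ}
    (hc : σ.G.fn c = some d) (hca : c < a) (ha : σ.G.fn a ≠ none) :
    (joinAt σ a).Spec (11 * (D + 1))
      fun σ' => OnlyGr D σ σ' fun w => w ≠ a ∧ σ.Gr.fn w ≠ none := by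
  refine .tick (by omega) <| .bind (prevPair_spec hσ a) (by omega) fun e he => ?_
  rcases e with _ | ⟨c, d⟩
  · exact absurd (he c hca) (by simp [hc])
  have haD : a < 2 ^ D := by
    obtain ⟨b, hb⟩ := Option.ne_none_iff_exists'.1 ha
    exact Trie.lt_of_fn_eq_some hσ.G hb
  refine .bind (Trie.find_spec hσ.Gr a) (by omega) fun e h => ?_
  subst h
  cases hGa : σ.Gr.fn a with
  | none => exact .pure ⟨rfl, hσ, hr, fun w => ⟨fun h => ⟨by rintro rfl; exact h hGa, h⟩, fun h => h.2⟩⟩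
  | some z =>
    refine .bind (Trie.pred_spec hσ.Gr c) (by omega) fun e h => ?_
    rcases e with _ | ⟨x, x'⟩
    · obtain ⟨x, h1, h2⟩ := hr.exists_head_le (a := c) (by simp [he.2.1])
      exact absurd (h x h1) h2
    have hxD := Trie.lt_of_fn_eq_some hσ.Gr h.2.1
    refine .bind (Trie.set_spec hσ.Gr a none) (by omega) fun T hT => ?_
    refine .bind (Trie.set_spec hT.1 x (some z)) (by omega) fun T' hT' => .pure ?_
    have hT'' := hT'.2 hxD
    rw [hT.2 haD] at hT''
    have h1 := he.1
    have h2 := h.1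
    simp only [mem_Iio, mem_Iic] at h1 h2
    refine ⟨rfl, ⟨hσ.U, hσ.L, hσ.G, hT'.1, hσ.starts, hσ.cuts⟩, ?_, fun w => ?_⟩
    · simp only [hT'']
      exact hr.join he.2.1 he.1 (fun w h1 h2 => he.2.2 w h2 h1) hGa h.2.1 h.1
        fun w h1 h2 => h.2.2 w h2 h1
    · simp only [hT'', Function.update_apply]
      split_ifs with h3 h4
      · subst h3; simp [h.2.1]; omega
      · simp [h4]
      · simp [h4]

theorem fixLink_spec (hσ : σ.WF D) (hr : IsRunMap σ.G.fn σ.Gr.fn) (a : ℕ) :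
    (fixLink I σ a).Spec (17 * (D + 1)) fun σ' => ∃ H : Prop,
      (OnlyGr D σ σ' fun w => (w ≠ a ∧ σ.Gr.fn w ≠ none) ∨ (w = a ∧ H)) ∧
      ∀ c d, σ.G.fn c = some d → σ.G.fn a ≠ none → c < a →
        (∀ w, c < w → w < a → σ.G.fn w = none) →
        (σ'.Gr.fn a = none ↔ a < d ∨ a = d ∧ badAt I σ.s σ.t a = false) := by
  have hself : ∀ w, σ.Gr.fn w ≠ none ↔ ((w ≠ a ∧ σ.Gr.fn w ≠ none) ∨ (w = a ∧ σ.Gr.fn a ≠ none)) := by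
    intro w
    rcases eq_or_ne w a with rfl | hw
    · simp
    · simp [hw]
  refine .tick (by omega) <| .bind (Trie.find_spec hσ.G a) (by omega) fun e h => ?_
  subst h
  cases hGa : σ.G.fn a with
  | none => exact .pure ⟨_, ⟨rfl, hσ, hr, hself⟩, fun c d _ h => absurd rfl h⟩
  | some b =>
    refine .bind (prevPair_spec hσ a) (by omega) fun e he => ?_
    rcases e with _ | ⟨c, d⟩
    · refine .pure ⟨_, ⟨rfl, hσ, hr, hself⟩, fun c d h _ h' => ?_⟩
      simp [he c h'] at h
    have huniq : ∀ c' d', σ.G.fn c' = some d' → c' < a →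
        (∀ w, c' < w → w < a → σ.G.fn w = none) → d' = d := by
      intro c' d' h1 h2 h3
      have h4 := he.2.1
      rcases lt_trichotomy c c' with h | h | h
      · simp [he.2.2 c' h2 h] at h1
      · subst h; rw [h1] at h4; simpa using h4
      · simp [h3 c h he.1] at h4
    change Timed.Spec (if a < d ∨ a = d ∧ badAt I σ.s σ.t a = false then joinAt σ a else cutAt σ a) _ _
    by_cases hl : a < d ∨ a = d ∧ badAt I σ.s σ.t a = false
    · rw [if_pos hl]
      refine (joinAt_spec hσ hr he.2.1 he.1 (by simp [hGa])).mono (by omega) fun σ' h' =>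
        ⟨False, ⟨h'.eq, h'.wf, h'.run, fun w => by rw [h'.heads_iff]; simp⟩, ?_⟩
      intro c' d' h1 h2 h3 h4
      rw [huniq c' d' h1 h3 h4]
      have := h'.heads_iff a
      simp only [ne_eq, not_true_eq_false, false_and, iff_false, not_not] at this
      simp [this, hl]
    · rw [if_neg hl]
      refine (cutAt_spec hσ hr (a := a) (by simp [hGa])).mono (by omega) fun σ' h' =>
        ⟨True, ⟨h'.eq, h'.wf, h'.run, fun w => by rw [h'.heads_iff]; tauto⟩, ?_⟩
      intro c' d' h1 h2 h3 h4
      rw [huniq c' d' h1 h3 h4]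
      have := h'.heads_iff a
      simp only [true_or, iff_true] at this
      simp [this, hl]

/-- The part of the invariant which concerns the reduced global group. -/
structure GrInv (pend : Set ℕ) (σ : State) : Prop where
  run : IsRunMap σ.G.fn σ.Gr.fn
  link : LinkOK (badAt I σ.s σ.t) pend σ.G.fn σ.Gr.fn

/-- The result of a procedure which changes the global group to `G` and updates the reduced
global group. -/
structure OnlyG (D : ℕ) (pend : Set ℕ) (σ σ' : State) (G : ℕ → Option ℕ) : Prop where
  eq : σ' = { σ with G := σ'.G, Gr := σ'.Gr }
  wf : σ'.WF D
  fn_G : σ'.G.fn = G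
  inv : GrInv I pend σ'

theorem OnlyG.refl {pend : Set ℕ} (hσ : σ.WF D) (hg : GrInv I pend σ) :
    OnlyG I D pend σ σ σ.G.fn := ⟨rfl, hσ, rfl, hg⟩

theorem OnlyG.trans {pend : Set ℕ} {σ₁ σ₂ σ₃ : State} {G G' : ℕ → Option ℕ}
    (h : OnlyG I D pend σ₁ σ₂ G) (h' : OnlyG I D pend σ₂ σ₃ G') : OnlyG I D pend σ₁ σ₃ G' := by
  refine ⟨?_, h'.wf, h'.fn_G, h'.inv⟩
  rw [h'.eq, h.eq]

/-- The next entry is a head after it has been cut off. -/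
theorem cutNext_spec (hσ : σ.WF D) (hr : IsRunMap σ.G.fn σ.Gr.fn) {a : ℕ} {next : Option (ℕ × ℕ)}
    (hn : Trie.IsMinEntry σ.G.fn (Ici (a + 1)) next) :
    Timed.Spec (match next with
      | some (c, _) => cutAt σ c
      | none => pure σ) (11 * (D + 1)) fun σ' =>
      (OnlyGr D σ σ' fun w => (∃ z, next = some (w, z)) ∨ σ.Gr.fn w ≠ none) ∧
      ∀ y', a < y' → σ.G.fn y' ≠ none → ∃ w, a < w ∧ w ≤ y' ∧ σ'.Gr.fn w ≠ none := by
  rcases next with _ | ⟨c, z⟩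
  · refine .pure ⟨⟨rfl, hσ, hr, fun w => by simp⟩, fun y' h1 h2 => ?_⟩
    exact absurd (hn y' h1) h2
  · refine (cutAt_spec hσ hr (a := c) (by simp [hn.2.1])).mono le_rfl fun σ' h' =>
      ⟨⟨h'.eq, h'.wf, h'.run, fun w => ?_⟩, fun y' h1 h2 => ?_⟩
    · rw [h'.heads_iff]
      simp [eq_comm]
    · refine ⟨c, hn.1, ?_, by rw [h'.heads_iff]; simp⟩
      by_contra h3
      exact h2 (hn.2.2 y' h1 (by omega))

theorem insertPair_spec {pend : Set ℕ} (hσ : σ.WF D) (hg : GrInv I pend σ) {a : ℕ} (b : ℕ)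
    (ha : σ.G.fn a = none) (haD : a < 2 ^ D) :
    (insertPair I σ a b).Spec (51 * (D + 1)) fun σ' =>
      OnlyG I D pend σ σ' (Function.update σ.G.fn a (some b)) := by
  refine .tick (by omega) <| .bind (Trie.succ_spec hσ.G (a + 1)) (by omega) fun next hn => ?_
  extract_lets jp
  have hcut := cutNext_spec hσ hg.run hn
  suffices hjp : ∀ σ₁, (OnlyGr D σ σ₁ fun w => (∃ z, next = some (w, z)) ∨ σ.Gr.fn w ≠ none) ∧
      (∀ y', a < y' → σ.G.fn y' ≠ none → ∃ w, a < w ∧ w ≤ y' ∧ σ₁.Gr.fn w ≠ none) →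
      (jp σ₁).Spec (36 * (D + 1)) fun σ' =>
        OnlyG I D pend σ σ' (Function.update σ.G.fn a (some b)) by
    rcases next with _ | ⟨c, z⟩
    all_goals exact hcut.bind (by omega) fun σ₁ h₁ => (hjp σ₁ h₁).mono (by omega) fun _ h => h
  rintro σ₁ ⟨h₁, hnext⟩
  have hG₁ : σ₁.G = σ.G := by rw [h₁.eq]
  refine .bind (Trie.set_spec h₁.wf.G a (some b)) (by omega) fun TG hTG => ?_
  refine .bind (Trie.set_spec h₁.wf.Gr a (some b)) (by omega) fun TH hTH => ?_
  have hTG' := hTG.2 haD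
  have hTH' := hTH.2 haD
  rw [hG₁] at hTG'
  have hrun : IsRunMap TG.fn TH.fn := by
    rw [hTG', hTH']
    exact h₁.run.insert b ha hnext
  refine .bind (fixLink_spec I (σ := { σ₁ with G := TG, Gr := TH }) (D := D)
    ⟨h₁.wf.U, h₁.wf.L, hTG.1, hTH.1, h₁.wf.starts, h₁.wf.cuts⟩ hrun a) (by omega)
    fun σ₂ ⟨H₂, h₂, hl₂⟩ => ?_
  have hG₂ : σ₂.G = TG := by rw [h₂.eq]
  have hs₂ : σ₂.s = σ.s := by rw [h₂.eq]; simp only; rw [h₁.eq]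
  have ht₂ : σ₂.t = σ.t := by rw [h₂.eq]; simp only; rw [h₁.eq]
  have hs₁ : σ₁.s = σ.s := by rw [h₁.eq]
  have ht₁ : σ₁.t = σ.t := by rw [h₁.eq]
  simp only [hs₁, ht₁] at hl₂
  -- links of all other pairs
  have hold : ∀ c d a', TG.fn c = some d → TG.fn a' ≠ none → c < a' →
      (∀ w, c < w → w < a' → TG.fn w = none) → a' ∉ pend → a' ≠ a → (∀ z, next ≠ some (a', z)) →
      (σ₂.Gr.fn a' = none ↔ a' < d ∨ a' = d ∧ badAt I σ.s σ.t a' = false) := by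
    intro c d a' h1 h2 h3 h4 h5 h6 h7
    simp only [hTG'] at h1 h2 h4
    have hca : c ≠ a := by
      rintro rfl
      rw [Function.update_of_ne h6] at h2
      rcases next with _ | ⟨c', z⟩
      · exact h2 (hn a' h3)
      · have hc' := hn.1
        have h8 := h7 z
        simp only [mem_Ici] at hc'
        have : a' ≠ c' := by rintro rfl; exact h8 rfl
        rcases lt_or_gt_of_ne this with h9 | h9
        · exact h2 (hn.2.2 a' h3 h9)
        · have := h4 c' (by omega) h9
          rw [Function.update_of_ne (by omega), hn.2.1] at this
          simp at this
    rw [Function.update_of_ne hca] at h1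
    rw [Function.update_of_ne h6] at h2
    have h4' : ∀ w, c < w → w < a' → σ.G.fn w = none := by
      intro w h8 h9
      have := h4 w h8 h9
      simp only [Function.update_apply] at this
      split_ifs at this
      exact this
    rw [← hg.link c d a' h1 h2 h3 h4' h5, ← not_iff_not]
    change σ₂.Gr.fn a' ≠ none ↔ σ.Gr.fn a' ≠ none
    rw [h₂.heads_iff]
    simp only [hTH', Function.update_of_ne h6]
    rw [h₁.heads_iff]
    simp [h7, h6]
  have heq₂ : σ₂ = { σ with G := σ₂.G, Gr := σ₂.Gr } := by
    conv_lhs => rw [h₂.eq]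
    rw [hG₂]
    conv_lhs => rw [h₁.eq]
  rcases next with _ | ⟨c', z⟩
  · refine .pure ⟨heq₂, h₂.wf, by rw [hG₂, hTG'], by rw [hG₂]; exact h₂.run, ?_⟩
    intro c d a' h1 h2 h3 h4 h5
    rw [hG₂] at h1 h2 h4
    rw [hs₂, ht₂]
    rcases eq_or_ne a' a with rfl | h6
    · exact hl₂ c d h1 h2 h3 h4
    · exact hold c d a' h1 h2 h3 h4 h5 h6 (by simp)
  · refine (fixLink_spec I h₂.wf (by rw [hG₂]; exact h₂.run) c').mono (by omega)
      fun σ₃ ⟨H₃, h₃, hl₃⟩ => ?_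
    have hG₃ : σ₃.G = TG := by rw [h₃.eq]; exact hG₂
    have heq₃ : σ₃ = { σ with G := σ₃.G, Gr := σ₃.Gr } := by
      rw [hG₃, ← hG₂]
      conv_lhs => rw [h₃.eq, heq₂]
    have hs₃ : σ₃.s = σ.s := by rw [heq₃]
    have ht₃ : σ₃.t = σ.t := by rw [heq₃]
    refine ⟨heq₃, h₃.wf, by rw [hG₃, hTG'], by rw [hG₃, ← hG₂]; exact h₃.run, ?_⟩
    intro c d a' h1 h2 h3 h4 h5
    rw [hG₃] at h1 h2 h4
    rw [hs₃, ht₃]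
    rcases eq_or_ne a' c' with rfl | h6
    · have := hl₃ c d
      rw [hG₂, hs₂, ht₂] at this
      exact this h1 h2 h3 h4
    · have h7 : σ₃.Gr.fn a' = none ↔ σ₂.Gr.fn a' = none := by
        rw [← not_iff_not]
        change σ₃.Gr.fn a' ≠ none ↔ σ₂.Gr.fn a' ≠ none
        rw [h₃.heads_iff]
        simp [h6]
      rw [h7]
      rcases eq_or_ne a' a with rfl | h8
      · exact hl₂ c d h1 h2 h3 h4
      · exact hold c d a' h1 h2 h3 h4 h5 h8 (by simp [Ne.symm h6])

theorem removePair_spec {pend : Set ℕ} (hσ : σ.WF D) (hg : GrInv I pend σ) (a : ℕ) :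
    (removePair I σ a).Spec (46 * (D + 1)) fun σ' =>
      OnlyG I D pend σ σ' (Function.update σ.G.fn a none) := by
  refine .tick (by omega) <| .bind (Trie.find_spec hσ.G a) (by omega) fun e h => ?_
  subst h
  cases hGa : σ.G.fn a with
  | none =>
    refine .pure ?_
    convert OnlyG.refl I hσ hg using 1
    rw [← hGa, Function.update_eq_self]
  | some b =>
  have haD := Trie.lt_of_fn_eq_some hσ.G hGa
  refine .bind (cutAt_spec hσ hg.run (a := a) (by simp [hGa])) (by omega) fun σ₀ h₀ => ?_
  have hG₀ : σ₀.G = σ.G := by rw [h₀.eq]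
  refine .bind (Trie.succ_spec h₀.wf.G (a + 1)) (by omega) fun next hn => ?_
  extract_lets jp
  have hcut := cutNext_spec h₀.wf (by rw [hG₀]; exact h₀.run) hn
  suffices hjp : ∀ σ₁, (OnlyGr D σ₀ σ₁ fun w => (∃ z, next = some (w, z)) ∨ σ₀.Gr.fn w ≠ none) ∧
      (∀ y', a < y' → σ₀.G.fn y' ≠ none → ∃ w, a < w ∧ w ≤ y' ∧ σ₁.Gr.fn w ≠ none) →
      (jp σ₁).Spec (19 * (D + 1)) fun σ' =>
        OnlyG I D pend σ σ' (Function.update σ.G.fn a none) by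
    rcases next with _ | ⟨c, z⟩
    all_goals exact hcut.bind (by omega) fun σ₁ h₁ => (hjp σ₁ h₁).mono (by omega) fun _ h => h
  rintro σ₁ ⟨h₁, hnext⟩
  rw [hG₀] at hn hnext
  have hG₁ : σ₁.G = σ.G := by rw [h₁.eq]; exact hG₀
  have heq₁ : σ₁ = { σ with Gr := σ₁.Gr } := by
    conv_lhs => rw [h₁.eq, h₀.eq]
  refine .bind (Trie.set_spec h₁.wf.G a none) (by omega) fun TG hTG => ?_
  refine .bind (Trie.set_spec h₁.wf.Gr a none) (by omega) fun TH hTH => ?_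
  have hTG' := hTG.2 haD
  have hTH' := hTH.2 haD
  rw [hG₁] at hTG'
  have hrun : IsRunMap TG.fn TH.fn := by
    rw [hTG', hTH']
    have := h₁.run
    rw [hG₀] at this
    refine this.remove ?_ hnext
    rw [h₁.heads_iff, h₀.heads_iff]
    simp
  set σ₂ : State := { σ₁ with G := TG, Gr := TH } with hσ₂
  have hwf₂ : σ₂.WF D := ⟨h₁.wf.U, h₁.wf.L, hTG.1, hTH.1, h₁.wf.starts, h₁.wf.cuts⟩
  have heq₂ : σ₂ = { σ with G := σ₂.G, Gr := σ₂.Gr } := by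
    conv_lhs => rw [hσ₂, heq₁]
  have hold : ∀ c d a', TG.fn c = some d → TG.fn a' ≠ none → c < a' →
      (∀ w, c < w → w < a' → TG.fn w = none) → a' ∉ pend → (∀ z, next ≠ some (a', z)) →
      (TH.fn a' = none ↔ a' < d ∨ a' = d ∧ badAt I σ.s σ.t a' = false) := by
    intro c d a' h1 h2 h3 h4 h5 h7
    simp only [hTG'] at h1 h2 h4
    have hca : c ≠ a := by rintro rfl; simp at h1
    have ha' : a' ≠ a := by rintro rfl; simp at h2
    rw [Function.update_of_ne hca] at h1
    rw [Function.update_of_ne ha'] at h2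
    have h4' : ∀ w, c < w → w < a' → σ.G.fn w = none := by
      intro w h8 h9
      have h10 := h4 w h8 h9
      simp only [Function.update_apply] at h10
      split_ifs at h10 with h11
      · subst h11
        exfalso
        rcases next with _ | ⟨c', z⟩
        · exact h2 (hn a' h9)
        · have hc' := hn.1
          have h8 := h7 z
          simp only [mem_Ici] at hc'
          have : a' ≠ c' := by rintro rfl; exact h8 rfl
          rcases lt_or_gt_of_ne this with h9 | h9
          · exact h2 (hn.2.2 a' (by simp; omega) h9)
          · have := h4 c' (by omega) h9
            rw [Function.update_of_ne (by omega), hn.2.1] at this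
            simp at this
      · exact h10
    rw [← hg.link c d a' h1 h2 h3 h4' h5, ← not_iff_not]
    change TH.fn a' ≠ none ↔ σ.Gr.fn a' ≠ none
    rw [hTH', Function.update_of_ne ha', h₁.heads_iff, h₀.heads_iff]
    simp [h7, ha']
  have hs₂ : σ₂.s = σ.s := by rw [heq₂]
  have ht₂ : σ₂.t = σ.t := by rw [heq₂]
  rcases next with _ | ⟨c', z⟩
  · refine .pure ⟨heq₂, hwf₂, hTG', hrun, ?_⟩
    intro c d a' h1 h2 h3 h4 h5
    rw [hs₂, ht₂]
    exact hold c d a' h1 h2 h3 h4 h5 (by simp)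
  · refine (fixLink_spec I hwf₂ hrun c').mono (by omega)
      fun σ₃ ⟨H₃, h₃, hl₃⟩ => ?_
    have hG₃ : σ₃.G = TG := by rw [h₃.eq]
    have heq₃ : σ₃ = { σ with G := σ₃.G, Gr := σ₃.Gr } := by
      rw [hG₃]
      conv_lhs => rw [h₃.eq, heq₂]
    have hs₃ : σ₃.s = σ.s := by rw [heq₃]
    have ht₃ : σ₃.t = σ.t := by rw [heq₃]
    refine ⟨heq₃, h₃.wf, by rw [hG₃, hTG'], by rw [hG₃]; exact h₃.run, ?_⟩
    intro c d a' h1 h2 h3 h4 h5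
    rw [hG₃] at h1 h2 h4
    rw [hs₃, ht₃]
    rcases eq_or_ne a' c' with rfl | h6
    · have := hl₃ c d
      rw [hs₂, ht₂] at this
      exact this h1 h2 h3 h4
    · have h7 : σ₃.Gr.fn a' = none ↔ TH.fn a' = none := by
        rw [← not_iff_not]
        change σ₃.Gr.fn a' ≠ none ↔ TH.fn a' ≠ none
        rw [h₃.heads_iff]
        simp [h6, hσ₂]
      rw [h7]
      exact hold c d a' h1 h2 h3 h4 h5 (by simp [Ne.symm h6])

end SubtrajSweep

namespace SubtrajSweep

/-! # Maximal index-pairs -/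

/-- The properties of the relation that cell `j` can be reached from cell `i` through the gates. -/
structure IsPass (n : ℕ) (pass : ℕ → ℕ → Prop) : Prop where
  refl : ∀ i, pass i i
  le : ∀ {i j}, pass i j → i ≤ j
  sub : ∀ {i j i' j'}, pass i j → i ≤ i' → i' ≤ j' → j' ≤ j → pass i' j'
  lt : ∀ {i j}, pass i j → i < n → j < n

/-- The pairs `(i, j)` with start in `S`, end in `T` and `j - i ≥ δ` such that `j` can be reached. -/
def Pairs (δ : ℕ) (S T : Set ℕ) (pass : ℕ → ℕ → Prop) (i j : ℕ) : Prop :=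
  i ∈ S ∧ j ∈ T ∧ pass i j ∧ i + δ ≤ j

/-- `M` consists of the inclusion-wise maximal pairs of the relation `R`. -/
structure Rep (M : ℕ → Option ℕ) (R : ℕ → ℕ → Prop) : Prop where
  sound : ∀ {i j}, M i = some j → R i j
  inc : ∀ {i i' j j'}, M i = some j → M i' = some j' → i < i' → j < j'
  cover : ∀ {i j}, R i j → ∃ a b, M a = some b ∧ a ≤ i ∧ j ≤ b

/-- The index `i` lies in a pair of `M`. -/
def Covered (M : ℕ → Option ℕ) (i : ℕ) : Prop := ∃ a b, M a = some b ∧ a ≤ i ∧ i ≤ b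

theorem Rep.iff_max {M : ℕ → Option ℕ} {R : ℕ → ℕ → Prop} (h : Rep M R) (i j : ℕ) :
    M i = some j ↔ R i j ∧ ∀ i' j', R i' j' → i' ≤ i → j ≤ j' → i' = i ∧ j' = j := by
  constructor
  · refine fun hi => ⟨h.sound hi, fun i' j' h1 h2 h3 => ?_⟩
    obtain ⟨a, b, h4, h5, h6⟩ := h.cover h1
    rcases lt_or_ge a i with h7 | h7
    · have := h.inc h4 hi h7
      omega
    · obtain rfl : a = i := by omega
      rw [hi] at h4
      simp at h4
      omega
  · rintro ⟨h1, h2⟩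
    obtain ⟨a, b, h4, h5, h6⟩ := h.cover h1
    obtain ⟨rfl, rfl⟩ := h2 a b (h.sound h4) h5 h6
    exact h4

theorem Rep.covered_iff {M : ℕ → Option ℕ} {R : ℕ → ℕ → Prop} (h : Rep M R) (i : ℕ) :
    Covered M i ↔ ∃ a b, R a b ∧ a ≤ i ∧ i ≤ b := by
  constructor
  · rintro ⟨a, b, h1, h2, h3⟩
    exact ⟨a, b, h.sound h1, h2, h3⟩
  · rintro ⟨a, b, h1, h2, h3⟩
    obtain ⟨a', b', h4, h5, h6⟩ := h.cover h1
    exact ⟨a', b', h4, by omega, by omega⟩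

theorem Rep.congr {M : ℕ → Option ℕ} {R R' : ℕ → ℕ → Prop} (h : Rep M R)
    (hR : ∀ i j, R i j ↔ R' i j) : Rep M R' := by
  have : R = R' := by ext i j; exact hR i j
  exact this ▸ h

/-- A map whose pairs are sound and increasing remains so when pairs are erased. -/
theorem Rep.mem_erase {M : ℕ → Option ℕ} {a i j : ℕ} (h : Function.update M a none i = some j) :
    i ≠ a ∧ M i = some j := by
  simp only [Function.update_apply] at h
  split_ifs at h with h1
  exact ⟨h1, h⟩

theorem mem_update {M : ℕ → Option ℕ} {a b i j : ℕ} (h : Function.update M a (some b) i = some j) :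
    (i = a ∧ j = b) ∨ (i ≠ a ∧ M i = some j) := by
  simp only [Function.update_apply] at h
  split_ifs at h with h1
  · exact .inl ⟨h1, by simpa using h.symm⟩
  · exact .inr ⟨h1, h⟩

variable {n δ : ℕ} {S T : Set ℕ} {pass pass' : ℕ → ℕ → Prop} {M : ℕ → Option ℕ}

/-! ## A start disappears -/

theorem Rep.leave_none (h : Rep M (Pairs δ S T pass)) {i₀ : ℕ} (hi : M i₀ = none) :
    Rep M (Pairs δ (S \ {i₀}) T pass) where
  sound := by
    intro i j hij
    obtain ⟨h1, h2⟩ := h.sound hij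
    refine ⟨⟨h1, ?_⟩, h2⟩
    rintro rfl
    simp [hi] at hij
  inc := h.inc
  cover := fun ⟨h1, h2⟩ => h.cover ⟨h1.1, h2⟩

theorem Rep.leave_keep (h : Rep M (Pairs δ S T pass)) {i₀ b : ℕ} (hi : M i₀ = some b)
    (hnext : ∀ i ∈ S, i₀ < i → i + δ ≤ b → ∃ j₀ ≤ i, i₀ < j₀ ∧ M j₀ ≠ none) :
    Rep (Function.update M i₀ none) (Pairs δ (S \ {i₀}) T pass) where
  sound := by
    intro i j hij
    obtain ⟨h1, h2⟩ := Rep.mem_erase hij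
    obtain ⟨h3, h4⟩ := h.sound h2
    exact ⟨⟨h3, h1⟩, h4⟩
  inc := fun h1 h2 => h.inc (Rep.mem_erase h1).2 (Rep.mem_erase h2).2
  cover := by
    rintro i j ⟨h1, h2, h3, h4⟩
    obtain ⟨a, c, h5, h6, h7⟩ := h.cover ⟨h1.1, h2, h3, h4⟩
    rcases eq_or_ne a i₀ with rfl | h8
    · obtain rfl : b = c := by simpa [hi] using h5
      have hne : i ≠ a := h1.2
      obtain ⟨j₀, h9, h10, h11⟩ := hnext i h1.1 (by omega) (by omega)
      obtain ⟨e, he⟩ := Option.ne_none_iff_exists'.1 h11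
      have := h.inc hi he h10
      exact ⟨j₀, e, by rw [Function.update_of_ne (by omega), he], h9, by omega⟩
    · exact ⟨a, c, by rwa [Function.update_of_ne h8], h6, h7⟩

theorem Rep.leave_move (h : Rep M (Pairs δ S T pass)) (hp : IsPass n pass) {i₀ j₀ b : ℕ}
    (hi : M i₀ = some b) (hjn : M j₀ = none) (hj : j₀ ∈ S) (hij : i₀ < j₀) (hmin : ∀ i ∈ S, i₀ < i → j₀ ≤ i)
    (hb : j₀ + δ ≤ b) :
    Rep (Function.update (Function.update M i₀ none) j₀ (some b)) (Pairs δ (S \ {i₀}) T pass) := by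
  have hs := h.sound hi
  refine ⟨fun {i j} h1 => ?_, fun {i i' j j'} h1 h2 h3 => ?_, fun {i j} h1 => ?_⟩
  · rcases mem_update h1 with ⟨rfl, rfl⟩ | ⟨h2, h3⟩
    · exact ⟨⟨hj, by simp; omega⟩, hs.2.1, hp.sub hs.2.2.1 hij.le (by omega) le_rfl, hb⟩
    · obtain ⟨h4, h5⟩ := Rep.mem_erase h3
      obtain ⟨h6, h7⟩ := h.sound h5
      exact ⟨⟨h6, h4⟩, h7⟩
  · rcases mem_update h1 with ⟨rfl, rfl⟩ | ⟨h4, h5⟩ <;>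
      rcases mem_update h2 with ⟨rfl, rfl⟩ | ⟨h6, h7⟩
    · omega
    · exact h.inc hi (Rep.mem_erase h7).2 (by omega)
    · obtain ⟨h8, h9⟩ := Rep.mem_erase h5
      refine h.inc h9 hi ?_
      by_contra h10
      have := hmin i (h.sound h9).1 (by omega)
      omega
    · exact h.inc (Rep.mem_erase h5).2 (Rep.mem_erase h7).2 h3
  · obtain ⟨h1, h2, h3, h4⟩ := h1
    obtain ⟨a, c, h5, h6, h7⟩ := h.cover ⟨h1.1, h2, h3, h4⟩
    rcases eq_or_ne a i₀ with rfl | h8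
    · obtain rfl : b = c := by simpa [hi] using h5
      have hne : i ≠ a := h1.2
      exact ⟨j₀, b, by simp, hmin i h1.1 (by omega), h7⟩
    · rcases eq_or_ne a j₀ with rfl | h9
      · simp [hjn] at h5
      · exact ⟨a, c, by rwa [Function.update_of_ne h9, Function.update_of_ne h8], h6, h7⟩

theorem Rep.covered_leave {M' : ℕ → Option ℕ} (h : Rep M (Pairs 1 S T pass)) (hp : IsPass n pass)
    {i₀ i : ℕ} (h' : Rep M' (Pairs 1 (S \ {i₀}) T pass)) (hi : i ∈ S \ {i₀})
    (hb : M i₀ ≠ some i) : Covered M' i ↔ Covered M i := by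
  constructor
  · rw [h.covered_iff, h'.covered_iff]
    rintro ⟨a, b, ⟨h1, h2⟩, h3⟩
    exact ⟨a, b, ⟨h1.1, h2⟩, h3⟩
  · rintro ⟨a, b, h1, h2, h3⟩
    rw [h'.covered_iff]
    obtain ⟨h4, h5, h6, h7⟩ := h.sound h1
    rcases eq_or_ne a i₀ with rfl | h8
    · have h9 : i ≠ a := hi.2
      have h10 : i ≠ b := by rintro rfl; exact hb h1
      exact ⟨i, b, ⟨hi, h5, hp.sub h6 h2 h3 le_rfl, by omega⟩, le_rfl, h3⟩
    · exact ⟨a, b, ⟨⟨h4, h8⟩, h5, h6, h7⟩, h2, h3⟩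

/-! ## A gate opens -/

/-- The relation `pass'` results from `pass` by opening the gate `k`, which can be reached
horizontally exactly from the cells `j, …, k`. -/
structure Opens (pass pass' : ℕ → ℕ → Prop) (S : Set ℕ) (j k : ℕ) : Prop where
  le : j ≤ k
  iff : ∀ i b, pass' i b ↔ pass i b ∨ (j ≤ i ∧ i ≤ k ∧ k < b ∧ pass (k + 1) b)
  closed : ∀ i b, i ≤ k → k < b → ¬ pass i b
  horizontal : pass j k
  mem : j ∈ S
  mem' : k + 1 ∈ S

variable {j k : ℕ}

theorem Rep.open_none (h : Rep M (Pairs δ S T pass)) (ho : Opens pass pass' S j k)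
    (hT : ∀ b ∈ T, ¬ pass (k + 1) b) : Rep M (Pairs δ S T pass') :=
  h.congr fun i b => and_congr_right fun _ => and_congr_right fun h2 => and_congr_left fun _ => by
    rw [ho.iff]
    have := hT b h2
    tauto

/-- The largest end that can be reached from cell `k + 1`. -/
theorem Rep.le_of_open (h : Rep M (Pairs δ S T pass)) (hp : IsPass n pass)
    (ho : Opens pass pass' S j k) {b : ℕ} (hb : b ∈ T) (hkb : pass (k + 1) b)
    (hδ : k + 1 + δ ≤ b) : ∃ e, M (k + 1) = some e ∧ b ≤ e := by
  obtain ⟨a, c, h1, h2, h3⟩ := h.cover ⟨ho.mem', hb, hkb, hδ⟩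
  rcases Nat.lt_or_ge k a with h4 | h4
  · obtain rfl : a = k + 1 := by omega
    exact ⟨c, h1, h3⟩
  · have := hp.le hkb
    exact absurd (h.sound h1).2.2.1 (ho.closed a c h4 (by omega))

theorem Rep.open_some (h : Rep M (Pairs δ S T pass)) (hp : IsPass n pass)
    (ho : Opens pass pass' S j k) (hδ : δ ≤ 1) {e : ℕ} (he : e ∈ T) (hke : pass (k + 1) e)
    (hmax : ∀ b ∈ T, pass (k + 1) b → b ≤ e) :
    Rep (Function.update (Function.update M (k + 1) none) j (some e)) (Pairs δ S T pass') := by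
  have hjk := ho.le
  have hk1 := hp.le hke
  have hlow : ∀ {a c}, M a = some c → a ≤ k → c ≤ k := by
    intro a c h1 h2
    by_contra h3
    exact ho.closed a c h2 (by omega) (h.sound h1).2.2.1
  have hgap : ∀ {a c}, M a = some c → j < a → k < a := by
    intro a c h1 h2
    by_contra h3
    obtain ⟨h4, h5, h6, h7⟩ := h.sound h1
    have := hlow h1 (by omega)
    obtain ⟨a', c', h8, h9, h10⟩ := h.cover
      ⟨ho.mem, h5, hp.sub ho.horizontal le_rfl (by omega) this, by omega⟩
    have := h.inc h8 h1 (by omega)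
    omega
  refine ⟨fun {i b} h1 => ?_, fun {i i' b b'} h1 h2 h3 => ?_, fun {i b} h1 => ?_⟩
  · rcases mem_update h1 with ⟨rfl, rfl⟩ | ⟨h2, h3⟩
    · exact ⟨ho.mem, he, (ho.iff _ _).2 (.inr ⟨le_rfl, hjk, by omega, hke⟩), by omega⟩
    · obtain ⟨h6, h7, h8, h9⟩ := h.sound (Rep.mem_erase h3).2
      exact ⟨h6, h7, (ho.iff _ _).2 (.inl h8), h9⟩
  · rcases mem_update h1 with ⟨rfl, rfl⟩ | ⟨h4, h5⟩ <;>
      rcases mem_update h2 with ⟨rfl, rfl⟩ | ⟨h6, h7⟩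
    · omega
    · obtain ⟨h8, h9⟩ := Rep.mem_erase h7
      have h10 := hgap h9 h3
      by_cases h11 : k + 1 + δ ≤ b
      · obtain ⟨e', h12, h13⟩ := h.le_of_open hp ho he hke h11
        have := h.inc h12 h9 (by omega)
        omega
      · have := (h.sound h9).2.2.2
        have := hp.le (h.sound h9).2.2.1
        omega
    · have := hlow (Rep.mem_erase h5).2 (by omega)
      omega
    · exact h.inc (Rep.mem_erase h5).2 (Rep.mem_erase h7).2 h3
  · obtain ⟨h1, h2, h3, h4⟩ := h1
    rcases (ho.iff _ _).1 h3 with h5 | ⟨h5, h6, h7, h8⟩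
    · obtain ⟨a, c, h6, h7, h8⟩ := h.cover ⟨h1, h2, h5, h4⟩
      rcases eq_or_ne a j with rfl | h9
      · have := hlow h6 hjk
        exact ⟨a, e, by simp, h7, by omega⟩
      · rcases eq_or_ne a (k + 1) with rfl | h10
        · obtain ⟨-, h11, h12, -⟩ := h.sound h6
          have := hmax c h11 h12
          exact ⟨j, e, by simp, by omega, by omega⟩
        · exact ⟨a, c, by rwa [Function.update_of_ne h9, Function.update_of_ne h10], h7, h8⟩
    · exact ⟨j, e, by simp, h5, hmax b h2 h8⟩

theorem Rep.covered_open {M' : ℕ → Option ℕ} (h : Rep M (Pairs 1 S T pass)) (hp : IsPass n pass)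
    (ho : Opens pass pass' S j k) (h' : Rep M' (Pairs 1 S T pass')) {i : ℕ}
    (hiT : i ∈ T) (hij : i ≠ j) (hik : i ≠ k + 1) : Covered M' i ↔ Covered M i := by
  rw [h.covered_iff, h'.covered_iff]
  constructor
  · rintro ⟨a, b, ⟨h1, h2, h3, h4⟩, h5, h6⟩
    rcases (ho.iff _ _).1 h3 with h7 | ⟨h7, h8, h9, h10⟩
    · exact ⟨a, b, ⟨h1, h2, h7, h4⟩, h5, h6⟩
    · rcases lt_or_ge k i with h11 | h11
      · exact ⟨k + 1, b, ⟨ho.mem', h2, h10, by omega⟩, by omega, h6⟩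
      · exact ⟨j, i, ⟨ho.mem, hiT, hp.sub ho.horizontal le_rfl (by omega) h11, by omega⟩,
          by omega, le_rfl⟩
  · rintro ⟨a, b, ⟨h1, h2, h3, h4⟩, h5, h6⟩
    exact ⟨a, b, ⟨h1, h2, (ho.iff _ _).2 (.inl h3), h4⟩, h5, h6⟩

/-! ## A gate closes -/

/-- The relation `pass'` results from `pass` by closing the gate `k`, after which only horizontal
paths remain possible; the cells in `X` can be reached in this way. -/
structure Closes (pass pass' : ℕ → ℕ → Prop) (X : Set ℕ) (k : ℕ) : Prop where
  iff : ∀ i b, pass' i b ↔ pass i b ∧ ¬ (i ≤ k ∧ k < b)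
  through : ∀ i b, i ≤ k → k < b → (pass i b ↔ pass i k ∧ b ∈ X)

variable {X : Set ℕ} {a b : ℕ}

theorem Rep.close_keep (h : Rep M (Pairs δ S T pass)) (hc : Closes pass pass' X k)
    (hlow : ∀ {a b}, M a = some b → a ≤ k → b ≤ k) : Rep M (Pairs δ S T pass') where
  sound := by
    intro i j hij
    obtain ⟨h1, h2, h3, h4⟩ := h.sound hij
    refine ⟨h1, h2, (hc.iff _ _).2 ⟨h3, fun h5 => ?_⟩, h4⟩
    have := hlow hij h5.1
    omega
  inc := h.inc
  cover := fun ⟨h1, h2, h3, h4⟩ => h.cover ⟨h1, h2, ((hc.iff _ _).1 h3).1, h4⟩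

/-- No pair that starts before the last start `a ≤ k` reaches the gate `k`. -/
theorem Rep.close_lt (h : Rep M (Pairs δ S T pass)) (hp : IsPass n pass)
    (hc : Closes pass pass' X k) (hab : M a = some b) (hak : a ≤ k) (hkb : k < b) {i c : ℕ}
    (hi : M i = some c) (hia : i < a) : c < k := by
  obtain ⟨h1, h2, h3, h4⟩ := h.sound hi
  obtain ⟨h5, h6, h7, h8⟩ := h.sound hab
  by_contra h9
  have hX := ((hc.through a b hak hkb).1 h7).2
  have : pass i b := (hc.through i b (by omega) hkb).2
    ⟨hp.sub h3 le_rfl (by omega) (by omega), hX⟩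
  obtain ⟨a', b', h10, h11, h12⟩ := h.cover ⟨h1, h6, this, by omega⟩
  have := h.inc h10 hab (by omega)
  omega

/-- The pair `(a, b)` is replaced by `(a, k)`, or removed if this is not allowed. -/
def shorten (δ : ℕ) (M : ℕ → Option ℕ) (a k : ℕ) : ℕ → Option ℕ :=
  Function.update M a (if a + δ ≤ k then some k else none)

theorem mem_shorten {i c : ℕ} (h : shorten δ M a k i = some c) :
    (i = a ∧ c = k ∧ a + δ ≤ k) ∨ (i ≠ a ∧ M i = some c) := by
  unfold shorten at h
  simp only [Function.update_apply] at h
  split_ifs at h with h1 h2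
  · exact .inl ⟨h1, by simpa using h.symm, h2⟩
  · exact .inr ⟨h1, h⟩

theorem shorten_of_ne {i : ℕ} (h : i ≠ a) : shorten δ M a k i = M i := Function.update_of_ne h _ _

theorem Rep.shorten_sound (h : Rep M (Pairs δ S T pass)) (hp : IsPass n pass)
    (hc : Closes pass pass' X k) (hkT : k ∈ T) (hab : M a = some b) (hak : a ≤ k) (hkb : k < b)
    (hmax : ∀ i, a < i → i ≤ k → M i = none) {i c : ℕ} (hi : shorten δ M a k i = some c) :
    Pairs δ S T pass' i c := by
  rcases mem_shorten hi with ⟨rfl, rfl, h1⟩ | ⟨h1, h2⟩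
  · obtain ⟨h3, h4, h5, h6⟩ := h.sound hab
    exact ⟨h3, hkT, (hc.iff _ _).2 ⟨hp.sub h5 le_rfl hak hkb.le, by omega⟩, h1⟩
  · obtain ⟨h3, h4, h5, h6⟩ := h.sound h2
    refine ⟨h3, h4, (hc.iff _ _).2 ⟨h5, fun h7 => ?_⟩, h6⟩
    rcases lt_or_gt_of_ne h1 with h8 | h8
    · have := h.close_lt hp hc hab hak hkb h2 h8
      omega
    · simp [hmax i h8 h7.1] at h2

theorem Rep.shorten_inc (h : Rep M (Pairs δ S T pass)) (hp : IsPass n pass)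
    (hc : Closes pass pass' X k) (hab : M a = some b) (hak : a ≤ k) (hkb : k < b) {i i' c c' : ℕ}
    (hi : shorten δ M a k i = some c) (hi' : shorten δ M a k i' = some c') (hlt : i < i') :
    c < c' := by
  rcases mem_shorten hi with ⟨rfl, rfl, h1⟩ | ⟨h1, h2⟩ <;>
    rcases mem_shorten hi' with ⟨rfl, rfl, h3⟩ | ⟨h3, h4⟩
  · omega
  · have := h.inc hab h4 hlt
    omega
  · exact h.close_lt hp hc hab hak hkb h2 hlt
  · exact h.inc h2 h4 hlt

theorem Rep.shorten_cover (h : Rep M (Pairs δ S T pass))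
    (hc : Closes pass pass' X k) (hab : M a = some b) {i c : ℕ}
    (hi : Pairs δ S T pass' i c) :
    (∃ a' b', shorten δ M a k a' = some b' ∧ a' ≤ i ∧ c ≤ b') ∨ (k < i ∧ c ≤ b) := by
  obtain ⟨h1, h2, h3, h4⟩ := hi
  obtain ⟨h5, h6⟩ := (hc.iff _ _).1 h3
  obtain ⟨a', b', h7, h8, h9⟩ := h.cover ⟨h1, h2, h5, h4⟩
  rcases eq_or_ne a' a with rfl | h10
  · obtain rfl : b = b' := by simpa [hab] using h7
    rcases lt_or_ge k i with h11 | h11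
    · exact .inr ⟨h11, h9⟩
    · refine .inl ⟨a', k, ?_, h8, by omega⟩
      unfold shorten
      rw [if_pos (by omega)]
      simp
  · exact .inl ⟨a', b', by rwa [shorten_of_ne h10], h8, h9⟩

theorem Rep.close_shorten (h : Rep M (Pairs δ S T pass)) (hp : IsPass n pass)
    (hc : Closes pass pass' X k) (hkT : k ∈ T) (hab : M a = some b) (hak : a ≤ k) (hkb : k < b)
    (hmax : ∀ i, a < i → i ≤ k → M i = none)
    (hnext : ∀ i ∈ S, k < i → i + δ ≤ b → ∃ j₀ ≤ i, k < j₀ ∧ M j₀ ≠ none) :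
    Rep (shorten δ M a k) (Pairs δ S T pass') := by
  refine ⟨h.shorten_sound hp hc hkT hab hak hkb hmax, h.shorten_inc hp hc hab hak hkb,
    fun {i c} hic => ?_⟩
  rcases h.shorten_cover hc hab hic with h1 | ⟨h1, h2⟩
  · exact h1
  · obtain ⟨j₀, h3, h4, h5⟩ := hnext i hic.1 h1 (by have := hic.2.2.2; omega)
    obtain ⟨e, he⟩ := Option.ne_none_iff_exists'.1 h5
    have := h.inc hab he (by omega)
    exact ⟨j₀, e, by rwa [shorten_of_ne (by omega)], h3, by omega⟩

theorem Rep.close_split (h : Rep M (Pairs δ S T pass)) (hp : IsPass n pass)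
    (hc : Closes pass pass' X k) (hkT : k ∈ T) (hab : M a = some b) (hak : a ≤ k) (hkb : k < b)
    (hmax : ∀ i, a < i → i ≤ k → M i = none) {j₀ : ℕ} (hjn : M j₀ = none) (hj : j₀ ∈ S)
    (hkj : k < j₀) (hmin : ∀ i ∈ S, k < i → j₀ ≤ i) (hb : j₀ + δ ≤ b) :
    Rep (Function.update (shorten δ M a k) j₀ (some b)) (Pairs δ S T pass') := by
  have hs := h.sound hab
  refine ⟨fun {i c} h1 => ?_, fun {i i' c c'} h1 h2 h3 => ?_, fun {i c} h1 => ?_⟩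
  · rcases mem_update h1 with ⟨rfl, rfl⟩ | ⟨h2, h3⟩
    · exact ⟨hj, hs.2.1, (hc.iff _ _).2 ⟨hp.sub hs.2.2.1 (by omega) (by omega) le_rfl, by omega⟩, hb⟩
    · exact h.shorten_sound hp hc hkT hab hak hkb hmax h3
  · rcases mem_update h1 with ⟨rfl, rfl⟩ | ⟨h4, h5⟩ <;>
      rcases mem_update h2 with ⟨rfl, rfl⟩ | ⟨h6, h7⟩
    · omega
    · rw [shorten_of_ne (by omega)] at h7
      exact h.inc hab h7 (by omega)
    · rcases mem_shorten h5 with ⟨rfl, rfl, h8⟩ | ⟨h8, h9⟩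
      · exact hkb
      · refine h.inc h9 hab ?_
        by_contra h10
        rcases le_or_gt i k with h11 | h11
        · simp [hmax i (by omega) h11] at h9
        · have := hmin i (h.sound h9).1 h11
          omega
    · exact h.shorten_inc hp hc hab hak hkb h5 h7 h3
  · rcases h.shorten_cover hc hab h1 with ⟨a', b', h2, h3, h4⟩ | ⟨h2, h3⟩
    · refine ⟨a', b', ?_, h3, h4⟩
      rw [Function.update_of_ne, h2]
      rintro rfl
      rw [shorten_of_ne (by omega), hjn] at h2
      simp at h2
    · exact ⟨j₀, b, by simp, hmin i h1.1 h2, h3⟩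

theorem Rep.covered_close {M' : ℕ → Option ℕ} (h : Rep M (Pairs 1 S T pass)) (hp : IsPass n pass)
    (hc : Closes pass pass' X k) (h' : Rep M' (Pairs 1 S T pass')) (hkT : k ∈ T)
    (hab : M a = some b) (hak : a ≤ k) (hkb : k < b) (hmax : ∀ i, a < i → i ≤ k → M i = none)
    {i : ℕ} (hi : i ∈ S) (hik : i ≠ k) (hib : i ≠ b) :
    Covered M' i ↔ Covered M i := by
  constructor
  · rw [h.covered_iff, h'.covered_iff]
    rintro ⟨a, b, ⟨h1, h2, h3, h4⟩, h5⟩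
    exact ⟨a, b, ⟨h1, h2, ((hc.iff _ _).1 h3).1, h4⟩, h5⟩
  · rintro ⟨a', b', h1, h2, h3⟩
    rw [h'.covered_iff]
    obtain ⟨h4, h5, h6, h7⟩ := h.sound h1
    by_cases h8 : a' ≤ k ∧ k < b'
    · obtain rfl : a' = a := by
        rcases lt_trichotomy a' a with h9 | h9 | h9
        · have := h.close_lt hp hc hab hak hkb h1 h9
          omega
        · exact h9
        · simp [hmax a' h9 h8.1] at h1
      obtain rfl : b = b' := by simpa [hab] using h1
      rcases lt_or_ge k i with h9 | h9
      · exact ⟨i, b, ⟨hi, h5, (hc.iff _ _).2 ⟨hp.sub h6 h2 h3 le_rfl, by omega⟩, by omega⟩, le_rfl, h3⟩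
      · exact ⟨a', k, ⟨h4, hkT, (hc.iff _ _).2 ⟨hp.sub h6 le_rfl hak hkb.le, by omega⟩, by omega⟩,
          h2, by omega⟩
    · exact ⟨a', b', ⟨h4, h5, (hc.iff _ _).2 ⟨h6, h8⟩, h7⟩, h2, h3⟩

/-! ## An end appears -/

/-- The smallest start from which cell `j` can be reached. -/
theorem Rep.firstGE {U : ℕ → Option ℕ} (hU : Rep U (Pairs 0 S univ pass))
    (hp : IsPass n pass) {i₀ c₀ : ℕ} (hf : Trie.IsFirstGE U j (some (i₀, c₀))) :
    i₀ ∈ S ∧ (i₀ ≤ j → pass i₀ j) ∧ ∀ i ∈ S, pass i j → i₀ ≤ i := by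
  obtain ⟨h1, h2, h3⟩ := hf
  obtain ⟨h4, -, h5, -⟩ := hU.sound h1
  refine ⟨h4, fun h => hp.sub h5 le_rfl h h2, fun i h6 h7 => ?_⟩
  obtain ⟨a, b, h8, h9, h10⟩ := hU.cover ⟨h6, trivial, h7, hp.le h7⟩
  by_contra h11
  have := h3 a b h8 (by omega)
  omega

theorem Rep.enterEnd_keep (h : Rep M (Pairs 1 S T pass))
    (hk : ∀ i ∈ S, pass i j → i < j → ∃ a b, M a = some b ∧ a ≤ i ∧ j ≤ b) :
    Rep M (Pairs 1 S (insert j T) pass) where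
  sound := fun hij => by
    obtain ⟨h1, h2, h3⟩ := h.sound hij
    exact ⟨h1, .inr h2, h3⟩
  inc := h.inc
  cover := by
    rintro i b ⟨h1, rfl | h2, h3, h4⟩
    · exact hk i h1 h3 (by omega)
    · exact h.cover ⟨h1, h2, h3, h4⟩

theorem Rep.enterEnd_set (h : Rep M (Pairs 1 S T pass)) (hp : IsPass n pass) {i₀ : ℕ}
    (hi₀ : i₀ ∈ S) (hpass : pass i₀ j) (hij : i₀ < j) (hmin : ∀ i ∈ S, pass i j → i₀ ≤ i)
    (hM : ∀ c, M i₀ = some c → c < j) :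
    Rep (Function.update M i₀ (some j)) (Pairs 1 S (insert j T) pass) := by
  refine ⟨fun {i c} h1 => ?_, fun {i i' c c'} h1 h2 h3 => ?_, fun {i c} h1 => ?_⟩
  · rcases mem_update h1 with ⟨rfl, rfl⟩ | ⟨h2, h3⟩
    · exact ⟨hi₀, .inl rfl, hpass, hij⟩
    · obtain ⟨h4, h5, h6⟩ := h.sound h3
      exact ⟨h4, .inr h5, h6⟩
  · rcases mem_update h1 with ⟨rfl, rfl⟩ | ⟨h4, h5⟩ <;>
      rcases mem_update h2 with ⟨rfl, rfl⟩ | ⟨h6, h7⟩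
    · omega
    · by_contra h8
      obtain ⟨h9, h10, h11, h12⟩ := h.sound h7
      obtain ⟨a, b, h13, h14, h15⟩ := h.cover
        ⟨hi₀, h10, hp.sub hpass le_rfl (by omega) (by omega), by omega⟩
      have := h.inc h13 h7 (by omega)
      omega
    · by_contra h8
      obtain ⟨h9, h10, h11, h12⟩ := h.sound h5
      have := hmin i h9 (hp.sub h11 le_rfl (by omega) (by omega))
      omega
    · exact h.inc h5 h7 h3
  · obtain ⟨h1, h2, h3, h4⟩ := h1
    rcases h2 with rfl | h2
    · exact ⟨i₀, c, by simp, hmin i h1 h3, le_rfl⟩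
    · obtain ⟨a, b, h5, h6, h7⟩ := h.cover ⟨h1, h2, h3, h4⟩
      rcases eq_or_ne a i₀ with rfl | h8
      · exact ⟨a, j, by simp, h6, by have := hM b h5; omega⟩
      · exact ⟨a, b, by rwa [Function.update_of_ne h8], h6, h7⟩

theorem Rep.covered_enterEnd {M' : ℕ → Option ℕ} (h : Rep M (Pairs 1 S T pass))
    (hp : IsPass n pass) (h' : Rep M' (Pairs 1 S (insert j T) pass)) {i i₀ : ℕ} (hi₀ : i₀ ∈ S)
    (hpass : pass i₀ j) (hmin : ∀ i ∈ S, pass i j → i₀ ≤ i) (hiT : i ∈ T)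
    (hij : i ≠ j) (hii : i ≠ i₀) : Covered M' i ↔ Covered M i := by
  rw [h.covered_iff, h'.covered_iff]
  constructor
  · rintro ⟨a, b, ⟨h1, rfl | h2, h3, h4⟩, h5, h6⟩
    · have := hmin a h1 h3
      exact ⟨i₀, i, ⟨hi₀, hiT, hp.sub hpass le_rfl (by omega) h6, by omega⟩, by omega, le_rfl⟩
    · exact ⟨a, b, ⟨h1, h2, h3, h4⟩, h5, h6⟩
  · rintro ⟨a, b, ⟨h1, h2, h3⟩, h4⟩
    exact ⟨a, b, ⟨h1, .inr h2, h3⟩, h4⟩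

end SubtrajSweep

namespace SubtrajSweep

/-! # The combinatorial structure of a free space -/

/-- The combinatorial data of a free space: which cells and gates are non-empty, and the indices of
the heights of their lowest and highest points. -/
structure Diagram where
  cell : ℕ → Prop
  bot : ℕ → ℕ
  top : ℕ → ℕ
  gate : ℕ → Prop
  lo : ℕ → ℕ
  hi : ℕ → ℕ

namespace Diagram

/-- The cells which have a point at the height with index `y`. -/
def atHeight (M : Diagram) (y : ℕ) : Set ℕ := {i | M.cell i ∧ M.bot i ≤ y ∧ y ≤ M.top i}

/-- Cell `j` can be reached from cell `i` through gates in `O`. -/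
def pass (M : Diagram) (O : Set ℕ) (i j : ℕ) : Prop :=
  i ≤ j ∧ (∀ k, i ≤ k → k < j → k ∈ O) ∧ ∀ k l, i ≤ k → k < l → l < j → M.lo k ≤ M.hi l

/-- The gates through which a path from height `s` to height `t` can pass. -/
def opened (M : Diagram) (s t : ℕ) : Set ℕ := {k | M.gate k ∧ M.lo k ≤ t ∧ s ≤ M.hi k}

/-- A diagram with `n` cells and `m` heights. -/
structure Valid (M : Diagram) (n m : ℕ) : Prop where
  cell_lt : ∀ {i}, M.cell i → i < n
  bot_le : ∀ {i}, M.cell i → M.bot i ≤ M.top i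
  top_lt : ∀ {i}, M.cell i → M.top i < m
  gate_lt : ∀ {k}, M.gate k → k + 1 < n
  lo_le : ∀ {k}, M.gate k → M.lo k ≤ M.hi k
  cell_left : ∀ {k}, M.gate k → M.cell k ∧ M.bot k ≤ M.lo k ∧ M.hi k ≤ M.top k
  cell_right : ∀ {k}, M.gate k → M.cell (k + 1) ∧ M.bot (k + 1) ≤ M.lo k ∧ M.hi k ≤ M.top (k + 1)

theorem isPass (M : Diagram) {n : ℕ} {O : Set ℕ} (hO : ∀ k ∈ O, k + 1 < n) :
    IsPass n (M.pass O) where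
  refl i := ⟨le_rfl, fun k h1 h2 => by omega, fun k l h1 h2 h3 => by omega⟩
  le h := h.1
  sub h h1 h2 h3 := ⟨h2, fun k h4 h5 => h.2.1 k (by omega) (by omega),
    fun k l h4 h5 h6 => h.2.2 k l (by omega) h5 (by omega)⟩
  lt {i j} h hi := by
    rcases h.1.lt_or_eq with h1 | h1
    · have := hO _ (h.2.1 (j - 1) (by omega) (by omega))
      omega
    · omega

end Diagram

/-! # The invariant of the sweep -/

variable {K : Type} [LinearOrder K] (I : SweepInput K)

/-- Cell `i` has points at both heights and is good. -/
def Loc (s t i : ℕ) : Prop :=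
  I.left i (I.height s) ≠ ⊤ ∧ I.right i (I.height t) ≠ ⊤ ∧ badAt I s t i = false

/-- The good local group is correct except for indices in `pend`. -/
structure LInv (pend : Set ℕ) (σ : State) : Prop where
  eq : ∀ i j, σ.L.fn i = some j → i < I.numCells ∧ j = i
  iff : ∀ i < I.numCells, i ∉ pend → (σ.L.fn i ≠ none ↔ Loc I σ.s σ.t i ∧ ¬ Covered σ.G.fn i)

variable {I} {D : ℕ} {σ : State}

theorem LInv.mono {pend pend' : Set ℕ} (h : LInv I pend σ) (hp : ∀ i ∈ pend, i ∈ pend') :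
    LInv I pend' σ := ⟨h.eq, fun i h1 h2 => h.iff i h1 fun h3 => h2 (hp i h3)⟩

theorem LInv.congr {pend pend' : Set ℕ} {σ' : State} (h : LInv I pend σ) (hL : σ'.L = σ.L)
    (hs : σ'.s = σ.s) (ht : σ'.t = σ.t) (hsub : ∀ i ∈ pend, i ∈ pend')
    (hG : ∀ i < I.numCells, i ∉ pend' → Loc I σ.s σ.t i →
      (Covered σ'.G.fn i ↔ Covered σ.G.fn i)) : LInv I pend' σ' := by
  refine ⟨fun i j => hL ▸ h.eq i j, fun i h1 h2 => ?_⟩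
  rw [hL, hs, ht, h.iff i h1 fun h3 => h2 (hsub i h3)]
  exact and_congr_right fun h3 => not_congr (hG i h1 h2 h3).symm

variable (I) in
theorem refreshLocal_spec (hσ : σ.WF D) {pend : Set ℕ} (hL : LInv I pend σ)
    (hinc : ∀ {i i' j j'}, σ.G.fn i = some j → σ.G.fn i' = some j' → i < i' → j < j')
    (hD : I.numCells ≤ 2 ^ D) {i : ℕ} (hi : i < I.numCells) :
    (refreshLocal I σ i).Spec (5 * (D + 1)) fun σ' =>
      σ' = { σ with L := σ'.L } ∧ σ'.WF D ∧ LInv I (pend \ {i}) σ' := by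
  refine .tick (by omega) <| .bind (Trie.pred_spec hσ.G i) (by omega) fun e he => ?_
  extract_lets jp
  suffices hjp : ∀ c : Bool, (c = true ↔ Covered σ.G.fn i) →
      (jp c).Spec (D + 1) fun σ' =>
      σ' = { σ with L := σ'.L } ∧ σ'.WF D ∧ LInv I (pend \ {i}) σ' by
    rcases e with _ | ⟨a, b⟩
    · refine .bind (Q := fun c => c = false) (c' := 0) (.pure rfl) (by omega) fun c hc =>
        (hjp c ?_).mono (by omega) fun _ h => h
      simp only [hc, Bool.false_eq_true, false_iff]
      rintro ⟨a, b, h1, h2, h3⟩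
      simp [he a h2] at h1
    · refine .bind (Q := fun c => c = decide (i ≤ b)) (c' := 0) (.pure rfl) (by omega) fun c hc =>
        (hjp c ?_).mono (by omega) fun _ h => h
      simp only [hc, decide_eq_true_eq]
      refine ⟨fun h => ⟨a, b, he.2.1, he.1, h⟩, ?_⟩
      rintro ⟨a', b', h1, h2, h3⟩
      rcases lt_trichotomy a a' with h | h | h
      · simp [he.2.2 a' h2 h] at h1
      · subst h
        have := he.2.1
        rw [h1] at this
        simp at this
        omega
      · have := hinc h1 he.2.1 h
        omega
  intro c hc
  refine .bind (Trie.set_spec hσ.L i _) (by omega) fun T hT => .pure ⟨rfl, ?_, ?_, ?_⟩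
  · exact ⟨hσ.U, hT.1, hσ.G, hσ.Gr, hσ.starts, hσ.cuts⟩
  · intro i' j' h
    simp only [hT.2 (hi.trans_le hD), Function.update_apply] at h
    split_ifs at h with h1 h2
    · exact ⟨h1 ▸ hi, by simp at h; omega⟩
    · exact hL.eq i' j' h
  · intro i' hi' hp
    simp only [hT.2 (hi.trans_le hD)]
    rcases eq_or_ne i' i with rfl | hne
    · rw [Function.update_self]
      have : (I.left i' (I.height σ.s) ≠ ⊤ ∧ I.right i' (I.height σ.t) ≠ ⊤ ∧
          testBad I σ i' = false ∧ c = false) ↔ Loc I σ.s σ.t i' ∧ ¬ Covered σ.G.fn i' := by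
        rw [← hc, testBad_eq]
        simp only [Loc, Bool.not_eq_true]
        tauto
      rw [← this]
      split_ifs with h1 <;> simp [h1]
    · rw [Function.update_of_ne hne]
      exact hL.iff i' hi' fun h => hp ⟨h, hne⟩

/-- The invariant of the sweep for the starts `S`, ends `T`, open gates `O` and cut gates `Z`.
The merging is correct except at starts in `pend`, and the good local group is correct except
for `pendL`. -/
structure Inv (I : SweepInput K) (M : Diagram) (D s t : ℕ) (pend pendL S T O Z : Set ℕ)
    (σ : State) : Prop where
  s_eq : σ.s = s
  t_eq : σ.t = t
  wf : σ.WF D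
  mem_lt : ∀ i ∈ S, i < I.numCells
  gate_lt : ∀ k ∈ O, k + 1 < I.numCells
  U : Rep σ.U.fn (Pairs 0 S univ (M.pass O))
  G : Rep σ.G.fn (Pairs 1 S T (M.pass O))
  gr : GrInv I pend σ
  L : LInv I pendL σ
  starts : ∀ i, σ.starts.fn i ≠ none ↔ i ∈ S
  cuts : ∀ k, σ.cuts.fn k ≠ none ↔ k ∈ Z

variable {M : Diagram} {s t : ℕ} {pend pendL S T O Z : Set ℕ}

theorem Inv.isPass (h : Inv I M D s t pend pendL S T O Z σ) : IsPass I.numCells (M.pass O) :=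
  M.isPass h.gate_lt

theorem Inv.G_lt (h : Inv I M D s t pend pendL S T O Z σ) {a b : ℕ} (hab : σ.G.fn a = some b) :
    a < I.numCells ∧ b < I.numCells := by
  obtain ⟨h1, -, h2, -⟩ := h.G.sound hab
  exact ⟨h.mem_lt a h1, h.isPass.lt h2 (h.mem_lt a h1)⟩

/-- Refreshing the index `i` removes it from the pending indices. -/
theorem refresh_spec (h : Inv I M D s t pend pendL S T O Z σ) (hD : I.numCells ≤ 2 ^ D) {i : ℕ}
    (hi : i < I.numCells) :
    (refresh I i σ).Spec (200 * (D + 1))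
      (Inv I M D s t (pend \ {i}) (pendL \ {i}) S T O Z) := by
  refine .tick (by omega) <| .bind (fixLink_spec I h.wf h.gr.run i) (by omega)
    fun σ₁ ⟨H, h₁, hl₁⟩ => ?_
  have hG₁ : σ₁.G = σ.G := by rw [h₁.eq]
  have hL₁ : σ₁.L = σ.L := by rw [h₁.eq]
  have hs₁ : σ₁.s = σ.s := by rw [h₁.eq]
  have ht₁ : σ₁.t = σ.t := by rw [h₁.eq]
  have hinv : LInv I pendL σ₁ := h.L.congr hL₁ hs₁ ht₁ (fun _ h => h) fun i _ _ _ => by rw [hG₁]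
  refine (refreshLocal_spec I h₁.wf hinv (by rw [hG₁]; exact h.G.inc) hD hi).mono (by omega)
    fun σ₂ ⟨h₂, hw, hL⟩ => ?_
  have heq : σ₂ = { σ with Gr := σ₂.Gr, L := σ₂.L } := by
    have : σ₂.Gr = σ₁.Gr := by rw [h₂]
    rw [this]
    conv_lhs => rw [h₂, h₁.eq]
  have hG₂ : σ₂.G = σ.G := by rw [heq]
  have hGr₂ : σ₂.Gr = σ₁.Gr := by rw [h₂]
  have hs₂ : σ₂.s = σ.s := by rw [heq]
  have ht₂ : σ₂.t = σ.t := by rw [heq]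
  refine ⟨hs₂.trans h.s_eq, ht₂.trans h.t_eq, hw, h.mem_lt, h.gate_lt, by rw [heq]; exact h.U,
    by rw [hG₂]; exact h.G, ⟨by rw [hG₂, hGr₂]; exact h₁.run, ?_⟩, hL,
    by rw [heq]; exact h.starts, by rw [heq]; exact h.cuts⟩
  rw [hG₂, hGr₂, hs₂, ht₂]
  intro c d a h1 h2 h3 h4 h5
  rcases eq_or_ne a i with rfl | h6
  · exact hl₁ c d h1 h2 h3 h4
  · rw [← h.gr.link c d a h1 h2 h3 h4 fun h7 => h5 ⟨h7, h6⟩, ← not_iff_not]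
    change σ₁.Gr.fn a ≠ none ↔ σ.Gr.fn a ≠ none
    rw [h₁.heads_iff]
    simp [h6]

theorem leaveGate_spec (h : Inv I M D s t pend pendL S T O Z σ) {k : ℕ} (hk : k < 2 ^ D) :
    (leaveGate k σ).Spec (200 * (D + 1)) (Inv I M D s t pend pendL S T O (insert k Z)) := by
  refine .tick (by omega) <| .bind (Trie.set_spec h.wf.cuts k (some k)) (by omega)
    fun C hC => .pure ?_
  have hw := h.wf
  refine ⟨h.s_eq, h.t_eq, ⟨hw.U, hw.L, hw.G, hw.Gr, hw.starts, hC.1⟩, h.mem_lt, h.gate_lt, h.U,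
    h.G, ⟨h.gr.run, h.gr.link⟩, ⟨h.L.eq, h.L.iff⟩, h.starts, fun j => ?_⟩
  simp only [hC.2 hk, Function.update_apply]
  split_ifs with h1
  · simp [h1]
  · rw [h.cuts]
    simp [h1]

/-- A cell that is not adjacent to an open gate appears. -/
theorem enterCell_spec (h : Inv I M D s t pend pendL S T O Z σ) (hD : I.numCells ≤ 2 ^ D) {i : ℕ}
    (hi : i < I.numCells) (hl : i ∉ O) (hr : ∀ k ∈ O, k + 1 ≠ i) :
    (enterCell i σ).Spec (200 * (D + 1)) (Inv I M D s t pend pendL (insert i S) T O Z) := by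
  refine .tick (by omega) <| .bind (Trie.set_spec h.wf.starts i (some i)) (by omega) fun X hX => ?_
  refine .bind (Trie.set_spec h.wf.U i (some i)) (by omega) fun U hU => .pure ?_
  have hw := h.wf
  have hX' := hX.2 (hi.trans_le hD)
  have hU' := hU.2 (hi.trans_le hD)
  have hfrom : ∀ {j}, M.pass O i j → j = i := by
    intro j hj
    by_contra hne
    exact hl (hj.2.1 i le_rfl (by have := hj.1; omega))
  have hto : ∀ {j b}, M.pass O j b → j < i → b < i := by
    intro j b hj hji
    by_contra hbi
    exact hr _ (hj.2.1 (i - 1) (by omega) (by omega)) (by omega)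
  refine ⟨h.s_eq, h.t_eq, ⟨hU.1, hw.L, hw.G, hw.Gr, hX.1, hw.cuts⟩, ?_, h.gate_lt,
    ?_, ?_, ⟨h.gr.run, h.gr.link⟩, ⟨h.L.eq, h.L.iff⟩, fun j => ?_, h.cuts⟩
  · rintro j (rfl | hj)
    · exact hi
    · exact h.mem_lt j hj
  · simp only [hU']
    refine ⟨fun {a b} h1 => ?_, fun {a a' b b'} h1 h2 h3 => ?_, fun {a b} h1 => ?_⟩
    · rcases mem_update h1 with ⟨rfl, rfl⟩ | ⟨h2, h3⟩
      · exact ⟨.inl rfl, trivial, h.isPass.refl _, le_rfl⟩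
      · obtain ⟨h4, h5⟩ := h.U.sound h3
        exact ⟨.inr h4, h5⟩
    · rcases mem_update h1 with ⟨rfl, rfl⟩ | ⟨h4, h5⟩ <;>
        rcases mem_update h2 with ⟨rfl, rfl⟩ | ⟨h6, h7⟩
      · omega
      · have := (h.U.sound h7).2.2.2
        omega
      · exact hto (h.U.sound h5).2.2.1 h3
      · exact h.U.inc h5 h7 h3
    · obtain ⟨h1, h2, h3, h4⟩ := h1
      rcases h1 with rfl | h1
      · obtain rfl := hfrom h3
        exact ⟨b, b, by simp, le_rfl, le_rfl⟩
      · obtain ⟨a', b', h5, h6, h7⟩ := h.U.cover ⟨h1, h2, h3, h4⟩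
        rcases eq_or_ne a' i with rfl | h8
        · obtain rfl := hfrom (h.U.sound h5).2.2.1
          exact ⟨b', b', by simp, h6, h7⟩
        · exact ⟨a', b', by rwa [Function.update_of_ne h8], h6, h7⟩
  · refine ⟨fun h1 => ?_, h.G.inc, fun h1 => ?_⟩
    · obtain ⟨h4, h5⟩ := h.G.sound h1
      exact ⟨.inr h4, h5⟩
    · obtain ⟨h1 | h1, h2, h3, h4⟩ := h1
      · subst h1
        have := hfrom h3
        omega
      · exact h.G.cover ⟨h1, h2, h3, h4⟩
  · simp only [hX', Function.update_apply]
    split_ifs with h1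
    · simp [h1]
    · rw [h.starts]
      simp [h1]

/-! ## Moving a start -/

/-- Add the pair from the next start to `b` if this is allowed and there is none yet. -/
def moved (δ : ℕ) (G : ℕ → Option ℕ) (next : Option (ℕ × ℕ)) (b : ℕ) : ℕ → Option ℕ :=
  match next with
  | none => G
  | some (j, _) => if j + δ ≤ b ∧ G j = none then Function.update G j (some b) else G

variable {n δ : ℕ} {pass pass' : ℕ → ℕ → Prop} {G : ℕ → Option ℕ} {next : Option (ℕ × ℕ)}
  {f : ℕ → Option ℕ}

theorem Rep.leave_moved (h : Rep G (Pairs δ S T pass)) (hp : IsPass n pass) {i b : ℕ}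
    (hi : G i = some b) (hf : ∀ j, f j ≠ none ↔ j ∈ S \ {i})
    (hn : Trie.IsMinEntry f (Ici (i + 1)) next) :
    Rep (moved δ (Function.update G i none) next b) (Pairs δ (S \ {i}) T pass) := by
  rcases next with _ | ⟨j, z⟩
  · refine h.leave_keep hi fun i' h1 h2 _ => ?_
    exact absurd (hn i' h2) ((hf i').2 ⟨h1, h2.ne'⟩)
  · have hij : i < j := hn.1
    have hj := (hf j).1 (by simp [hn.2.1])
    have hmin : ∀ i' ∈ S, i < i' → j ≤ i' := by
      intro i' h1 h2
      by_contra h3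
      exact (hf i').2 ⟨h1, h2.ne'⟩ (hn.2.2 i' h2 (by omega))
    unfold moved
    dsimp only
    rw [Function.update_of_ne hij.ne']
    split_ifs with hc
    · exact h.leave_move hp hi hc.2 hj.1 hij hmin hc.1
    · refine h.leave_keep hi fun i' h1 h2 h3 => ⟨j, hmin i' h1 h2, hij, fun h4 => hc ⟨?_, h4⟩⟩
      have := hmin i' h1 h2
      omega

theorem Rep.close_moved {X : Set ℕ} {k : ℕ} (h : Rep G (Pairs δ S T pass)) (hp : IsPass n pass)
    (hc : Closes pass pass' X k) (hkT : k ∈ T) {a b : ℕ} (hab : G a = some b) (hak : a ≤ k)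
    (hkb : k < b) (hmax : ∀ i, a < i → i ≤ k → G i = none) (hf : ∀ j, f j ≠ none ↔ j ∈ S)
    (hn : Trie.IsMinEntry f (Ici (k + 1)) next) :
    Rep (moved δ (shorten δ G a k) next b) (Pairs δ S T pass') := by
  rcases next with _ | ⟨j, z⟩
  · refine h.close_shorten hp hc hkT hab hak hkb hmax fun i' h1 h2 _ => ?_
    exact absurd (hn i' h2) ((hf i').2 h1)
  · have hij : k < j := hn.1
    have hj := (hf j).1 (by simp [hn.2.1])
    have hmin : ∀ i' ∈ S, k < i' → j ≤ i' := by
      intro i' h1 h2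
      by_contra h3
      exact (hf i').2 h1 (hn.2.2 i' h2 (by omega))
    unfold moved
    dsimp only
    rw [shorten_of_ne (by omega)]
    split_ifs with hc'
    · exact h.close_split hp hc hkT hab hak hkb hmax hc'.2 hj hij hmin hc'.1
    · refine h.close_shorten hp hc hkT hab hak hkb hmax fun i' h1 h2 h3 =>
        ⟨j, hmin i' h1 h2, hij, fun h4 => hc' ⟨?_, h4⟩⟩
      have := hmin i' h1 h2
      omega

theorem moveU_spec {τ : State} {U : Trie ℕ} (hU : U.WF D) {b c : ℕ} {jp : State → Timed State}
    {R : State → Prop} (hlt : ∀ j z, next = some (j, z) → j < 2 ^ D) (hc : 2 * (D + 1) ≤ c)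
    (hjp : ∀ U' : Trie ℕ, U'.WF D → U'.fn = moved 0 U.fn next b →
      (jp { τ with U := U' }).Spec (c - 2 * (D + 1)) R) :
    Timed.Spec (match next with
      | none => do
        let σ ← (pure { τ with U := U } : Timed State)
        jp σ
      | some (j, _) => do
        let r ← U.find j
        if j ≤ b ∧ r.isNone = true then do
          let U ← U.set j (some b)
          let σ ← (pure { τ with U := U } : Timed State)
          jp σ
        else do
          let σ ← (pure { τ with U := U } : Timed State)
          jp σ) c R := by
  rcases next with _ | ⟨j, z⟩
  · exact .bind (Q := fun σ => σ = { τ with U := U }) (c' := 0) (.pure rfl) (by omega)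
      fun σ hσ => hσ ▸ (hjp U hU rfl).mono (by omega) fun _ h => h
  · refine .bind (Trie.find_spec hU j) (by omega) fun r hr => ?_
    subst hr
    unfold moved at hjp
    simp only [Option.isNone_iff_eq_none, add_zero] at hjp ⊢
    split_ifs with h1
    · rw [if_pos h1] at hjp
      refine .bind (Trie.set_spec hU j (some b)) (by omega) fun U' hU' => ?_
      exact .bind (Q := fun σ => σ = { τ with U := U' }) (c' := 0) (.pure rfl) (by omega)
        fun σ hσ => hσ ▸ (hjp U' hU'.1 (hU'.2 (hlt j z rfl))).mono (by omega) fun _ h => h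
    · rw [if_neg h1] at hjp
      exact .bind (Q := fun σ => σ = { τ with U := U }) (c' := 0) (.pure rfl) (by omega)
        fun σ hσ => hσ ▸ (hjp U hU rfl).mono (by omega) fun _ h => h

theorem moveG_spec {τ : State} (hτ : τ.WF D) (hg : GrInv I pend τ) {b c : ℕ}
    {jp : State → Timed State} {R : State → Prop} (hlt : ∀ j z, next = some (j, z) → j < 2 ^ D)
    (hc : 52 * (D + 1) ≤ c)
    (hjp : ∀ τ', OnlyG I D pend τ τ' (moved 1 τ.G.fn next b) →
      (jp τ').Spec (c - 52 * (D + 1)) R) :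
    Timed.Spec (match next with
      | none => do
        let σ ← (pure τ : Timed State)
        jp σ
      | some (j, _) => do
        let r ← τ.G.find j
        if j < b ∧ r.isNone = true then do
          let σ ← insertPair I τ j b
          jp σ
        else do
          let σ ← (pure τ : Timed State)
          jp σ) c R := by
  rcases next with _ | ⟨j, z⟩
  · exact .bind (Q := fun σ => σ = τ) (c' := 0) (.pure rfl) (by omega)
      fun σ hσ => hσ ▸ (hjp τ (.refl I hτ hg)).mono (by omega) fun _ h => h
  · refine .bind (Trie.find_spec hτ.G j) (by omega) fun r hr => ?_
    subst hr
    unfold moved at hjp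
    simp only [Option.isNone_iff_eq_none, Nat.add_one_le_iff] at hjp ⊢
    split_ifs with h1
    · rw [if_pos h1] at hjp
      exact .bind (insertPair_spec I hτ hg b h1.2 (hlt j z rfl)) (by omega)
        fun σ hσ => (hjp σ hσ).mono (by omega) fun _ h => h
    · rw [if_neg h1] at hjp
      exact .bind (Q := fun σ => σ = τ) (c' := 0) (.pure rfl) (by omega)
        fun σ hσ => hσ ▸ (hjp τ (.refl I hτ hg)).mono (by omega) fun _ h => h

/-- The result of a procedure which changes only the good local group. -/
structure OnlyL (I : SweepInput K) (D : ℕ) (pendL : Set ℕ) (σ σ' : State) : Prop where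
  eq : σ' = { σ with L := σ'.L }
  wf : σ'.WF D
  inv : LInv I pendL σ'

/-- Put together the invariant after an update of the global group and of the good local group. -/
theorem Inv.of_updates {τ σ₁ σ₂ : State} {G' : ℕ → Option ℕ} (h₁ : OnlyG I D pend τ σ₁ G')
    (h₂ : OnlyL I D pendL σ₁ σ₂) (hs : τ.s = s) (ht : τ.t = t) (hS : ∀ i ∈ S, i < I.numCells)
    (hO : ∀ k ∈ O, k + 1 < I.numCells) (hU : Rep τ.U.fn (Pairs 0 S univ (M.pass O)))
    (hG : Rep G' (Pairs 1 S T (M.pass O))) (hst : ∀ i, τ.starts.fn i ≠ none ↔ i ∈ S)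
    (hZ : ∀ k, τ.cuts.fn k ≠ none ↔ k ∈ Z) : Inv I M D s t pend pendL S T O Z σ₂ := by
  have hG₂ : σ₂.G = σ₁.G := by rw [h₂.eq]
  have hGr₂ : σ₂.Gr = σ₁.Gr := by rw [h₂.eq]
  have heq : σ₂ = { τ with G := σ₂.G, Gr := σ₂.Gr, L := σ₂.L } := by
    rw [hG₂, hGr₂]
    conv_lhs => rw [h₂.eq, h₁.eq]
  have hs₁ : σ₂.s = σ₁.s := by rw [h₂.eq]
  have ht₁ : σ₂.t = σ₁.t := by rw [h₂.eq]
  refine ⟨by rw [heq]; exact hs, by rw [heq]; exact ht, h₂.wf, hS, hO, by rw [heq]; exact hU,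
    by rw [hG₂, h₁.fn_G]; exact hG, ⟨by rw [hG₂, hGr₂]; exact h₁.inv.run, ?_⟩, h₂.inv,
    by rw [heq]; exact hst, by rw [heq]; exact hZ⟩
  rw [hG₂, hGr₂, hs₁, ht₁]
  exact h₁.inv.link

/-- The good local group after an update of the global group. -/
theorem OnlyG.lInv {τ σ₁ : State} {G' : ℕ → Option ℕ} {pendL' : Set ℕ}
    (h₁ : OnlyG I D pend τ σ₁ G') (hL : LInv I pendL τ) (hsub : ∀ i ∈ pendL, i ∈ pendL')
    (hG : ∀ i < I.numCells, i ∉ pendL' → Loc I τ.s τ.t i →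
      (Covered G' i ↔ Covered τ.G.fn i)) : LInv I pendL' σ₁ :=
  hL.congr (by rw [h₁.eq]) (by rw [h₁.eq]) (by rw [h₁.eq]) hsub (by rw [h₁.fn_G]; exact hG)

theorem leaveCell_spec (h : Inv I M D s t pend pendL S T O Z σ) (hD : I.numCells ≤ 2 ^ D) {i : ℕ}
    (hi : i < I.numCells) (hloc : ∀ j < I.numCells, j ∉ pendL → Loc I s t j → j ∈ S \ {i}) :
    (leaveCell I i σ).Spec (200 * (D + 1)) (Inv I M D s t pend pendL (S \ {i}) T O Z) := by
  have hw := h.wf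
  have hS' : ∀ j ∈ S \ {i}, j < I.numCells := fun j hj => h.mem_lt j hj.1
  refine .tick (by omega) <| .bind (Trie.set_spec h.wf.starts i none) (by omega) fun X hX => ?_
  have hX' : ∀ j, X.fn j ≠ none ↔ j ∈ S \ {i} := by
    intro j
    rw [hX.2 (hi.trans_le hD), Function.update_apply]
    split_ifs with h1
    · simp [h1]
    · rw [h.starts]
      simp [h1]
  refine .bind (Trie.succ_spec hX.1 (i + 1)) (by omega) fun next hn => ?_
  have hlt : ∀ j z, next = some (j, z) → j < 2 ^ D := by
    rintro j z rfl
    exact Trie.lt_of_fn_eq_some hX.1 hn.2.1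
  refine .bind (Trie.find_spec h.wf.U i) (by omega) fun e he => ?_
  extract_lets jp
  suffices hjp : ∀ U : Trie ℕ, U.WF D → Rep U.fn (Pairs 0 (S \ {i}) univ (M.pass O)) →
      (jp { σ with starts := X, U := U }).Spec (180 * (D + 1))
        (Inv I M D s t pend pendL (S \ {i}) T O Z) by
    clear_value jp
    rcases e with _ | b
    · exact .bind (Q := fun τ => τ = { σ with starts := X }) (c' := 0) (.pure rfl) (by omega)
        fun τ hτ => hτ ▸ (hjp _ hw.U (h.U.leave_none he.symm)).mono (by omega) fun _ h => h
    · refine .bind (Trie.set_spec hw.U i none) (by omega) fun U hU => ?_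
      refine moveU_spec (τ := { σ with starts := X }) (jp := jp) hU.1 hlt ?_ ?_
      · omega
      intro U' hU' hU''
      refine (hjp U' hU' ?_).mono (by omega) fun _ h => h
      rw [hU'', hU.2 (hi.trans_le hD)]
      exact h.U.leave_moved h.isPass he.symm hX' hn
  intro U hU hUrep
  set τ : State := { σ with starts := X, U := U } with hτ
  have hτw : τ.WF D := ⟨hU, hw.L, hw.G, hw.Gr, hX.1, hw.cuts⟩
  have hτg : GrInv I pend τ := ⟨h.gr.run, h.gr.link⟩
  have hτL : LInv I pendL τ := ⟨h.L.eq, h.L.iff⟩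
  refine .bind (Trie.find_spec hw.G i) (by omega) fun e he => ?_
  rcases e with _ | b
  · exact .pure (Inv.of_updates (.refl I hτw hτg) ⟨rfl, hτw, hτL⟩ h.s_eq h.t_eq hS' h.gate_lt hUrep
      (h.G.leave_none he.symm) hX' h.cuts)
  · refine .bind (removePair_spec I hτw hτg i) (by omega) fun σ₁ h₁ => ?_
    refine moveG_spec h₁.wf h₁.inv hlt (by omega) fun σ₂ h₂ => ?_
    have h₁₂ := h₁.trans I h₂
    rw [h₁.fn_G] at h₁₂
    have hrep : Rep (moved 1 (Function.update σ.G.fn i none) next b)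
        (Pairs 1 (S \ {i}) T (M.pass O)) := h.G.leave_moved h.isPass he.symm hX' hn
    have hL₂ : LInv I (insert b pendL) σ₂ := by
      refine h₁₂.lInv hτL (fun _ h => .inr h) fun j h1 h2 h3 => ?_
      simp only [mem_insert_iff, not_or] at h2
      have h3' : Loc I s t j := by rw [← h.s_eq, ← h.t_eq]; exact h3
      refine h.G.covered_leave h.isPass hrep (hloc j h1 h2.2 h3') ?_
      rw [← he]
      simpa using Ne.symm h2.1
    refine (refreshLocal_spec I h₂.wf hL₂ (by rw [h₁₂.fn_G]; exact hrep.inc) hD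
      (h.G_lt he.symm).2).mono (by omega) fun σ₃ ⟨h1, h2, h3⟩ => ?_
    refine Inv.of_updates h₁₂ ⟨h1, h2, h3.mono ?_⟩ h.s_eq h.t_eq hS' h.gate_lt hUrep hrep hX' h.cuts
    rintro j ⟨rfl | h4, h5⟩
    · exact absurd rfl h5
    · exact h4

theorem openGate_spec (h : Inv I M D s t pend pendL S T O Z σ) (hD : I.numCells ≤ 2 ^ D) {k : ℕ}
    (hk : k + 1 < I.numCells)
    (hopen : ∀ j ≤ k, (∀ g, j ≤ g → g < k → g ∉ Z) → (j = 0 ∨ j - 1 ∈ Z) →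
      Opens (M.pass O) (M.pass (insert k O)) S j k)
    (hT : I.right (k + 1) (I.height t) ≠ ⊤ ↔ k + 1 ∈ T)
    (hloc : ∀ j < I.numCells, j ∉ pendL → Loc I s t j → j ∈ T) :
    (openGate I k σ).Spec (200 * (D + 1))
      (Inv I M D s t pend pendL S T (insert k O) (Z \ {k})) := by
  have hw := h.wf
  have hp := h.isPass
  have hO' : ∀ g ∈ insert k O, g + 1 < I.numCells := by
    rintro g (rfl | hg)
    · exact hk
    · exact h.gate_lt g hg
  refine .tick (by omega) <| .bind (Trie.set_spec h.wf.cuts k none) (by omega) fun X hX => ?_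
  have hX' : ∀ g, X.fn g ≠ none ↔ g ∈ Z \ {k} := by
    intro g
    rw [hX.2 (by omega), Function.update_apply]
    split_ifs with h1
    · simp [h1]
    · rw [h.cuts]
      simp [h1]
  extract_lets τ₀ jp
  suffices hjp : ∀ j ≤ k, Opens (M.pass O) (M.pass (insert k O)) S j k →
      (jp j).Spec (190 * (D + 1)) (Inv I M D s t pend pendL S T (insert k O) (Z \ {k})) by
    have hZX : ∀ g < k, X.fn g = none → g ∉ Z := by
      intro g h1 h2 h3
      exact (hX' g).2 ⟨h3, h1.ne⟩ h2
    by_cases hk0 : k = 0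
    · rw [if_pos hk0]
      refine .bind (Q := fun j => j = 0) (c' := 0) (.pure rfl) (by omega) fun j hj =>
        (hjp j (by omega) (hopen j (by omega) (fun g _ _ => by omega) (.inl hj))).mono (by omega)
          fun _ h => h
    · rw [if_neg hk0]
      refine .bind (Trie.pred_spec hX.1 (k - 1)) (by omega) fun e he => ?_
      rcases e with _ | ⟨c, z⟩
      · refine .bind (Q := fun j => j = 0) (c' := 0) (.pure rfl) (by omega) fun j hj =>
          (hjp j (by omega) (hopen j (by omega) (fun g h1 h2 => ?_) (.inl hj))).mono (by omega)
            fun _ h => h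
        exact hZX g h2 (he g (by simp; omega))
      · have hc := he.1
        simp only [mem_Iic] at hc
        refine .bind (Q := fun j => j = c + 1) (c' := 0) (.pure rfl) (by omega) fun j hj =>
          (hjp j (by omega) (hopen j (by omega) (fun g h1 h2 => ?_) (.inr ?_))).mono (by omega)
            fun _ h => h
        · exact hZX g h2 (he.2.2 g (by simp; omega) (by omega))
        · rw [hj]
          exact ((hX' c).1 (by simp [he.2.1])).1
  intro j hjk ho
  have hj1 : j < I.numCells := by omega
  obtain ⟨e₀, he₀, -⟩ := h.U.le_of_open hp ho (b := k + 1) trivial (hp.refl _) (by omega)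
  have hmax₀ : ∀ b ∈ univ, M.pass O (k + 1) b → b ≤ e₀ := by
    intro b _ hb
    obtain ⟨e', h1, h2⟩ := h.U.le_of_open hp ho (b := b) trivial hb (hp.le hb)
    rw [he₀] at h1
    simp at h1
    omega
  refine .bind (Trie.find_spec hw.U (k + 1)) (by omega) fun e he => ?_
  rw [he₀] at he
  subst he
  extract_lets jp₂
  refine .bind (Trie.set_spec hw.U (k + 1) none) (by omega) fun U₁ hU₁ => ?_
  refine .bind (Trie.set_spec hU₁.1 j (some e₀)) (by omega) fun U hU => ?_
  refine .bind (Q := fun τ => τ = { σ with cuts := X, U := U }) (c' := 0) (.pure rfl) (by omega)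
    fun τ hτ => ?_
  have hUrep : Rep U.fn (Pairs 0 S univ (M.pass (insert k O))) := by
    rw [hU.2 (by omega), hU₁.2 (by omega)]
    exact h.U.open_some hp ho (by omega) trivial (h.U.sound he₀).2.2.1 hmax₀
  have hτw : τ.WF D := hτ ▸ ⟨hU.1, hw.L, hw.G, hw.Gr, hw.starts, hX.1⟩
  have hτg : GrInv I pend τ := hτ ▸ ⟨h.gr.run, h.gr.link⟩
  have hτL : LInv I pendL τ := hτ ▸ ⟨h.L.eq, h.L.iff⟩
  have hτs : τ.s = s := hτ ▸ h.s_eq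
  have hτt : τ.t = t := hτ ▸ h.t_eq
  have hτG : τ.G = σ.G := by rw [hτ]
  have hτU : Rep τ.U.fn (Pairs 0 S univ (M.pass (insert k O))) := hτ ▸ hUrep
  have hτS : ∀ i, τ.starts.fn i ≠ none ↔ i ∈ S := hτ ▸ h.starts
  have hτZ : ∀ i, τ.cuts.fn i ≠ none ↔ i ∈ Z \ {k} := hτ ▸ hX'
  clear_value τ₀
  refine .bind (Trie.find_spec hτw.G (k + 1)) (by omega) fun e he => ?_
  extract_lets jp₃
  suffices hjp : ∀ target : Option ℕ,
      (target = none → ∀ b ∈ T, ¬ M.pass O (k + 1) b) →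
      (∀ e, target = some e → e ∈ T ∧ M.pass O (k + 1) e ∧ ∀ b ∈ T, M.pass O (k + 1) b → b ≤ e) →
      (jp₃ target).Spec (180 * (D + 1)) (Inv I M D s t pend pendL S T (insert k O) (Z \ {k})) by
    clear_value jp₃
    rw [hτG] at he
    rcases e with _ | e
    · refine .bind (c' := 0) (.pure rfl) (by omega) fun target htarget =>
        (hjp target ?_ ?_).mono (by omega) fun _ h => h
      · intro h1 b hb hkb
        have hne : k + 1 ≠ b := by
          rintro rfl
          rw [← htarget, hτt, if_pos (hT.2 hb)] at h1
          simp at h1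
        obtain ⟨e', h2, -⟩ := h.G.le_of_open hp ho hb hkb (by have := hp.le hkb; omega)
        simp [← he] at h2
      · intro e h1
        rw [← htarget, hτt] at h1
        split_ifs at h1 with h2
        obtain rfl : k + 1 = e := by simpa using h1
        refine ⟨hT.1 h2, hp.refl _, fun b hb hkb => ?_⟩
        by_contra hne
        obtain ⟨e', h2, -⟩ := h.G.le_of_open hp ho hb hkb (by have := hp.le hkb; omega)
        simp [← he] at h2
    · refine .bind (Q := fun r => r = some e) (c' := 0) (.pure rfl) (by omega) fun target htarget =>
        (hjp target (by simp [htarget]) ?_).mono (by omega) fun _ h => h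
      intro e' h1
      obtain rfl : e = e' := by simpa [htarget] using h1
      obtain ⟨h2, h3, h4, h5⟩ := h.G.sound he.symm
      refine ⟨h3, h4, fun b hb hkb => ?_⟩
      by_contra hne
      obtain ⟨e', h6, h7⟩ := h.G.le_of_open hp ho hb hkb (by omega)
      rw [← he] at h6
      simp at h6
      omega
  intro target hnone hsome
  rcases target with _ | e
  · exact .pure (Inv.of_updates (.refl I hτw hτg) ⟨rfl, hτw, hτL⟩ hτs hτt h.mem_lt hO' hτU
      (by rw [hτG]; exact h.G.open_none ho (hnone rfl)) hτS hτZ)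
  · obtain ⟨heT, hke, hmax⟩ := hsome e rfl
    refine .bind (removePair_spec I hτw hτg (k + 1)) (by omega) fun σ₁ h₁ => ?_
    refine .bind (removePair_spec I h₁.wf h₁.inv j) (by omega) fun σ₂ h₂ => ?_
    refine .bind (insertPair_spec I h₂.wf h₂.inv e ?_ (by omega)) (by omega) fun σ₃ h₃ => ?_
    · rw [h₂.fn_G]
      simp
    have h₁₃ := (h₁.trans I h₂).trans I h₃
    rw [h₂.fn_G, h₁.fn_G, Function.update_idem, hτG] at h₁₃
    have hrep := h.G.open_some hp ho le_rfl heT hke hmax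
    have hL₃ : LInv I (insert j (insert (k + 1) pendL)) σ₃ := by
      refine h₁₃.lInv hτL (fun _ h => .inr (.inr h)) fun i h1 h2 h3 => ?_
      simp only [mem_insert_iff, not_or] at h2
      rw [hτs, hτt] at h3
      rw [hτG]
      exact h.G.covered_open hp ho hrep (hloc i h1 h2.2.2 h3) h2.1 h2.2.1
    refine .bind (refreshLocal_spec I h₁₃.wf hL₃ (by rw [h₁₃.fn_G]; exact hrep.inc) hD hj1) (by omega)
      fun σ₄ ⟨h1, h2, h3⟩ => ?_
    have hG₄ : σ₄.G = σ₃.G := by rw [h1]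
    refine (refreshLocal_spec I h2 h3 (by rw [hG₄, h₁₃.fn_G]; exact hrep.inc) hD hk).mono (by omega)
      fun σ₅ ⟨h4, h5, h6⟩ => ?_
    refine Inv.of_updates h₁₃ ⟨?_, h5, h6.mono ?_⟩ hτs hτt h.mem_lt hO' hτU hrep hτS hτZ
    · conv_lhs => rw [h4, h1]
    · rintro i ⟨⟨rfl | rfl | h7, h8⟩, h9⟩
      · exact absurd rfl h8
      · exact absurd rfl h9
      · exact h7

/-! ## Moving an end -/

theorem closeGate_spec (h : Inv I M D s t pend pendL S T O Z σ) (hD : I.numCells ≤ 2 ^ D) {k : ℕ}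
    (hk : k + 1 < I.numCells) {X : Set ℕ} (hc : Closes (M.pass O) (M.pass (O \ {k})) X k)
    (hkT : k ∈ T) (hkT' : k + 1 ∈ T)
    (hloc : ∀ j < I.numCells, j ∉ pendL → Loc I s t j → j ∈ S) :
    (closeGate I k σ).Spec (200 * (D + 1)) (Inv I M D s t pend pendL S T (O \ {k}) Z) := by
  have hw := h.wf
  have hp := h.isPass
  have hO' : ∀ g ∈ O \ {k}, g + 1 < I.numCells := fun g hg => h.gate_lt g hg.1
  refine .tick (by omega) <| .bind (Trie.succ_spec h.wf.starts (k + 1)) (by omega) fun next hn => ?_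
  have hlt : ∀ j z, next = some (j, z) → j < 2 ^ D := by
    rintro j z rfl
    exact Trie.lt_of_fn_eq_some hw.starts hn.2.1
  refine .bind (Trie.pred_spec h.wf.U k) (by omega) fun e he => ?_
  extract_lets jp
  suffices hjp : ∀ U : Trie ℕ, U.WF D → Rep U.fn (Pairs 0 S univ (M.pass (O \ {k}))) →
      (jp { σ with U := U }).Spec (180 * (D + 1))
        (Inv I M D s t pend pendL S T (O \ {k}) Z) by
    clear_value jp
    have hlow : ∀ {a b i c}, σ.U.fn a = some b → (∀ i, a < i → i ≤ k → σ.U.fn i = none) → b ≤ k →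
        σ.U.fn i = some c → i ≤ k → c ≤ k := by
      intro a b i c h1 h2 h3 h4 h5
      rcases lt_trichotomy i a with h6 | rfl | h6
      · have := h.U.inc h4 h1 h6
        omega
      · rw [h1] at h4; simp at h4; omega
      · simp [h2 i h6 h5] at h4
    rcases e with _ | ⟨a, b⟩
    · refine .bind (Q := fun τ => τ = σ) (c' := 0) (.pure rfl) (by omega)
        fun τ hτ => hτ ▸ (hjp _ hw.U (h.U.close_keep hc fun {a b} h1 h2 => ?_)).mono (by omega)
          fun _ h => h
      simp [he a h2] at h1
    · have hmax : ∀ i, a < i → i ≤ k → σ.U.fn i = none := fun i h1 h2 => he.2.2 i h2 h1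
      by_cases hkb : k < b
      · simp only [if_pos hkb]
        refine .bind (Trie.set_spec hw.U a (some k)) (by omega) fun U hU => ?_
        refine moveU_spec (τ := σ) (jp := jp) hU.1 hlt ?_ ?_
        · omega
        intro U' hU' hU''
        refine (hjp U' hU' ?_).mono (by omega) fun _ h => h
        have := h.U.close_moved hp hc trivial he.2.1 he.1 hkb hmax h.starts hn
        unfold shorten at this
        rwa [if_pos (show a + 0 ≤ k from he.1), ← hU.2 (Trie.lt_of_fn_eq_some hw.U he.2.1), ← hU'']
          at this
      · simp only [if_neg hkb]
        exact .bind (Q := fun τ => τ = σ) (c' := 0) (.pure rfl) (by omega)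
          fun τ hτ => hτ ▸ (hjp _ hw.U (h.U.close_keep hc
            fun h1 h2 => hlow he.2.1 hmax (by omega) h1 h2)).mono (by omega) fun _ h => h
  intro U hU hUrep
  set τ : State := { σ with U := U } with hτ
  have hτw : τ.WF D := ⟨hU, hw.L, hw.G, hw.Gr, hw.starts, hw.cuts⟩
  have hτg : GrInv I pend τ := ⟨h.gr.run, h.gr.link⟩
  have hτL : LInv I pendL τ := ⟨h.L.eq, h.L.iff⟩
  refine .bind (Trie.pred_spec hw.G k) (by omega) fun e he => ?_
  have hkeep : (∀ {a b}, σ.G.fn a = some b → a ≤ k → b ≤ k) →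
      Inv I M D s t pend pendL S T (O \ {k}) Z τ := fun hlow =>
    Inv.of_updates (.refl I hτw hτg) ⟨rfl, hτw, hτL⟩ h.s_eq h.t_eq h.mem_lt hO' hUrep
      (h.G.close_keep hc hlow) h.starts h.cuts
  rcases e with _ | ⟨a, b⟩
  · refine .pure (hkeep fun {a b} h1 h2 => ?_)
    simp [he a h2] at h1
  have hmax : ∀ i, a < i → i ≤ k → σ.G.fn i = none := fun i h1 h2 => he.2.2 i h2 h1
  by_cases hkb : k < b
  swap
  · simp only [if_neg hkb]
    refine .pure (hkeep fun {i c} h4 h5 => ?_)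
    rcases lt_trichotomy i a with h6 | rfl | h6
    · have := h.G.inc h4 he.2.1 h6
      omega
    · rw [he.2.1] at h4; simp at h4; omega
    · simp [hmax i h6 h5] at h4
  simp -zeta only [if_pos hkb]
  refine .bind (removePair_spec I hτw hτg a) (by omega) fun σ₁ h₁ => ?_
  extract_lets jp₃ jp₂
  suffices hjp : ∀ σ₂, OnlyG I D pend τ σ₂ (shorten 1 σ.G.fn a k) →
      (jp₂ σ₂).Spec (70 * (D + 1)) (Inv I M D s t pend pendL S T (O \ {k}) Z) by
    clear_value jp₂
    unfold shorten at hjp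
    split_ifs with hak
    · refine .bind (insertPair_spec I h₁.wf h₁.inv k ?_ ?_) (by omega)
        fun σ₂ h₂ => (hjp σ₂ ?_).mono (by omega) fun _ h => h
      · rw [h₁.fn_G]
        simp
      · exact Trie.lt_of_fn_eq_some hw.G he.2.1
      · have := h₁.trans I h₂
        rwa [h₁.fn_G, Function.update_idem, ← if_pos (c := a + 1 ≤ k) (t := some k) (e := none) hak]
          at this
    · refine .bind (Q := fun σ₂ => σ₂ = σ₁) (c' := 0) (.pure rfl) (by omega)
        fun σ₂ h₂ => (hjp σ₂ ?_).mono (by omega) fun _ h => h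
      rw [h₂, if_neg (by omega)]
      exact h₁
  intro σ₂ h₂
  have hrep : Rep (moved 1 (shorten 1 σ.G.fn a k) next b) (Pairs 1 S T (M.pass (O \ {k}))) :=
    h.G.close_moved hp hc hkT he.2.1 he.1 hkb hmax h.starts hn
  refine moveG_spec (jp := jp₃) h₂.wf h₂.inv hlt (by omega) fun σ₃ h₃ => ?_
  have h₂₃ := h₂.trans I h₃
  rw [h₂.fn_G] at h₂₃
  have hL₃ : LInv I (insert k (insert b pendL)) σ₃ := by
    refine h₂₃.lInv hτL (fun _ h => .inr (.inr h)) fun i h1 h2 h3 => ?_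
    simp only [mem_insert_iff, not_or] at h2
    have h3' : Loc I s t i := by rw [← h.s_eq, ← h.t_eq]; exact h3
    exact h.G.covered_close hp hc hrep hkT he.2.1 he.1 hkb hmax (hloc i h1 h2.2.2 h3') h2.1 h2.2.1
  refine .bind (refreshLocal_spec I h₂₃.wf hL₃ (by rw [h₂₃.fn_G]; exact hrep.inc) hD
    (by omega : k < I.numCells)) (by omega) fun σ₄ ⟨h1, h2, h3⟩ => ?_
  have hG₄ : σ₄.G = σ₃.G := by rw [h1]
  refine (refreshLocal_spec I h2 h3 (by rw [hG₄, h₂₃.fn_G]; exact hrep.inc) hD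
    (h.G_lt he.2.1).2).mono (by omega) fun σ₅ ⟨h4, h5, h6⟩ => ?_
  refine Inv.of_updates h₂₃ ⟨?_, h5, h6.mono ?_⟩ h.s_eq h.t_eq h.mem_lt hO' hUrep hrep h.starts h.cuts
  · conv_lhs => rw [h4, h1]
  · rintro i ⟨⟨rfl | rfl | h7, h8⟩, h9⟩
    · exact absurd rfl h8
    · exact absurd rfl h9
    · exact h7

theorem enterCellEnd_spec (h : Inv I M D s t pend pendL S T O Z σ) (hD : I.numCells ≤ 2 ^ D) {j : ℕ}
    (hloc : ∀ i < I.numCells, i ∉ pendL → Loc I s t i → i ∈ T ∧ i ≠ j) :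
    (enterCellEnd I j σ).Spec (200 * (D + 1)) (Inv I M D s t pend pendL S (insert j T) O Z) := by
  have hw := h.wf
  have hp := h.isPass
  have hkeep : (∀ i ∈ S, M.pass O i j → i < j → ∃ a b, σ.G.fn a = some b ∧ a ≤ i ∧ j ≤ b) →
      Inv I M D s t pend pendL S (insert j T) O Z σ := fun hk =>
    Inv.of_updates (.refl I hw h.gr) ⟨rfl, hw, h.L⟩ h.s_eq h.t_eq h.mem_lt h.gate_lt h.U
      (h.G.enterEnd_keep hk) h.starts h.cuts
  refine .tick (by omega) <| .bind (Trie.firstGE_spec hw.U (fun _ _ _ _ => h.U.inc) j) (by omega)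
    fun e he => ?_
  rcases e with _ | ⟨i₀, c₀⟩
  · refine .pure (hkeep fun i h1 h2 h3 => ?_)
    obtain ⟨a, b, h4, h5, h6⟩ := h.U.cover ⟨h1, trivial, h2, h3.le⟩
    have := he a b h4
    omega
  obtain ⟨hi₀, hpass, hmin⟩ := h.U.firstGE hp he
  by_cases hij : i₀ < j
  swap
  · simp only [if_neg hij]
    refine .pure (hkeep fun i h1 h2 h3 => ?_)
    have := hmin i h1 h2
    omega
  replace hpass := hpass hij.le
  have hi₀n := h.mem_lt i₀ hi₀
  simp only [if_pos hij]
  refine .bind (Trie.find_spec hw.G i₀) (by omega) fun e he => ?_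
  have hset : ∀ σ₁, (∀ c, σ.G.fn i₀ = some c → c < j) →
      OnlyG I D pend σ σ₁ (Function.update σ.G.fn i₀ (some j)) →
      (refreshLocal I σ₁ i₀).Spec (5 * (D + 1)) (Inv I M D s t pend pendL S (insert j T) O Z) := by
    intro σ₁ hM h₁
    have hrep := h.G.enterEnd_set hp hi₀ hpass hij hmin hM
    have hL₁ : LInv I (insert i₀ pendL) σ₁ := by
      refine h₁.lInv h.L (fun _ h => .inr h) fun i h1 h2 h3 => ?_
      simp only [mem_insert_iff, not_or] at h2
      have h3' : Loc I s t i := by rw [← h.s_eq, ← h.t_eq]; exact h3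
      have h4 := hloc i h1 h2.2 h3'
      exact h.G.covered_enterEnd hp hrep hi₀ hpass hmin h4.1 h4.2 h2.1
    refine (refreshLocal_spec I h₁.wf hL₁ (by rw [h₁.fn_G]; exact hrep.inc) hD hi₀n).mono le_rfl
      fun σ₂ ⟨h1, h2, h3⟩ => ?_
    refine Inv.of_updates h₁ ⟨h1, h2, h3.mono ?_⟩ h.s_eq h.t_eq h.mem_lt h.gate_lt h.U hrep h.starts
      h.cuts
    rintro i ⟨rfl | h4, h5⟩
    · exact absurd rfl h5
    · exact h4
  rcases e with _ | c
  · refine .bind (insertPair_spec I hw h.gr j he.symm (by omega)) (by omega)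
      fun σ₁ h₁ => (hset σ₁ ?_ h₁).mono (by omega) fun _ h => h
    simp [← he]
  · by_cases hcj : c < j
    · simp only [if_pos hcj]
      refine .bind (removePair_spec I hw h.gr i₀) (by omega) fun σ₁ h₁ => ?_
      refine .bind (insertPair_spec I h₁.wf h₁.inv j ?_ (by omega)) (by omega)
        fun σ₂ h₂ => (hset σ₂ ?_ ?_).mono (by omega) fun _ h => h
      · rw [h₁.fn_G]
        simp
      · simp [← he, hcj]
      · have := h₁.trans I h₂
        rwa [h₁.fn_G, Function.update_idem] at this
    · simp only [if_neg hcj]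
      refine .pure (hkeep fun i h1 h2 h3 => ⟨i₀, c, he.symm, hmin i h1 h2, by omega⟩)

end SubtrajSweep

namespace SubtrajSweep

/-! # Loops -/

theorem forList_spec {α : Type} {f : ℕ → α → Timed α} {c : ℕ} (P : List ℕ → α → Prop)
    (hf : ∀ x xs a, P (x :: xs) a → (f x a).Spec c (P xs)) (xs : List ℕ) {a : α} (h : P xs a) :
    (forList f xs a).Spec (xs.length * (c + 1) + 1) (P []) := by
  induction xs generalizing a with
  | nil => exact .tick (by omega) (.pure h)
  | cons x xs ih =>
    have : (x :: xs).length * (c + 1) = xs.length * (c + 1) + (c + 1) := by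
      rw [List.length_cons, Nat.succ_mul]
    exact .tick (by omega) <| .bind (hf x xs a h) (by omega) fun b hb =>
      (ih hb).mono (by omega) fun _ h => h

theorem forList_spec_of_nodup {α : Type} {f : ℕ → α → Timed α} {c : ℕ} (P : List ℕ → α → Prop)
    {xs : List ℕ} (hxs : xs.Nodup)
    (hf : ∀ x ys a, x ∈ xs → x ∉ ys → P (x :: ys) a → (f x a).Spec c (P ys)) {a : α} (h : P xs a) :
    (forList f xs a).Spec (xs.length * (c + 1) + 1) (P []) := by
  refine (forList_spec (f := f) (c := c) (fun ys a => (ys.Nodup ∧ ys ⊆ xs) ∧ P ys a) ?_ xs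
    ⟨⟨hxs, List.Subset.refl _⟩, h⟩).mono le_rfl fun _ h => h.2
  rintro x ys a ⟨⟨h1, h2⟩, h3⟩
  exact (hf x ys a (h2 (by simp)) (List.nodup_cons.1 h1).1 h3).mono le_rfl fun _ h =>
    ⟨⟨(List.nodup_cons.1 h1).2, fun y hy => h2 (by simp [hy])⟩, h⟩

theorem forRange_spec {α : Type} {f : ℕ → α → Timed α} {c : ℕ} (P : ℕ → α → Prop) {N : ℕ}
    (hf : ∀ x a, x < N → P x a → (f x a).Spec c (P (x + 1))) (k x : ℕ) (hN : x + k = N) {a : α}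
    (h : P x a) : (forRange f k x a).Spec (k * (c + 1) + 1) (P N) := by
  induction k generalizing x a with
  | zero => exact .tick (by omega) (.pure (by rw [← hN]; exact h))
  | succ k ih =>
    have : (k + 1) * (c + 1) = k * (c + 1) + (c + 1) := Nat.succ_mul _ _
    exact .tick (by omega) <| .bind (hf x a (by omega) h) (by omega) fun b hb =>
      (ih (x + 1) (by omega) hb).mono (by omega) fun _ h => h

theorem depthFor_spec (n fuel D : ℕ) (h : n ≤ 2 ^ (D + fuel)) :
    (depthFor n fuel (2 ^ D) D).Spec (Nat.clog 2 n - D + 1) fun D' =>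
      n ≤ 2 ^ D' ∧ (D' = D ∨ D' ≤ Nat.clog 2 n) := by
  induction fuel generalizing D with
  | zero => exact .tick (by omega) (.pure ⟨h, .inl rfl⟩)
  | succ fuel ih =>
    refine .tick (by omega) ?_
    split_ifs with h1
    · exact .pure ⟨h1, .inl rfl⟩
    · have h2 : D < Nat.clog 2 n := (Nat.lt_clog_iff_pow_lt (by omega)).2 (by omega)
      have := ih (D + 1) (by rwa [add_right_comm])
      rw [pow_succ, mul_comm] at this
      refine this.mono (by omega) fun D' h3 => ⟨h3.1, .inr ?_⟩
      rcases h3.2 with rfl | h4 <;> omega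

/-- The depth that is computed for `n` keys. -/
theorem depthFor_spec_one (n : ℕ) :
    (depthFor n n 1 0).Spec (Nat.clog 2 n + 1) fun D => n ≤ 2 ^ D ∧ D ≤ Nat.clog 2 n :=
  (depthFor_spec n n 0 (by rw [zero_add]; exact Nat.lt_two_pow_self.le)).mono (by omega)
    fun D h => ⟨h.1, by rcases h.2 with rfl | h <;> omega⟩

/-! # Inputs and events -/

variable {K : Type} [LinearOrder K] (I : SweepInput K) (M : Diagram)

/-- The input `I` describes a free space with the combinatorial structure `M`. -/
structure Models : Prop where
  valid : M.Valid I.numCells I.numHeights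
  left : ∀ {i y}, i < I.numCells → y < I.numHeights →
    (I.left i (I.height y) ≠ ⊤ ↔ i ∈ M.atHeight y)
  right : ∀ {i y}, i < I.numCells → y < I.numHeights →
    (I.right i (I.height y) ≠ ⊤ ↔ i ∈ M.atHeight y)
  strictMono : ∀ {a b}, a < I.numHeights → b < I.numHeights → (I.height a ≤ I.height b ↔ a ≤ b)
  range_some : ∀ {i}, M.cell i → I.range i = some (I.height (M.bot i), I.height (M.top i))
  range_none : ∀ {i}, i < I.numCells → ¬ M.cell i → I.range i = none
  gate_some : ∀ {k}, M.gate k → I.gate k = some (I.height (M.lo k), I.height (M.hi k))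
  gate_none : ∀ {k}, k < I.numCells → ¬ M.gate k → I.gate k = none
  top_le : ∀ {i a b}, M.cell i → M.bot i ≤ a → a ≤ b → b < M.top i →
    I.left i (I.height a) < (I.topX i : WithTop K) → I.left i (I.height b) < (I.topX i : WithTop K)
  le_bot : ∀ {i a b}, M.cell i → M.bot i < a → a ≤ b → b ≤ M.top i →
    I.right i (I.height a) ≤ (I.botX i : WithTop K) → I.right i (I.height b) ≤ (I.botX i : WithTop K)
  bad_iff : ∀ {i s t}, s < I.numHeights → t < I.numHeights → i ∈ M.atHeight s → i ∈ M.atHeight t →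
    (badAt I s t i = true ↔ I.topX i ≤ I.botX i ∧ (I.topX i : WithTop K) ≤ I.left i (I.height s) ∧
      I.right i (I.height t) ≤ (I.botX i : WithTop K))

/-- The list of events at an index. -/
def Trie.list (T : Trie (List ℕ)) (k : ℕ) : List ℕ := (T.fn k).getD []

theorem eventsAt_spec {D : ℕ} {T : Trie (List ℕ)} (hT : T.WF D) (k : ℕ) :
    (eventsAt T k).Spec (2 * (D + 1)) fun xs => xs = T.list k := by
  refine .tick (by omega) <| .bind (Trie.find_spec hT k) (by omega) fun e he => ?_
  subst he
  unfold Trie.list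
  cases T.fn k with
  | none => exact .pure rfl
  | some xs => exact .pure rfl

/-- The number of events at an index. -/
def Events.weight (ev : Events) (k : ℕ) : ℕ :=
  (ev.botAt.list k).length + (ev.topAt.list k).length + (ev.loAt.list k).length +
    (ev.hiAt.list k).length + (ev.flipS.list k).length + (ev.flipT.list k).length

/-- The list at an index contains, without repetition, the elements with the property. -/
def IsEventList (T : Trie (List ℕ)) (k : ℕ) (p : ℕ → Prop) : Prop :=
  (T.list k).Nodup ∧ ∀ i, i ∈ T.list k ↔ p i

/-- The events have been computed correctly. -/
structure EventsOK (D : ℕ) (ev : Events) : Prop where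
  wf_botAt : ev.botAt.WF D
  wf_topAt : ev.topAt.WF D
  wf_loAt : ev.loAt.WF D
  wf_hiAt : ev.hiAt.WF D
  wf_flipS : ev.flipS.WF D
  wf_flipT : ev.flipT.WF D
  botAt : ∀ k, IsEventList ev.botAt k fun i => M.cell i ∧ M.bot i = k
  topAt : ∀ k, IsEventList ev.topAt k fun i => M.cell i ∧ M.top i = k
  loAt : ∀ k, IsEventList ev.loAt k fun i => M.gate i ∧ M.lo i = k
  hiAt : ∀ k, IsEventList ev.hiAt k fun i => M.gate i ∧ M.hi i = k
  flipS_lt : ∀ k, ∀ i ∈ ev.flipS.list k, i < I.numCells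
  flipT_lt : ∀ k, ∀ i ∈ ev.flipT.list k, i < I.numCells
  flipS_bot : ∀ i, M.cell i → i ∈ ev.flipS.list (M.bot i)
  flipS_top : ∀ i, M.cell i → i ∈ ev.flipS.list (M.top i)
  flipT_bot : ∀ i, M.cell i → i ∈ ev.flipT.list (M.bot i)
  flipT_top : ∀ i, M.cell i → i ∈ ev.flipT.list (M.top i)
  flipS : ∀ i s t, i < I.numCells → s + 1 < I.numHeights → t < I.numHeights →
    i ∉ ev.flipS.list (s + 1) → i ∉ ev.flipS.list s → badAt I s t i = badAt I (s + 1) t i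
  flipT : ∀ i s t, i < I.numCells → s < I.numHeights → t + 1 < I.numHeights →
    i ∉ ev.flipT.list (t + 1) → i ∉ ev.flipT.list t → badAt I s t i = badAt I s (t + 1) i

/-- The gates that do not contain a height. -/
def Diagram.cutAt (n y : ℕ) : Set ℕ := {k | k < n ∧ ¬ (M.gate k ∧ M.lo k ≤ y ∧ y ≤ M.hi k)}

/-- The invariant between two moves. -/
def SweepInv (D s t : ℕ) (σ : State) : Prop :=
  Inv I M D s t ∅ ∅ (M.atHeight s) (M.atHeight t) (M.opened s t) (M.cutAt I.numCells s) σ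

variable {I M}

theorem Inv.congr {D s t : ℕ} {σ : State} {pend pendL S T O Z pend' pendL' S' T' O' Z' : Set ℕ}
    (h : Inv I M D s t pend pendL S T O Z σ) (h1 : pend = pend') (h2 : pendL = pendL')
    (h3 : S = S') (h4 : T = T') (h5 : O = O') (h6 : Z = Z') :
    Inv I M D s t pend' pendL' S' T' O' Z' σ := by
  subst h1 h2 h3 h4 h5 h6
  exact h

/-- Changing the heights makes some indices pending. -/
theorem Inv.change_heights {D s t s' t' : ℕ} {σ : State} {S T O Z : Set ℕ} {P : Set ℕ}
    (h : Inv I M D s t ∅ ∅ S T O Z σ)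
    (hP : ∀ i < I.numCells, i ∉ P →
      badAt I s' t' i = badAt I s t i ∧ (Loc I s' t' i ↔ Loc I s t i)) :
    Inv I M D s' t' P P S T O Z { σ with s := s', t := t' } := by
  have hw := h.wf
  refine ⟨rfl, rfl, ⟨hw.U, hw.L, hw.G, hw.Gr, hw.starts, hw.cuts⟩, h.mem_lt, h.gate_lt, h.U, h.G,
    ⟨h.gr.run, fun c d a h1 h2 h3 h4 h5 => ?_⟩, ⟨h.L.eq, fun i h1 h2 => ?_⟩, h.starts, h.cuts⟩
  · have ha : a < I.numCells := by
      obtain ⟨b, hb⟩ := Option.ne_none_iff_exists'.1 h2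
      exact (h.G_lt hb).1
    have := h.gr.link c d a h1 h2 h3 h4 (by simp)
    rw [h.s_eq, h.t_eq] at this
    rw [this]
    simp only [(hP a ha h5).1]
  · have := h.L.iff i h1 (by simp)
    rw [h.s_eq, h.t_eq] at this
    rw [this, (hP i h1 h2).2]

theorem Inv.ends_subset {D s t : ℕ} {σ : State} {pend pendL S T O Z T' : Set ℕ}
    (h : Inv I M D s t pend pendL S T O Z σ) (hsub : ∀ i ∈ T', i ∈ T)
    (hT : ∀ i j, i < j → M.pass O i j → j ∈ T → j ∈ T') : Inv I M D s t pend pendL S T' O Z σ :=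
  ⟨h.s_eq, h.t_eq, h.wf, h.mem_lt, h.gate_lt, h.U, h.G.congr fun i j =>
    ⟨fun ⟨h1, h2, h3, h4⟩ => ⟨h1, hT i j (by omega) h3 h2, h3, h4⟩,
      fun ⟨h1, h2, h3⟩ => ⟨h1, hsub j h2, h3⟩⟩, h.gr, h.L, h.starts, h.cuts⟩

theorem refreshLocal_inv {D s t : ℕ} {σ : State} {pend pendL S T O Z : Set ℕ}
    (h : Inv I M D s t pend pendL S T O Z σ) (hD : I.numCells ≤ 2 ^ D) {i : ℕ}
    (hi : i < I.numCells) :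
    (refreshLocal I σ i).Spec (200 * (D + 1)) (Inv I M D s t pend (pendL \ {i}) S T O Z) :=
  (refreshLocal_spec I h.wf h.L h.G.inc hD hi).mono (by omega) fun _ ⟨h1, h2, h3⟩ =>
    Inv.of_updates (.refl I h.wf h.gr) ⟨h1, h2, h3⟩ h.s_eq h.t_eq h.mem_lt h.gate_lt h.U h.G
      h.starts h.cuts

/-- The gate `k`, which contains the height `y`, opens when the start is at height `y`. -/
theorem Diagram.Valid.opens {n m : ℕ} (hM : M.Valid n m) {O Z : Set ℕ} {y j k : ℕ}
    (hk : M.gate k) (hlo : M.lo k ≤ y) (hhi : y ≤ M.hi k) (hkO : k ∉ O)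
    (hO : ∀ g ∈ O, M.gate g ∧ y ≤ M.hi g) (hZ : ∀ g < k, g ∉ Z → g ∈ O ∧ M.lo g ≤ y)
    (hZO : ∀ g ∈ O, g < k → g ∈ Z → M.hi k < M.lo g) (hjk : j ≤ k)
    (hj : ∀ g, j ≤ g → g < k → g ∉ Z) (hj' : j = 0 ∨ j - 1 ∈ Z) :
    Opens (M.pass O) (M.pass (insert k O)) (M.atHeight y) j k where
  le := hjk
  closed i b h1 h2 h3 := hkO (h3.2.1 k h1 h2)
  horizontal := ⟨hjk, fun g h1 h2 => (hZ g h2 (hj g h1 h2)).1, fun g l h1 h2 h3 =>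
    (hZ g (by omega) (hj g h1 (by omega))).2.trans (hO l (hZ l h3 (hj l (by omega) h3)).1).2⟩
  mem := by
    rcases hjk.lt_or_eq with h1 | rfl
    · obtain ⟨h2, h3⟩ := hZ j h1 (hj j le_rfl h1)
      obtain ⟨h4, h5⟩ := hO j h2
      obtain ⟨h6, h7, h8⟩ := hM.cell_left h4
      exact ⟨h6, h7.trans h3, h5.trans h8⟩
    · obtain ⟨h6, h7, h8⟩ := hM.cell_left hk
      exact ⟨h6, h7.trans hlo, hhi.trans h8⟩
  mem' := by
    obtain ⟨h6, h7, h8⟩ := hM.cell_right hk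
    exact ⟨h6, h7.trans hlo, hhi.trans h8⟩
  iff i b := by
    have hhi' : ∀ g ∈ insert k O, y ≤ M.hi g := by
      rintro g (rfl | hg)
      · exact hhi
      · exact (hO g hg).2
    constructor
    · rintro ⟨h1, h2, h3⟩
      by_cases h4 : i ≤ k ∧ k < b
      · refine .inr ⟨?_, h4.1, h4.2, h4.2, fun g h5 h6 => ?_, fun g l h5 => h3 g l (by omega)⟩
        · by_contra h5
          have h6 : j - 1 ∈ O := (h2 (j - 1) (by omega) (by omega)).resolve_left (by omega)
          have h7 := hZO _ h6 (by omega) (hj'.resolve_left (by omega))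
          have := h3 (j - 1) k (by omega) (by omega) h4.2
          omega
        · exact (h2 g (by omega) h6).resolve_left (by omega)
      · exact .inl ⟨h1, fun g h5 h6 => (h2 g h5 h6).resolve_left (by omega), h3⟩
    · rintro (⟨h1, h2, h3⟩ | ⟨h1, h2, h3, h4, h5, h6⟩)
      · exact ⟨h1, fun g h5 h6 => .inr (h2 g h5 h6), h3⟩
      · have hmem : ∀ g, i ≤ g → g < b → g ∈ insert k O := by
          intro g h7 h8
          rcases lt_trichotomy g k with h9 | h9 | h9
          · exact .inr (hZ g h9 (hj g (by omega) h9)).1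
          · exact .inl h9
          · exact .inr (h5 g h9 h8)
        refine ⟨by omega, hmem, fun g l h7 h8 h9 => ?_⟩
        have h10 := hhi' l (hmem l (by omega) h9)
        rcases lt_trichotomy g k with h11 | rfl | h11
        · exact (hZ g h11 (hj g (by omega) h11)).2.trans h10
        · exact hlo.trans h10
        · exact h6 g l h11 h8 h9

/-- The gate `k` closes when the end moves down from its lowest point. -/
theorem Diagram.closes {O : Set ℕ} {k : ℕ} (hkO : k ∈ O) (hk : M.lo k ≤ M.hi k)
    (hO : ∀ g ∈ O, M.lo g ≤ M.lo k) :
    Closes (M.pass O) (M.pass (O \ {k}))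
      {b | M.pass O (k + 1) b ∧ ∀ l, k < l → l < b → M.lo k ≤ M.hi l} k where
  iff i b := by
    constructor
    · rintro ⟨h1, h2, h3⟩
      exact ⟨⟨h1, fun g h4 h5 => (h2 g h4 h5).1, h3⟩, fun h4 => (h2 k h4.1 h4.2).2 rfl⟩
    · rintro ⟨⟨h1, h2, h3⟩, h4⟩
      refine ⟨h1, fun g h5 h6 => ⟨h2 g h5 h6, ?_⟩, h3⟩
      rintro rfl
      exact h4 ⟨h5, h6⟩
  through i b hik hkb := by
    constructor
    · rintro ⟨h1, h2, h3⟩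
      exact ⟨⟨hik, fun g h4 h5 => h2 g h4 (by omega), fun g l h4 h5 h6 => h3 g l h4 h5 (by omega)⟩,
        ⟨hkb, fun g h4 h5 => h2 g (by omega) h5, fun g l h4 h5 h6 => h3 g l (by omega) h5 h6⟩,
        fun l h4 h5 => h3 k l hik h4 h5⟩
    · rintro ⟨⟨-, h2, h3⟩, ⟨-, h5, h6⟩, h7⟩
      have hmem : ∀ g, i ≤ g → g < b → g ∈ O := by
        intro g h8 h9
        rcases lt_trichotomy g k with h10 | rfl | h10
        · exact h2 g h8 h10
        · exact hkO
        · exact h5 g h10 h9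
      refine ⟨by omega, hmem, fun g l h8 h9 h10 => ?_⟩
      have h11 := hO g (hmem g h8 (by omega))
      rcases lt_trichotomy l k with h12 | rfl | h12
      · exact h3 g l h8 h9 h12
      · exact h11.trans hk
      · exact h11.trans (h7 l h12 h10)

variable {D : ℕ} {σ : State} {ev : Events} {s t D' : ℕ}

/-- Refreshing all indices of a list. -/
theorem forList_refresh_spec {P S T O Z : Set ℕ} (hD : I.numCells ≤ 2 ^ D) (xs : List ℕ)
    (hxs : ∀ i ∈ xs, i < I.numCells)
    (h : Inv I M D s t ({i | i ∈ xs} ∪ P) ({i | i ∈ xs} ∪ P) S T O Z σ) :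
    (forList (refresh I) xs σ).Spec (xs.length * (200 * (D + 1) + 1) + 1)
      (Inv I M D s t P P S T O Z) := by
  have := forList_spec (f := refresh I) (c := 200 * (D + 1))
    (P := fun xs σ => (∀ i ∈ xs, i < I.numCells) ∧
      ∃ Q ⊆ {i | i ∈ xs} ∪ P, Inv I M D s t Q Q S T O Z σ) ?_ xs ⟨hxs, _, subset_rfl, h⟩
  · refine this.mono le_rfl ?_
    rintro σ ⟨-, Q, hQ, h⟩
    have hQ' : ∀ i ∈ Q, i ∈ P := fun i hi => (hQ hi).resolve_left (by simp)
    exact ⟨h.s_eq, h.t_eq, h.wf, h.mem_lt, h.gate_lt, h.U, h.G,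
      ⟨h.gr.run, fun c d a h1 h2 h3 h4 h5 => h.gr.link c d a h1 h2 h3 h4 fun h6 => h5 (hQ' a h6)⟩,
      h.L.mono hQ', h.starts, h.cuts⟩
  · rintro i xs σ ⟨h1, Q, hQ, h⟩
    refine (refresh_spec h hD (h1 i (by simp))).mono le_rfl fun σ' h' =>
      ⟨fun j hj => h1 j (by simp [hj]), _, ?_, h'⟩
    rintro j ⟨hj, hji⟩
    rcases hQ hj with h2 | h2
    · rcases List.mem_cons.1 h2 with h3 | h3
      · exact absurd h3 hji
      · exact .inl h3
    · exact .inr h2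

end SubtrajSweep

namespace SubtrajSweep

/-! # Moving the start and the end -/

variable {K : Type} [LinearOrder K] {I : SweepInput K} {M : Diagram} {D : ℕ} {σ : State}
  {ev : Events} {s t D' : ℕ}

theorem Models.loc_start (hM : Models I M) (hE : EventsOK I M D' ev) (hs : s + 1 < I.numHeights)
    (ht : t < I.numHeights) {i : ℕ} (hi : i < I.numCells)
    (hP : i ∉ {i | i ∈ ev.flipS.list (s + 1)} ∪ {i | i ∈ ev.flipS.list s}) :
    badAt I s t i = badAt I (s + 1) t i ∧ (Loc I s t i ↔ Loc I (s + 1) t i) := by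
  have h1 := hE.flipS i s t hi hs ht (fun h => hP (.inl h)) fun h => hP (.inr h)
  refine ⟨h1, ?_⟩
  unfold Loc
  rw [h1, hM.left hi (by omega), hM.left hi hs]
  refine and_congr_left fun _ => ⟨fun ⟨h2, h3, h4⟩ => ⟨h2, by omega, ?_⟩,
    fun ⟨h2, h3, h4⟩ => ⟨h2, ?_, by omega⟩⟩
  · by_contra h5
    have h6 := hE.flipS_top i h2
    rw [show M.top i = s by omega] at h6
    exact hP (.inr h6)
  · by_contra h5
    have h6 := hE.flipS_bot i h2
    rw [show M.bot i = s + 1 by omega] at h6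
    exact hP (.inl h6)

theorem Models.loc_end (hM : Models I M) (hE : EventsOK I M D' ev) (hs : s < I.numHeights)
    (ht : t + 1 < I.numHeights) {i : ℕ} (hi : i < I.numCells)
    (hP : i ∉ {i | i ∈ ev.flipT.list (t + 1)} ∪ {i | i ∈ ev.flipT.list t}) :
    badAt I s t i = badAt I s (t + 1) i ∧ (Loc I s t i ↔ Loc I s (t + 1) i) := by
  have h1 := hE.flipT i s t hi hs ht (fun h => hP (.inl h)) fun h => hP (.inr h)
  refine ⟨h1, ?_⟩
  unfold Loc
  rw [h1, hM.right hi (by omega), hM.right hi ht]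
  refine and_congr_right fun _ => and_congr_left fun _ => ⟨fun ⟨h2, h3, h4⟩ => ⟨h2, by omega, ?_⟩,
    fun ⟨h2, h3, h4⟩ => ⟨h2, ?_, by omega⟩⟩
  · by_contra h5
    have h6 := hE.flipT_top i h2
    rw [show M.top i = t by omega] at h6
    exact hP (.inr h6)
  · by_contra h5
    have h6 := hE.flipT_bot i h2
    rw [show M.bot i = t + 1 by omega] at h6
    exact hP (.inl h6)

/-- Run a loop over the events at an index. -/
theorem Timed.Spec.bind_events {β : Type} {T : Trie (List ℕ)} (hT : T.WF D') (k : ℕ)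
    {f : List ℕ → Timed β} {R : β → Prop} {c : ℕ} (hc : 2 * (D' + 1) ≤ c)
    (h : (f (T.list k)).Spec (c - 2 * (D' + 1)) R) : (eventsAt T k >>= f).Spec c R :=
  .bind (eventsAt_spec hT k) hc fun _ he => he ▸ h

theorem advanceStart_spec (hM : Models I M) (hE : EventsOK I M D' ev) (hD : I.numCells ≤ 2 ^ D)
    (h : SweepInv I M D (s + 1) t σ) (hst : s ≤ t) (ht : t < I.numHeights)
    (hs : s + 1 < I.numHeights) :
    (advanceStart I ev σ s).Spec
      (19 * (D' + 1) + (ev.weight (s + 1) + ev.weight s) * (200 * (D + 1) + 1))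
      (SweepInv I M D s t) := by
  have hV := hM.valid
  have h0 := h.change_heights fun i hi hP => hM.loc_start hE hs ht hi hP
  rw [show ({ σ with s := s, t := t } : State) = { σ with s := s } by rw [← h.t_eq]] at h0
  have hw : (ev.weight (s + 1) + ev.weight s) * (200 * (D + 1) + 1) ≥
      (ev.loAt.list (s + 1)).length * (200 * (D + 1) + 1) +
      (ev.botAt.list (s + 1)).length * (200 * (D + 1) + 1) +
      (ev.topAt.list s).length * (200 * (D + 1) + 1) +
      (ev.hiAt.list s).length * (200 * (D + 1) + 1) +
      (ev.flipS.list (s + 1)).length * (200 * (D + 1) + 1) +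
      (ev.flipS.list s).length * (200 * (D + 1) + 1) := by
    simp only [← Nat.add_mul]
    exact Nat.mul_le_mul_right _ (by unfold Events.weight; omega)
  have hloc : ∀ j < I.numCells, j ∉ {i | i ∈ ev.flipS.list (s + 1)} ∪ {i | i ∈ ev.flipS.list s} →
      Loc I s t j → (M.cell j ∧ M.bot j ≤ s ∧ s < M.top j) ∧ j ∈ M.atHeight t := by
    intro j hj hjP hl
    have h1 := (hM.left hj (by omega)).1 hl.1
    refine ⟨⟨h1.1, h1.2.1, ?_⟩, (hM.right hj ht).1 hl.2.1⟩
    have h2 := h1.2.2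
    by_contra h3
    have h4 := hE.flipS_top j h1.1
    rw [show M.top j = s by omega] at h4
    exact hjP (.inr h4)
  set P := {i | i ∈ ev.flipS.list (s + 1)} ∪ {i | i ∈ ev.flipS.list s} with hP
  unfold advanceStart
  refine .tick (by omega) ?_
  dsimp only
  rw [h.s_eq]
  refine .bind_events hE.wf_loAt _ (by omega) ?_
  refine .bind (forList_spec_of_nodup (c := 200 * (D + 1)) (fun xs σ =>
    Inv I M D s t P P (M.atHeight (s + 1)) (M.atHeight t) (M.opened (s + 1) t)
      {k | k < I.numCells ∧ ¬ (M.gate k ∧ (M.lo k ≤ s ∨ k ∈ xs) ∧ s + 1 ≤ M.hi k)} σ)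
    (hE.loAt _).1 ?_ ?_) (by omega) fun σ₁ h1 => ?_
  · intro x xs τ hx hxs hτ
    obtain ⟨hx1, hx2⟩ := ((hE.loAt _).2 x).1 hx
    have hxn := hV.gate_lt hx1
    refine (leaveGate_spec hτ (k := x) (by omega)).mono le_rfl fun τ' h' =>
      h'.congr rfl rfl rfl rfl rfl ?_
    ext k
    simp only [mem_insert_iff, mem_ofPred_eq, List.mem_cons]
    constructor
    · rintro (rfl | ⟨h1, h2⟩)
      · exact ⟨by omega, fun h3 => h3.2.1.elim (by omega) hxs⟩
      · exact ⟨h1, fun h3 => h2 ⟨h3.1, h3.2.1.imp_right .inr, h3.2.2⟩⟩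
    · rintro ⟨h1, h2⟩
      by_cases hk : k = x
      · exact .inl hk
      · exact .inr ⟨h1, fun h3 => h2 ⟨h3.1, h3.2.1.imp_right (·.resolve_left hk), h3.2.2⟩⟩
  · refine h0.congr rfl rfl rfl rfl rfl ?_
    ext k
    simp only [Diagram.cutAt, mem_ofPred_eq, (hE.loAt _).2]
    refine and_congr_right fun _ => not_congr (and_congr_right fun hg => and_congr_left fun _ => ?_)
    simp only [hg, true_and]
    omega
  refine .bind_events hE.wf_botAt _ (by omega) ?_
  refine .bind (forList_spec_of_nodup (c := 200 * (D + 1)) (fun xs σ =>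
    Inv I M D s t P P {i | M.cell i ∧ (M.bot i ≤ s ∨ i ∈ xs) ∧ s + 1 ≤ M.top i} (M.atHeight t)
      (M.opened (s + 1) t) {k | k < I.numCells ∧ ¬ (M.gate k ∧ M.lo k ≤ s ∧ s + 1 ≤ M.hi k)} σ)
    (hE.botAt _).1 ?_ ?_) (by omega) fun σ₂ h2 => ?_
  · intro x xs τ hx hxs hτ
    obtain ⟨hx1, hx2⟩ := ((hE.botAt _).2 x).1 hx
    refine (leaveCell_spec hτ hD (hV.cell_lt hx1) fun j hj h3 h4 => ?_).mono le_rfl fun τ' h' =>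
      h'.congr rfl rfl ?_ rfl rfl rfl
    · obtain ⟨⟨h5, h6, h7⟩, -⟩ := hloc j hj h3 h4
      exact ⟨⟨h5, .inl h6, h7⟩, by rintro rfl; omega⟩
    · ext k
      simp only [mem_sdiff, mem_singleton_iff, mem_ofPred_eq, List.mem_cons]
      constructor
      · rintro ⟨⟨h3, h4, h5⟩, h6⟩
        exact ⟨h3, h4.imp_right (·.resolve_left h6), h5⟩
      · rintro ⟨h3, h4, h5⟩
        refine ⟨⟨h3, h4.imp_right .inr, h5⟩, ?_⟩
        rintro rfl
        exact h4.elim (by omega) hxs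
  · refine h1.congr rfl rfl ?_ rfl rfl (by simp)
    ext k
    simp only [Diagram.atHeight, mem_ofPred_eq, (hE.botAt _).2]
    refine and_congr_right fun hg => and_congr_left fun _ => ?_
    simp only [hg, true_and]
    omega
  refine .bind_events hE.wf_topAt _ (by omega) ?_
  refine .bind (forList_spec_of_nodup (c := 200 * (D + 1)) (fun xs σ =>
    Inv I M D s t P P {i | i ∈ M.atHeight s ∧ (s + 1 ≤ M.top i ∨ i ∉ xs)} (M.atHeight t)
      (M.opened (s + 1) t) {k | k < I.numCells ∧ ¬ (M.gate k ∧ M.lo k ≤ s ∧ s + 1 ≤ M.hi k)} σ)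
    (hE.topAt _).1 ?_ ?_) (by omega) fun σ₃ h3 => ?_
  · intro x xs τ hx hxs hτ
    obtain ⟨hx1, hx2⟩ := ((hE.topAt _).2 x).1 hx
    refine (enterCell_spec hτ hD (hV.cell_lt hx1) ?_ ?_).mono le_rfl fun τ' h' =>
      h'.congr rfl rfl ?_ rfl rfl rfl
    · rintro ⟨h4, h5, h6⟩
      have := (hV.cell_left h4).2.2
      omega
    · rintro k ⟨h4, h5, h6⟩ rfl
      have := (hV.cell_right h4).2.2
      omega
    · ext k
      simp only [mem_insert_iff, mem_ofPred_eq, List.mem_cons, not_or]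
      constructor
      · rintro (rfl | ⟨h4, h5⟩)
        · have := hV.bot_le hx1
          exact ⟨⟨hx1, by omega, by omega⟩, .inr hxs⟩
        · exact ⟨h4, h5.imp_right (·.2)⟩
      · rintro ⟨h4, h5⟩
        by_cases hk : k = x
        · exact .inl hk
        · exact .inr ⟨h4, h5.imp_right fun h6 => ⟨hk, h6⟩⟩
  · refine h2.congr rfl rfl ?_ rfl rfl rfl
    ext k
    simp only [Diagram.atHeight, mem_ofPred_eq, (hE.topAt _).2, List.not_mem_nil, or_false]
    constructor
    · rintro ⟨h4, h5, h6⟩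
      exact ⟨⟨h4, h5, by omega⟩, .inl h6⟩
    · rintro ⟨⟨h4, h5, h6⟩, h7⟩
      exact ⟨h4, h5, h7.elim id fun h8 => by
        have : M.top k ≠ s := fun h9 => h8 ⟨h4, h9⟩
        omega⟩
  refine .bind_events hE.wf_hiAt _ (by omega) ?_
  refine .bind (forList_spec_of_nodup (c := 200 * (D + 1)) (fun xs σ =>
    Inv I M D s t P P (M.atHeight s) (M.atHeight t)
      {k | k ∈ M.opened s t ∧ (s + 1 ≤ M.hi k ∨ k ∉ xs)}
      {k | k < I.numCells ∧ ¬ (M.gate k ∧ M.lo k ≤ s ∧ s ≤ M.hi k ∧ (s + 1 ≤ M.hi k ∨ k ∉ xs))} σ)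
    (hE.hiAt _).1 ?_ ?_) (by omega) fun σ₄ h4 => ?_
  · intro x xs τ hx hxs hτ
    obtain ⟨hx1, hx2⟩ := ((hE.hiAt _).2 x).1 hx
    have hxn := hV.gate_lt hx1
    have hxl := hV.lo_le hx1
    refine (openGate_spec hτ hD hxn (fun j hj h5 h6 => hV.opens hx1 (by omega) (by omega) ?_ ?_ ?_ ?_
      hj h5 h6) (hM.right hxn ht) fun j hj h5 h6 => (hloc j hj h5 h6).2).mono le_rfl
      fun τ' h' => h'.congr rfl rfl rfl rfl ?_ ?_
    · rintro ⟨h7, h8⟩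
      exact h8.elim (by omega) (fun h => h (by simp))
    · rintro g ⟨h7, -⟩
      exact ⟨h7.1, h7.2.2⟩
    · intro g hg hgZ
      obtain ⟨h7, h8, h9, h10⟩ := by_contra fun h => hgZ ⟨by omega, h⟩
      exact ⟨⟨⟨h7, by omega, h9⟩, h10⟩, h8⟩
    · rintro g ⟨h7, h8⟩ hg ⟨-, h9⟩
      rw [hx2]
      by_contra h10
      exact h9 ⟨h7.1, by omega, h7.2.2, h8⟩
    · ext k
      simp only [mem_insert_iff, mem_ofPred_eq, List.mem_cons, not_or]
      constructor
      · rintro (rfl | ⟨h5, h6⟩)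
        · exact ⟨⟨hx1, by omega, by omega⟩, .inr hxs⟩
        · exact ⟨h5, h6.imp_right (·.2)⟩
      · rintro ⟨h5, h6⟩
        by_cases hk : k = x
        · exact .inl hk
        · exact .inr ⟨h5, h6.imp_right fun h6 => ⟨hk, h6⟩⟩
    · ext k
      simp only [mem_sdiff, mem_singleton_iff, mem_ofPred_eq, List.mem_cons, not_or]
      constructor
      · rintro ⟨⟨h5, h6⟩, h7⟩
        exact ⟨h5, fun ⟨h8, h9, h10, h11⟩ => h6 ⟨h8, h9, h10, h11.imp_right fun h => ⟨h7, h⟩⟩⟩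
      · rintro ⟨h5, h6⟩
        refine ⟨⟨h5, fun ⟨h8, h9, h10, h11⟩ => h6 ⟨h8, h9, h10, h11.imp_right (·.2)⟩⟩, ?_⟩
        rintro rfl
        exact h6 ⟨hx1, by omega, by omega, .inr hxs⟩
  · refine h3.congr rfl rfl (by simp) rfl ?_ ?_
    · ext k
      simp only [Diagram.opened, mem_ofPred_eq, (hE.hiAt _).2]
      constructor
      · rintro ⟨h5, h6, h7⟩
        exact ⟨⟨h5, h6, by omega⟩, .inl h7⟩
      · rintro ⟨⟨h5, h6, h7⟩, h8⟩
        exact ⟨h5, h6, h8.elim id fun h9 => by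
          have : M.hi k ≠ s := fun h10 => h9 ⟨h5, h10⟩
          omega⟩
    · ext k
      simp only [mem_ofPred_eq, (hE.hiAt _).2]
      refine and_congr_right fun _ => not_congr (and_congr_right fun hg => and_congr_right fun _ => ?_)
      simp only [hg, true_and]
      omega
  refine .bind_events hE.wf_flipS _ (by omega) ?_
  refine .bind (forList_refresh_spec hD _ (hE.flipS_lt _) h4) (by omega) fun σ₅ h5 => ?_
  refine .bind_events hE.wf_flipS _ (by omega) ?_
  refine (forList_refresh_spec (P := ∅) hD _ (hE.flipS_lt _) (h5.congr (by simp) (by simp) rfl rfl rfl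
    rfl)).mono (by omega) fun σ₆ h6 => h6.congr rfl rfl rfl rfl ?_ ?_
  · simp
  · ext k
    simp [Diagram.cutAt]

theorem advanceEnd_spec (hM : Models I M) (hE : EventsOK I M D' ev) (hD : I.numCells ≤ 2 ^ D)
    (h : SweepInv I M D s (t + 1) σ) (hst : s ≤ t) (ht : t + 1 < I.numHeights) :
    (advanceEnd I ev σ t).Spec
      (19 * (D' + 1) + (ev.weight (t + 1) + ev.weight t) * (200 * (D + 1) + 1))
      (SweepInv I M D s t) := by
  have hV := hM.valid
  have hs : s < I.numHeights := by omega
  have h0 := h.change_heights fun i hi hP => hM.loc_end hE hs ht hi hP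
  rw [show ({ σ with s := s, t := t } : State) = { σ with t := t } by rw [← h.s_eq]] at h0
  have hw : (ev.weight (t + 1) + ev.weight t) * (200 * (D + 1) + 1) ≥
      (ev.loAt.list (t + 1)).length * (200 * (D + 1) + 1) +
      (ev.topAt.list t).length * (200 * (D + 1) + 1) +
      (ev.flipT.list (t + 1)).length * (200 * (D + 1) + 1) +
      (ev.flipT.list t).length * (200 * (D + 1) + 1) := by
    simp only [← Nat.add_mul]
    exact Nat.mul_le_mul_right _ (by unfold Events.weight; omega)
  have hloc : ∀ j < I.numCells, j ∉ {i | i ∈ ev.flipT.list (t + 1)} ∪ {i | i ∈ ev.flipT.list t} →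
      Loc I s t j → j ∈ M.atHeight s ∧ (M.cell j ∧ M.bot j ≤ t ∧ t < M.top j) := by
    intro j hj hjP hl
    have h1 := (hM.right hj (by omega)).1 hl.2.1
    refine ⟨(hM.left hj hs).1 hl.1, h1.1, h1.2.1, ?_⟩
    have h2 := h1.2.2
    by_contra h3
    have h4 := hE.flipT_top j h1.1
    rw [show M.top j = t by omega] at h4
    exact hjP (.inr h4)
  set P := {i | i ∈ ev.flipT.list (t + 1)} ∪ {i | i ∈ ev.flipT.list t} with hP
  unfold advanceEnd
  refine .tick (by omega) ?_
  dsimp only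
  rw [h.t_eq]
  refine .bind_events hE.wf_loAt _ (by omega) ?_
  refine .bind (forList_spec_of_nodup (c := 200 * (D + 1)) (fun xs σ =>
    Inv I M D s t P P (M.atHeight s) (M.atHeight (t + 1))
      {k | M.gate k ∧ (M.lo k ≤ t ∨ k ∈ xs ∧ M.lo k = t + 1) ∧ s ≤ M.hi k} (M.cutAt I.numCells s) σ)
    (hE.loAt _).1 ?_ ?_) (by omega) fun σ₁ h1 => ?_
  · intro x xs τ hx hxs hτ
    obtain ⟨hx1, hx2⟩ := ((hE.loAt _).2 x).1 hx
    have hxn := hV.gate_lt hx1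
    have hxl := hV.lo_le hx1
    obtain ⟨h1, h2, h3⟩ := hV.cell_left hx1
    obtain ⟨h4, h5, h6⟩ := hV.cell_right hx1
    refine (closeGate_spec hτ hD hxn (Diagram.closes (k := x) ?_ hxl ?_) ⟨h1, by omega, by omega⟩
      ⟨h4, by omega, by omega⟩ fun j hj h7 h8 => (hloc j hj h7 h8).1).mono le_rfl
      fun τ' h' => h'.congr rfl rfl rfl rfl ?_ rfl
    · exact ⟨hx1, .inr ⟨by simp, hx2⟩, by omega⟩
    · rintro g ⟨-, h7, -⟩
      omega
    · ext k
      simp only [mem_sdiff, mem_singleton_iff, mem_ofPred_eq, List.mem_cons]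
      constructor
      · rintro ⟨⟨h7, h8, h9⟩, h10⟩
        exact ⟨h7, h8.imp_right (And.imp_left (·.resolve_left h10)), h9⟩
      · rintro ⟨h7, h8, h9⟩
        refine ⟨⟨h7, h8.imp_right (And.imp_left .inr), h9⟩, ?_⟩
        rintro rfl
        exact h8.elim (by omega) fun h => hxs h.1
  · refine h0.congr rfl rfl rfl rfl ?_ rfl
    ext k
    simp only [Diagram.opened, mem_ofPred_eq, (hE.loAt _).2]
    refine and_congr_right fun hg => and_congr_left fun _ => ?_
    simp only [hg, true_and]
    omega
  have h1' : Inv I M D s t P P (M.atHeight s) {i | M.cell i ∧ M.bot i ≤ t ∧ t + 1 ≤ M.top i}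
      (M.opened s t) (M.cutAt I.numCells s) σ₁ := by
    refine Inv.ends_subset (h1.congr rfl rfl rfl rfl (by simp [Diagram.opened]) rfl)
      (fun i ⟨h2, h3, h4⟩ => ⟨h2, by omega, h4⟩) fun i j hij h2 h3 => ⟨h3.1, ?_, h3.2.2⟩
    obtain ⟨h4, h5, -⟩ := h2.2.1 (j - 1) (by omega) (by omega)
    obtain ⟨-, h6, -⟩ := hV.cell_right h4
    rw [show j - 1 + 1 = j by omega] at h6
    omega
  refine .bind_events hE.wf_topAt _ (by omega) ?_
  refine .bind (forList_spec_of_nodup (c := 200 * (D + 1)) (fun xs σ =>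
    Inv I M D s t P P (M.atHeight s) {i | i ∈ M.atHeight t ∧ (t + 1 ≤ M.top i ∨ i ∉ xs)}
      (M.opened s t) (M.cutAt I.numCells s) σ)
    (hE.topAt _).1 ?_ ?_) (by omega) fun σ₂ h2 => ?_
  · intro x xs τ hx hxs hτ
    obtain ⟨hx1, hx2⟩ := ((hE.topAt _).2 x).1 hx
    refine (enterCellEnd_spec hτ hD fun j hj h3 h4 => ?_).mono le_rfl fun τ' h' =>
      h'.congr rfl rfl rfl ?_ rfl rfl
    · obtain ⟨-, h5, h6, h7⟩ := hloc j hj h3 h4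
      exact ⟨⟨⟨h5, h6, h7.le⟩, .inl h7⟩, by rintro rfl; omega⟩
    · ext k
      simp only [mem_insert_iff, mem_ofPred_eq, List.mem_cons, not_or]
      constructor
      · rintro (rfl | ⟨h4, h5⟩)
        · have := hV.bot_le hx1
          exact ⟨⟨hx1, by omega, by omega⟩, .inr hxs⟩
        · exact ⟨h4, h5.imp_right (·.2)⟩
      · rintro ⟨h4, h5⟩
        by_cases hk : k = x
        · exact .inl hk
        · exact .inr ⟨h4, h5.imp_right fun h6 => ⟨hk, h6⟩⟩
  · refine h1'.congr rfl rfl rfl ?_ rfl rfl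
    ext k
    simp only [Diagram.atHeight, mem_ofPred_eq, (hE.topAt _).2]
    constructor
    · rintro ⟨h4, h5, h6⟩
      exact ⟨⟨h4, h5, by omega⟩, .inl h6⟩
    · rintro ⟨⟨h4, h5, h6⟩, h7⟩
      exact ⟨h4, h5, h7.elim id fun h8 => by
        have : M.top k ≠ t := fun h9 => h8 ⟨h4, h9⟩
        omega⟩
  refine .bind_events hE.wf_flipT _ (by omega) ?_
  refine .bind (forList_refresh_spec hD _ (hE.flipT_lt _) h2) (by omega) fun σ₃ h3 => ?_
  refine .bind_events hE.wf_flipT _ (by omega) ?_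
  refine (forList_refresh_spec (P := ∅) hD _ (hE.flipT_lt _) (h3.congr (by simp) (by simp) rfl rfl rfl
    rfl)).mono (by omega) fun σ₆ h6 => h6.congr rfl rfl rfl (by simp) rfl rfl

end SubtrajSweep

namespace SubtrajSweep

/-! # The initial state and the main loop -/

variable {K : Type} [LinearOrder K] {I : SweepInput K} {M : Diagram} {D : ℕ} {σ : State}
  {ev : Events} {s t D' : ℕ}

theorem Rep.empty {R : ℕ → ℕ → Prop} (h : ∀ i j, ¬ R i j) : Rep (fun _ => none) R :=
  ⟨fun h => by simp at h, fun h => by simp at h, fun hR => absurd hR (h _ _)⟩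

theorem initialState_spec (hM : Models I M) {a : ℕ} (ha : a < I.numHeights) {c : ℕ}
    (hc : Nat.clog 2 I.numCells + 1 + 200 * (Nat.clog 2 I.numCells + 1) * (4 * I.numCells + 1) +
      8 * I.numCells + 5 ≤ c) :
    (initialState I a).Spec c fun σ => ∃ D, I.numCells ≤ 2 ^ D ∧ D ≤ Nat.clog 2 I.numCells ∧
      SweepInv I M D a a σ := by
  have hV := hM.valid
  refine .tick (by omega) <| .bind (depthFor_spec_one _) (by omega) fun D ⟨hD, hDc⟩ => ?_
  have hmul : I.numCells * (200 * (D + 1) + 1 + 1) * 4 + 200 * (D + 1) ≤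
      200 * (Nat.clog 2 I.numCells + 1) * (4 * I.numCells + 1) + 8 * I.numCells := by
    have : (D + 1) * (4 * I.numCells + 1) ≤
        (Nat.clog 2 I.numCells + 1) * (4 * I.numCells + 1) := Nat.mul_le_mul_right _ (by omega)
    linarith
  refine .bind (Trie.empty_spec D) (by omega) fun E hE => ?_
  have h0 : Inv I M D a a ∅ univ ∅ (M.atHeight a) ∅ ∅ ⟨a, a, E, E, E, E, E, E⟩ := by
    refine ⟨rfl, rfl, ⟨hE.1, hE.1, hE.1, hE.1, hE.1, hE.1⟩, by simp, by simp, ?_, ?_, ⟨?_, ?_⟩,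
      ⟨?_, by simp⟩, by simp [hE.2.2], by simp [hE.2.2]⟩
    · simp only [hE.2.2]
      exact .empty fun i j h => h.1
    · simp only [hE.2.2]
      exact .empty fun i j h => h.1
    · refine ⟨?_, ?_, ?_⟩ <;> simp [hE.2.2]
    · intro c d a h
      simp [hE.2.2] at h
    · simp [hE.2.2]
  refine .bind (forRange_spec (c := 200 * (D + 1) + 1) (N := I.numCells) (fun x σ =>
    Inv I M D a a ∅ univ ∅ (M.atHeight a) ∅ {k | k < x} σ) (fun x τ hx hτ => ?_) _ 0 (by omega)
    (h0.congr rfl rfl rfl rfl rfl (by simp))) (by omega) fun σ₁ h1 => ?_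
  · refine (leaveGate_spec hτ (by omega)).mono (by omega) fun τ' h' =>
      h'.congr rfl rfl rfl rfl rfl ?_
    ext k
    simp only [mem_insert_iff, mem_ofPred_eq]
    omega
  refine .bind (forRange_spec (c := 200 * (D + 1) + 1) (N := I.numCells) (fun x σ =>
    Inv I M D a a ∅ univ {i | i ∈ M.atHeight a ∧ i < x} (M.atHeight a) ∅ {k | k < I.numCells} σ)
    (fun x τ hx hτ => ?_) _ 0 (by omega) (h1.congr rfl rfl (by simp) rfl rfl rfl)) (by omega)
    fun σ₂ h2 => ?_
  · refine .tick (by omega) ?_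
    rw [hτ.s_eq]
    split_ifs with hx'
    · refine (enterCell_spec hτ hD hx (by simp) (by simp)).mono (by omega) fun τ' h' =>
        h'.congr rfl rfl ?_ rfl rfl rfl
      ext k
      simp only [mem_insert_iff, mem_ofPred_eq]
      constructor
      · rintro (rfl | h)
        · exact ⟨(hM.left hx ha).1 hx', by omega⟩
        · exact ⟨h.1, by omega⟩
      · intro h
        by_cases hk : k = x
        · exact .inl hk
        · exact .inr ⟨h.1, by omega⟩
    · refine .pure (hτ.congr rfl rfl ?_ rfl rfl rfl)
      ext k
      simp only [mem_ofPred_eq]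
      refine and_congr_right fun hk => ⟨fun h => by omega, fun h => ?_⟩
      have : k ≠ x := by
        rintro rfl
        exact hx' ((hM.left hx ha).2 hk)
      omega
  refine .bind (forRange_spec (c := 200 * (D + 1) + 1) (N := I.numCells) (fun x σ =>
    Inv I M D a a ∅ univ (M.atHeight a) (M.atHeight a)
      {k | M.gate k ∧ M.lo k ≤ a ∧ a ≤ M.hi k ∧ k < x}
      {k | k < I.numCells ∧ ¬ (M.gate k ∧ M.lo k ≤ a ∧ a ≤ M.hi k ∧ k < x)} σ)
    (fun x τ hx hτ => ?_) _ 0 (by omega) (h2.congr rfl rfl ?_ rfl (by simp) (by simp))) (by omega)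
    fun σ₃ h3 => ?_
  · refine .tick (by omega) ?_
    rw [hτ.s_eq]
    by_cases hg : M.gate x
    · simp only [hM.gate_some hg]
      have hlo := hV.lo_le hg
      have hhi := (hV.top_lt (hV.cell_left hg).1).trans_le' (hV.cell_left hg).2.2
      have hxn := hV.gate_lt hg
      split_ifs with hx' <;> rw [hM.strictMono (by omega) ha, hM.strictMono ha hhi] at hx'
      · refine (openGate_spec hτ hD hxn (fun j hj h5 h6 => hV.opens hg hx'.1 hx'.2 ?_ ?_ ?_ ?_
          hj h5 h6) (hM.right hxn ha) (by simp)).mono (by omega)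
          fun τ' h' => h'.congr rfl rfl rfl rfl ?_ ?_
        · rintro ⟨-, -, -, h7⟩
          omega
        · rintro g ⟨h7, -, h8, -⟩
          exact ⟨h7, h8⟩
        · intro g hg hgZ
          obtain ⟨h7, h8, h9, h10⟩ := by_contra fun h => hgZ ⟨by omega, h⟩
          exact ⟨⟨h7, h8, h9, h10⟩, h8⟩
        · rintro g h7 - ⟨-, h8⟩
          exact absurd h7 h8
        · ext k
          simp only [mem_insert_iff, mem_ofPred_eq]
          constructor
          · rintro (rfl | ⟨h5, h6, h7, h8⟩)
            · exact ⟨hg, hx'.1, hx'.2, by omega⟩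
            · exact ⟨h5, h6, h7, by omega⟩
          · rintro ⟨h5, h6, h7, h8⟩
            by_cases hk : k = x
            · exact .inl hk
            · exact .inr ⟨h5, h6, h7, by omega⟩
        · ext k
          simp only [mem_sdiff, mem_singleton_iff, mem_ofPred_eq]
          constructor
          · rintro ⟨⟨h5, h6⟩, h7⟩
            exact ⟨h5, fun ⟨h8, h9, h10, h11⟩ => h6 ⟨h8, h9, h10, by omega⟩⟩
          · rintro ⟨h5, h6⟩
            refine ⟨⟨h5, fun ⟨h8, h9, h10, h11⟩ => h6 ⟨h8, h9, h10, by omega⟩⟩, ?_⟩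
            rintro rfl
            exact h6 ⟨hg, hx'.1, hx'.2, by omega⟩
      · have : ∀ k, (M.gate k ∧ M.lo k ≤ a ∧ a ≤ M.hi k ∧ k < x + 1 ↔
            M.gate k ∧ M.lo k ≤ a ∧ a ≤ M.hi k ∧ k < x) := by
          refine fun k => and_congr_right fun _ => and_congr_right fun h5 => and_congr_right fun h6 =>
            ⟨fun h => ?_, fun h => by omega⟩
          have : k ≠ x := by
            rintro rfl
            exact hx' ⟨h5, h6⟩
          omega
        exact .pure (hτ.congr rfl rfl rfl rfl (by simp only [this]) (by simp only [this]))
    · simp only [hM.gate_none hx hg]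
      have : ∀ k, (M.gate k ∧ M.lo k ≤ a ∧ a ≤ M.hi k ∧ k < x + 1 ↔
          M.gate k ∧ M.lo k ≤ a ∧ a ≤ M.hi k ∧ k < x) := by
        refine fun k => and_congr_right fun hk => and_congr_right fun h5 => and_congr_right fun h6 =>
          ⟨fun h => ?_, fun h => by omega⟩
        have : k ≠ x := by
          rintro rfl
          exact hg hk
        omega
      exact .pure (hτ.congr rfl rfl rfl rfl (by simp only [this]) (by simp only [this]))
  · ext k
    exact ⟨fun h => h.1, fun h => ⟨h, hV.cell_lt h.1⟩⟩
  refine (forRange_spec (c := 200 * (D + 1) + 1) (N := I.numCells) (fun x σ =>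
    Inv I M D a a ∅ {i | x ≤ i} (M.atHeight a) (M.atHeight a) (M.opened a a)
      (M.cutAt I.numCells a) σ)
    (fun x τ hx hτ => ?_) _ 0 (by omega) (h3.congr rfl (by ext; simp) rfl rfl ?_ ?_)).mono (by omega)
    fun σ₄ h4 => ⟨D, hD, hDc, h4.s_eq, h4.t_eq, h4.wf, h4.mem_lt, h4.gate_lt, h4.U, h4.G, h4.gr,
      ⟨h4.L.eq, fun i hi _ => h4.L.iff i hi (by simpa using hi)⟩, h4.starts, h4.cuts⟩
  · refine (refreshLocal_inv hτ hD hx).mono (by omega) fun τ' h' =>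
      h'.congr rfl ?_ rfl rfl rfl rfl
    ext k
    simp only [mem_sdiff, mem_singleton_iff, mem_ofPred_eq]
    omega
  · ext k
    refine ⟨fun h => ⟨h.1, h.2.1, h.2.2.1⟩, fun h => ⟨h.1, h.2.1, h.2.2, ?_⟩⟩
    have := hV.gate_lt h.1
    omega
  · ext k
    exact and_congr_right fun hk => not_congr (and_congr_right fun _ => and_congr_right fun _ =>
      ⟨fun h => h.1, fun h => ⟨h, hk⟩⟩)

/-- Twice the number of events at indices less than `k`, plus the number of events at `k`. -/
def Events.potential (ev : Events) (k : ℕ) : ℕ :=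
  ∑ i ∈ Finset.range k, ev.weight i + ∑ i ∈ Finset.range (k + 1), ev.weight i

theorem Events.potential_succ (ev : Events) (k : ℕ) :
    ev.potential (k + 1) = ev.potential k + (ev.weight (k + 1) + ev.weight k) := by
  unfold Events.potential
  rw [Finset.sum_range_succ _ (k + 1), Finset.sum_range_succ _ k]
  omega

/-- The next pair in the reversed sweep-sequence. -/
def StepsDown (p q : ℕ × ℕ) : Prop :=
  (p.1 = q.1 ∨ p.1 = q.1 + 1) ∧ (p.2 = q.2 ∨ p.2 = q.2 + 1)

theorem loopBody_spec (hM : Models I M) (hE : EventsOK I M D' ev) (hD : I.numCells ≤ 2 ^ D)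
    (h : SweepInv I M D s t σ) (hst : s ≤ t) (ht : t < I.numHeights) {p : ℕ × ℕ}
    (hp : StepsDown (s, t) p) (hp' : p.1 ≤ p.2) {c : ℕ}
    (hc : 39 * (D' + 1) + (ev.potential s + ev.potential t) * (200 * (D + 1) + 1) ≤
      c + (ev.potential p.1 + ev.potential p.2) * (200 * (D + 1) + 1)) :
    (loopBody I ev p σ).Spec c (SweepInv I M D p.1 p.2) := by
  obtain ⟨s', t'⟩ := p
  obtain ⟨h1, h2⟩ := hp
  dsimp only at h1 h2 hp' hc
  have hss : s' ≤ s := by omega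
  have hmono : ∀ {k l}, (k = l ∨ k = l + 1) → ∃ x, ev.potential k * (200 * (D + 1) + 1) =
      ev.potential l * (200 * (D + 1) + 1) + x ∧ (k = l + 1 →
      x = (ev.weight (l + 1) + ev.weight l) * (200 * (D + 1) + 1)) := by
    rintro k l (rfl | rfl)
    · exact ⟨0, rfl, by omega⟩
    · exact ⟨_, by rw [ev.potential_succ, Nat.add_mul], fun _ => rfl⟩
  obtain ⟨x, hx, hx'⟩ := hmono h1
  obtain ⟨y, hy, hy'⟩ := hmono h2
  rw [Nat.add_mul, Nat.add_mul, hx, hy] at hc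
  refine .tick (by omega) ?_
  dsimp only
  have hend : ∀ τ, SweepInv I M D s' t τ →
      (if t' ≠ τ.t then advanceEnd I ev τ t' else pure τ).Spec (19 * (D' + 1) + y)
        (SweepInv I M D s' t') := by
    intro τ hτ
    rw [hτ.t_eq]
    split_ifs with ht'
    · obtain rfl : t = t' + 1 := by omega
      exact (advanceEnd_spec hM hE hD hτ hp' ht).mono (by rw [← hy' rfl]) fun _ h => h
    · obtain rfl : t = t' := by omega
      exact .pure hτ
  rw [h.s_eq]
  split_ifs with hs
  · obtain rfl : s = s' + 1 := by omega
    exact .bind (advanceStart_spec hM hE hD h (by omega) ht (by omega)) (by rw [← hx' rfl]; omega)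
      fun τ hτ => (hend τ hτ).mono (by rw [← hx' rfl]; omega) fun _ h => h
  · obtain rfl : s = s' := by omega
    exact .bind (Q := fun τ => τ = σ) (c' := 0) (.pure rfl) (by omega)
      fun τ hτ => (hend τ (hτ ▸ h)).mono (by omega) fun _ h => h

theorem mainLoop_spec (hM : Models I M) (hE : EventsOK I M D' ev) (hD : I.numCells ≤ 2 ^ D)
    (ps : List (ℕ × ℕ)) (h : SweepInv I M D s t σ) (hchain : ((s, t) :: ps).IsChain StepsDown)
    (hps : ∀ p ∈ (s, t) :: ps, p.1 ≤ p.2 ∧ p.2 < I.numHeights) :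
    (mainLoop I ev ps σ).Spec (ps.length * (39 * (D' + 1) + 1) + 1 +
      (ev.potential s + ev.potential t) * (200 * (D + 1) + 1)) fun xs =>
      List.Forall₂ (fun p σ' => p.1 ≤ p.2 ∧ p.2 < I.numHeights ∧ SweepInv I M D p.1 p.2 σ')
        ((s, t) :: ps) xs := by
  induction ps generalizing s t σ with
  | nil =>
    obtain ⟨h1, h2⟩ := hps (s, t) (by simp)
    exact .tick (by omega) (.pure (.cons ⟨h1, h2, h⟩ .nil))
  | cons p ps ih =>
    obtain ⟨h1, h2⟩ := hps (s, t) (by simp)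
    obtain ⟨h3, h4⟩ := List.isChain_cons_cons.1 hchain
    have hlen : (p :: ps).length * (39 * (D' + 1) + 1) =
        ps.length * (39 * (D' + 1) + 1) + (39 * (D' + 1) + 1) := by
      rw [List.length_cons, Nat.succ_mul]
    have hle : (ev.potential p.1 + ev.potential p.2) * (200 * (D + 1) + 1) ≤
        (ev.potential s + ev.potential t) * (200 * (D + 1) + 1) := by
      have hmono : Monotone ev.potential :=
        monotone_nat_of_le_succ fun k => by rw [ev.potential_succ]; omega
      refine Nat.mul_le_mul_right _ (Nat.add_le_add (hmono ?_) (hmono ?_))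
      · have := h3.1
        dsimp only at this
        omega
      · have := h3.2
        dsimp only at this
        omega
    obtain ⟨x, hx⟩ := Nat.exists_eq_add_of_le hle
    refine .tick (by omega) <| .bind (loopBody_spec (c := 39 * (D' + 1) + x) hM hE hD h h1 h2 h3
      (hps p (by simp)).1 (by omega)) (by omega) fun σ' hσ' => ?_
    exact .bind (ih (s := p.1) (t := p.2) hσ' h4 fun q hq => hps q (List.mem_cons_of_mem _ hq))
      (by omega) fun xs hxs => .pure (.cons ⟨h1, h2, h⟩ hxs)

end SubtrajSweep

namespace SubtrajSweep

/-! # The computation of the events -/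

theorem bisect_spec {p : ℕ → Bool} {fuel lo hi : ℕ} (hfuel : hi - lo ≤ fuel) (hle : lo ≤ hi)
    (hp : ∀ x y, lo ≤ x → x ≤ y → y < hi → p x = true → p y = true) {L : ℕ} (hL : hi - lo < 2 ^ L) :
    (bisect p fuel lo hi).Spec (L + 1) fun r =>
      lo ≤ r ∧ r ≤ hi ∧ ∀ x, lo ≤ x → x < hi → (p x = true ↔ r ≤ x) := by
  induction fuel generalizing lo hi L with
  | zero => exact .tick (by omega) (.pure ⟨le_rfl, hle, fun x h1 h2 => by omega⟩)
  | succ fuel ih =>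
    refine .tick (by omega) ?_
    split_ifs with h1 h2
    · obtain ⟨L, rfl⟩ : ∃ L', L = L' + 1 :=
        Nat.exists_eq_succ_of_ne_zero (by rintro rfl; simp at hL; omega)
      rw [pow_succ] at hL
      refine (ih (L := L) (by omega) (by omega) (fun x y h3 h4 h5 => hp x y h3 h4 (by omega))
        (by omega)).mono (by omega) fun r ⟨h3, h4, h5⟩ => ⟨h3, by omega, fun x h6 h7 => ?_⟩
      by_cases h8 : x < (lo + hi) / 2
      · exact h5 x h6 h8
      · exact ⟨fun _ => by omega, fun _ => hp _ x (by omega) (by omega) h7 h2⟩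
    · obtain ⟨L, rfl⟩ : ∃ L', L = L' + 1 :=
        Nat.exists_eq_succ_of_ne_zero (by rintro rfl; simp at hL; omega)
      rw [pow_succ] at hL
      refine (ih (L := L) (by omega) (by omega) (fun x y h3 h4 h5 => hp x y (by omega) h4 h5)
        (by omega)).mono (by omega) fun r ⟨h3, h4, h5⟩ => ⟨by omega, h4, fun x h6 h7 => ?_⟩
      by_cases h8 : x ≤ (lo + hi) / 2
      · exact ⟨fun h9 => absurd (hp x _ h6 h8 (by omega) h9) h2, fun h9 => by omega⟩
      · exact h5 x (by omega) h7
    · exact .pure ⟨le_rfl, hle, fun x h2 h3 => by omega⟩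

theorem addEvent_spec {D : ℕ} {T : Trie (List ℕ)} (hT : T.WF D) {k : ℕ} (hk : k < 2 ^ D) (x : ℕ) :
    (addEvent T k x).Spec (3 * (D + 1)) fun T' =>
      T'.WF D ∧ T'.list = Function.update T.list k (x :: T.list k) := by
  refine .tick (by omega) <| .bind (Trie.find_spec hT k) (by omega) fun e he => ?_
  subst he
  have hset : ∀ ys, x :: T.list k = ys → (T.set k (some ys)).Spec (2 * (D + 1) - 1) fun T' =>
      T'.WF D ∧ T'.list = Function.update T.list k (x :: T.list k) := by
    rintro _ rfl
    refine (Trie.set_spec hT k _).mono (by omega) fun T' ⟨h1, h2⟩ => ⟨h1, ?_⟩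
    funext j
    unfold Trie.list
    rw [h2 hk]
    rcases eq_or_ne j k with rfl | hjk
    · simp [Trie.list]
    · simp [hjk]
  unfold Trie.list at hset ⊢
  cases h : T.fn k with
  | none => exact (hset _ (by rw [h]; rfl)).mono (by omega) (by simp [h])
  | some xs => exact (hset _ (by rw [h]; rfl)).mono (by omega) (by simp [h])

theorem sum_length_update (L : ℕ → List ℕ) (k x N : ℕ) :
    ∑ j ∈ Finset.range N, (Function.update L k (x :: L k) j).length ≤
      ∑ j ∈ Finset.range N, (L j).length + 1 := by
  calc _ ≤ ∑ j ∈ Finset.range N, ((L j).length + if j = k then 1 else 0) := by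
        refine Finset.sum_le_sum fun j _ => ?_
        rcases eq_or_ne j k with rfl | hjk
        · simp
        · simp [hjk]
    _ ≤ _ := by
        rw [Finset.sum_add_distrib]
        refine Nat.add_le_add_left ?_ _
        rw [Finset.sum_ite_eq']
        split_ifs <;> omega

/-- The list at every index consists of the elements from `c` on with the property. -/
def CollectsFrom (T : Trie (List ℕ)) (c : ℕ) (p : ℕ → ℕ → Prop) : Prop :=
  ∀ k, IsEventList T k fun i => c ≤ i ∧ p i k

theorem CollectsFrom.add {T T' : Trie (List ℕ)} {c : ℕ} {p : ℕ → ℕ → Prop}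
    (h : CollectsFrom T (c + 1) p) {k : ℕ} (hk : ∀ j, p c j ↔ j = k)
    (hT : T'.list = Function.update T.list k (c :: T.list k)) : CollectsFrom T' c p := by
  intro j
  unfold IsEventList
  obtain ⟨h1, h2⟩ := h j
  have h3 : ∀ i, i ∈ T.list j ↔ c + 1 ≤ i ∧ p i j := h2
  rw [hT]
  rcases eq_or_ne j k with rfl | hjk
  · rw [Function.update_self, List.nodup_cons]
    refine ⟨⟨fun h4 => ?_, h1⟩, fun i => ?_⟩
    · have := ((h3 c).1 h4).1
      omega
    · rw [List.mem_cons, h3]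
      constructor
      · rintro (rfl | ⟨h4, h5⟩)
        · exact ⟨le_rfl, (hk j).2 rfl⟩
        · exact ⟨by omega, h5⟩
      · rintro ⟨h4, h5⟩
        rcases h4.eq_or_lt with h6 | h6
        · exact .inl h6.symm
        · exact .inr ⟨h6, h5⟩
  · rw [Function.update_of_ne hjk]
    refine ⟨h1, fun i => ?_⟩
    rw [h3]
    refine ⟨fun ⟨h4, h5⟩ => ⟨by omega, h5⟩, fun ⟨h4, h5⟩ => ⟨?_, h5⟩⟩
    rcases h4.eq_or_lt with rfl | h6
    · exact absurd ((hk j).1 h5) hjk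
    · exact h6

theorem CollectsFrom.skip {T : Trie (List ℕ)} {c : ℕ} {p : ℕ → ℕ → Prop}
    (h : CollectsFrom T (c + 1) p) (hk : ∀ j, ¬ p c j) : CollectsFrom T c p := by
  refine fun j => ⟨(h j).1, fun i => ?_⟩
  rw [(h j).2]
  refine ⟨fun ⟨h4, h5⟩ => ⟨by omega, h5⟩, fun ⟨h4, h5⟩ => ⟨?_, h5⟩⟩
  rcases h4.eq_or_lt with rfl | h6
  · exact absurd h5 (hk j)
  · exact h6

variable {K : Type} [LinearOrder K] (I : SweepInput K) (M : Diagram)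

/-- The height from which on `l_i(s)` is to the left of the top-most points. -/
def Diagram.IsFlipStart (i p : ℕ) : Prop :=
  ∀ x, M.bot i ≤ x → x < M.top i →
    (¬ (I.topX i : WithTop K) ≤ I.left i (I.height x) ↔ p ≤ x)

/-- The height from which on `r_i(t)` is to the left of the bottom-most points. -/
def Diagram.IsFlipEnd (i q : ℕ) : Prop :=
  ∀ x, M.bot i < x → x ≤ M.top i →
    (I.right i (I.height x) ≤ (I.botX i : WithTop K) ↔ q ≤ x)

/-- The events have been computed for the cells from `c` on and for the gates from `g` on. -/
structure EventsFrom (D c g : ℕ) (ev : Events) : Prop where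
  wf_botAt : ev.botAt.WF D
  wf_topAt : ev.topAt.WF D
  wf_loAt : ev.loAt.WF D
  wf_hiAt : ev.hiAt.WF D
  wf_flipS : ev.flipS.WF D
  wf_flipT : ev.flipT.WF D
  botAt : CollectsFrom ev.botAt c fun i k => M.cell i ∧ M.bot i = k
  topAt : CollectsFrom ev.topAt c fun i k => M.cell i ∧ M.top i = k
  loAt : CollectsFrom ev.loAt g fun i k => M.gate i ∧ M.lo i = k
  hiAt : CollectsFrom ev.hiAt g fun i k => M.gate i ∧ M.hi i = k
  cell_S : ∀ k, ∀ i ∈ ev.flipS.list k, M.cell i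
  cell_T : ∀ k, ∀ i ∈ ev.flipT.list k, M.cell i
  flipS : ∀ i, c ≤ i → M.cell i → i ∈ ev.flipS.list (M.bot i) ∧ i ∈ ev.flipS.list (M.top i) ∧
    ∃ p, M.IsFlipStart I i p ∧ i ∈ ev.flipS.list p
  flipT : ∀ i, c ≤ i → M.cell i → i ∈ ev.flipT.list (M.bot i) ∧ i ∈ ev.flipT.list (M.top i) ∧
    ∃ p, M.IsFlipEnd I i p ∧ i ∈ ev.flipT.list p
  weight : ∀ N, ∑ k ∈ Finset.range N, ev.weight k ≤ 8 * (I.numCells - c) + 2 * (I.numCells - g)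

variable {I M} {D : ℕ}

theorem heightIndex_spec (hM : Models I M) (hD : I.numHeights < 2 ^ D) {k : ℕ}
    (hk : k < I.numHeights) :
    (heightIndex I (I.height k)).Spec (2 * (D + 1)) fun r => r = k := by
  refine .tick (by omega) ?_
  refine (bisect_spec (lo := 0) (hi := I.numHeights) (L := D) le_rfl (by omega)
    (fun x y _ h1 h2 => ?_) (by omega)).mono (by omega)
    fun r ⟨_, h2, h3⟩ => ?_
  · simp only [decide_eq_true_eq]
    rw [hM.strictMono hk (by omega), hM.strictMono hk h2]
    omega
  · have h4 : ∀ x < I.numHeights, (k ≤ x ↔ r ≤ x) := fun x hx => by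
      rw [← h3 x (by omega) hx, decide_eq_true_eq, hM.strictMono hk hx]
    have h5 := (h4 k hk).1 le_rfl
    exact le_antisymm h5 ((h4 r (by omega)).2 le_rfl)

theorem addEvent_flips {D : ℕ} {T : Trie (List ℕ)} (hT : T.WF D) (x a b p : ℕ) (ha : a < 2 ^ D)
    (hb : b < 2 ^ D) (hp : p < 2 ^ D) {β : Type} {f : Trie (List ℕ) → Timed β} {R : β → Prop} {c : ℕ}
    (hc : 9 * (D + 1) ≤ c)
    (h : ∀ T' : Trie (List ℕ), T'.WF D → x ∈ T'.list a → x ∈ T'.list b → x ∈ T'.list p →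
      (∀ k y, y ∈ T.list k → y ∈ T'.list k) → (∀ k y, y ∈ T'.list k → y = x ∨ y ∈ T.list k) →
      (∀ N, ∑ k ∈ Finset.range N, (T'.list k).length ≤
        ∑ k ∈ Finset.range N, (T.list k).length + 3) → (f T').Spec (c - 9 * (D + 1)) R) :
    (addEvent T a x >>= fun T₁ => addEvent T₁ b x >>= fun T₂ => addEvent T₂ p x >>= f).Spec c R := by
  have hself : ∀ {T T' : Trie (List ℕ)} {k}, T'.list = Function.update T.list k (x :: T.list k) →
      x ∈ T'.list k := fun h => by simp [h]
  have hmono : ∀ {T T' : Trie (List ℕ)} {k}, T'.list = Function.update T.list k (x :: T.list k) →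
      ∀ j y, y ∈ T.list j → y ∈ T'.list j := by
    intro T T' k h j y hy
    rw [h, Function.update_apply]
    split_ifs with hj
    · exact List.mem_cons_of_mem _ (hj ▸ hy)
    · exact hy
  have hback : ∀ {T T' : Trie (List ℕ)} {k}, T'.list = Function.update T.list k (x :: T.list k) →
      ∀ j y, y ∈ T'.list j → y = x ∨ y ∈ T.list j := by
    intro T T' k h j y hy
    rw [h, Function.update_apply] at hy
    split_ifs at hy with hj
    · exact hj ▸ List.mem_cons.1 hy
    · exact .inr hy
  refine .bind (addEvent_spec hT ha x) (by omega) fun T₁ ⟨h1, h2⟩ => ?_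
  refine .bind (addEvent_spec h1 hb x) (by omega) fun T₂ ⟨h3, h4⟩ => ?_
  refine .bind (addEvent_spec h3 hp x) (by omega) fun T₃ ⟨h5, h6⟩ => ?_
  refine (h T₃ h5 (hmono h6 _ _ (hmono h4 _ _ (hself h2))) (hmono h6 _ _ (hself h4)) (hself h6)
    (fun k y hy => hmono h6 _ _ (hmono h4 _ _ (hmono h2 _ _ hy))) (fun k y hy => ?_)
    fun N => ?_).mono (by omega) fun _ h => h
  · rcases hback h6 k y hy with h7 | h7
    · exact .inl h7
    rcases hback h4 k y h7 with h7 | h7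
    · exact .inl h7
    · exact hback h2 k y h7
  · have h7 := sum_length_update T.list a x N
    have h8 := sum_length_update T₁.list b x N
    have h9 := sum_length_update T₂.list p x N
    rw [← h2] at h7
    rw [← h4] at h8
    rw [← h6] at h9
    omega

theorem addCellEvents_spec (hM : Models I M) (hD : I.numHeights < 2 ^ D) {i g : ℕ}
    (hi : i < I.numCells) {ev : Events} (h : EventsFrom I M D (i + 1) g ev) :
    (addCellEvents I i ev).Spec (40 * (D + 1)) (EventsFrom I M D i g) := by
  refine .tick (by omega) ?_
  by_cases hc : M.cell i
  swap
  · simp only [hM.range_none hi hc]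
    have hne : ∀ j, i ≤ j → M.cell j → i + 1 ≤ j := by
      intro j h1 h2
      rcases h1.eq_or_lt with rfl | h3
      · exact absurd h2 hc
      · exact h3
    exact .pure { h with
      botAt := h.botAt.skip fun _ h => hc h.1
      topAt := h.topAt.skip fun _ h => hc h.1
      flipS := fun j h1 h2 => h.flipS j (hne j h1 h2) h2
      flipT := fun j h1 h2 => h.flipT j (hne j h1 h2) h2
      weight := fun N => (h.weight N).trans (by omega) }
  have hle := hM.valid.bot_le hc
  have hlt := hM.valid.top_lt hc
  simp only [hM.range_some hc]
  refine .bind (heightIndex_spec hM hD (by omega)) (by omega) fun a ha => ?_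
  refine .bind (heightIndex_spec hM hD hlt) (by omega) fun b hb => ?_
  subst ha hb
  refine .bind (bisect_spec (L := D) le_rfl hle (fun x y h1 h2 h3 h4 => ?_) (by omega)) (by omega)
    fun p ⟨hp1, hp2, hp3⟩ => ?_
  · simp only [decide_eq_true_eq, not_le] at h4 ⊢
    exact hM.top_le hc h1 h2 h3 h4
  refine .bind (bisect_spec (L := D) (by omega) (by omega) (fun x y h1 h2 h3 h4 => ?_) (by omega))
    (by omega) fun q ⟨hq1, hq2, hq3⟩ => ?_
  · simp only [decide_eq_true_eq] at h4 ⊢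
    exact hM.le_bot hc (by omega) h2 (by omega) h4
  refine .bind (addEvent_spec h.wf_botAt (by omega) i) (by omega) fun B ⟨hB1, hB2⟩ => ?_
  refine .bind (addEvent_spec h.wf_topAt (by omega) i) (by omega) fun U ⟨hU1, hU2⟩ => ?_
  refine addEvent_flips h.wf_flipS i (M.bot i) (M.top i) p (by omega) (by omega) (by omega) (by omega)
    fun S hS1 hS2 hS3 hS4 hS5 hS6 hS7 => ?_
  refine addEvent_flips h.wf_flipT i (M.bot i) (M.top i) q (by omega) (by omega) (by omega) (by omega)
    fun T hT1 hT2 hT3 hT4 hT5 hT6 hT7 => .pure ?_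
  refine { h with
    wf_botAt := hB1
    wf_topAt := hU1
    wf_flipS := hS1
    wf_flipT := hT1
    botAt := h.botAt.add (fun j => by simp [hc, eq_comm]) hB2
    topAt := h.topAt.add (fun j => by simp [hc, eq_comm]) hU2
    cell_S := fun k j hj => (hS6 k j hj).elim (fun h => h ▸ hc) (h.cell_S k j)
    cell_T := fun k j hj => (hT6 k j hj).elim (fun h => h ▸ hc) (h.cell_T k j)
    flipS := ?_
    flipT := ?_
    weight := ?_ }
  · intro j h1 h2
    rcases h1.eq_or_lt with rfl | h3
    · refine ⟨hS2, hS3, p, fun x h4 h5 => ?_, hS4⟩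
      rw [← hp3 x h4 h5, decide_eq_true_eq]
    · obtain ⟨h4, h5, r, h6, h7⟩ := h.flipS j h3 h2
      exact ⟨hS5 _ _ h4, hS5 _ _ h5, r, h6, hS5 _ _ h7⟩
  · intro j h1 h2
    rcases h1.eq_or_lt with rfl | h3
    · refine ⟨hT2, hT3, q, fun x h4 h5 => ?_, hT4⟩
      rw [← hq3 x (by omega) (by omega), decide_eq_true_eq]
    · obtain ⟨h4, h5, r, h6, h7⟩ := h.flipT j h3 h2
      exact ⟨hT5 _ _ h4, hT5 _ _ h5, r, h6, hT5 _ _ h7⟩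
  · intro N
    have h1 := h.weight N
    have h2 := sum_length_update ev.botAt.list (M.bot i) i N
    have h3 := sum_length_update ev.topAt.list (M.top i) i N
    rw [← hB2] at h2
    rw [← hU2] at h3
    have h4 := hS7 N
    have h5 := hT7 N
    simp only [Events.weight, Finset.sum_add_distrib] at h1 ⊢
    omega

theorem addGateEvents_spec (hM : Models I M) (hD : I.numHeights < 2 ^ D) {i c : ℕ}
    (hi : i < I.numCells) {ev : Events} (h : EventsFrom I M D c (i + 1) ev) :
    (addGateEvents I i ev).Spec (11 * (D + 1)) (EventsFrom I M D c i) := by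
  refine .tick (by omega) ?_
  by_cases hg : M.gate i
  swap
  · simp only [hM.gate_none hi hg]
    exact .pure { h with
      loAt := h.loAt.skip fun _ h => hg h.1
      hiAt := h.hiAt.skip fun _ h => hg h.1
      weight := fun N => (h.weight N).trans (by omega) }
  have hle := hM.valid.lo_le hg
  have hlt := (hM.valid.top_lt (hM.valid.cell_left hg).1).trans_le' (hM.valid.cell_left hg).2.2
  simp only [hM.gate_some hg]
  refine .bind (heightIndex_spec hM hD (by omega)) (by omega) fun a ha => ?_
  refine .bind (heightIndex_spec hM hD hlt) (by omega) fun b hb => ?_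
  subst ha hb
  refine .bind (addEvent_spec h.wf_loAt (by omega) i) (by omega) fun B ⟨hB1, hB2⟩ => ?_
  refine .bind (addEvent_spec h.wf_hiAt (by omega) i) (by omega) fun U ⟨hU1, hU2⟩ => .pure ?_
  refine { h with
    wf_loAt := hB1
    wf_hiAt := hU1
    loAt := h.loAt.add (fun j => by simp [hg, eq_comm]) hB2
    hiAt := h.hiAt.add (fun j => by simp [hg, eq_comm]) hU2
    weight := fun N => ?_ }
  have h1 := h.weight N
  have h2 := sum_length_update ev.loAt.list (M.lo i) i N
  have h3 := sum_length_update ev.hiAt.list (M.hi i) i N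
  rw [← hB2] at h2
  rw [← hU2] at h3
  simp only [Events.weight, Finset.sum_add_distrib] at h1 ⊢
  omega

theorem addAllEvents_spec (hM : Models I M) (hD : I.numHeights < 2 ^ D) {c : ℕ}
    (hc : c ≤ I.numCells) {ev : Events} (h : EventsFrom I M D c c ev) :
    (addAllEvents I c ev).Spec (c * (52 * (D + 1)) + 1) (EventsFrom I M D 0 0) := by
  induction c generalizing ev with
  | zero => exact .tick (by omega) (.pure h)
  | succ c ih =>
    rw [Nat.succ_mul]
    refine .tick (by omega) <| .bind (addCellEvents_spec hM hD hc h) (by omega) fun ev₁ h1 => ?_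
    refine .bind (addGateEvents_spec hM hD hc h1) (by omega) fun ev₂ h2 => ?_
    exact (ih (by omega) h2).mono (by omega) fun _ h => h

theorem badAt_eq_false_of_left {s t i : ℕ} (h : ¬ I.left i (I.height s) ≠ ⊤) :
    badAt I s t i = false := by
  unfold badAt
  rw [not_not.1 h]

theorem badAt_eq_false_of_right {s t i : ℕ} (h : ¬ I.right i (I.height t) ≠ ⊤) :
    badAt I s t i = false := by
  unfold badAt
  rw [not_not.1 h]
  cases I.left i (I.height s) <;> rfl

theorem EventsFrom.eventsOK (hM : Models I M) {ev : Events} (h : EventsFrom I M D 0 0 ev) :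
    EventsOK I M D ev := by
  refine { h with
    botAt := fun k => by simpa using h.botAt k
    topAt := fun k => by simpa using h.topAt k
    loAt := fun k => by simpa using h.loAt k
    hiAt := fun k => by simpa using h.hiAt k
    flipS_lt := fun k i hi => hM.valid.cell_lt (h.cell_S k i hi)
    flipT_lt := fun k i hi => hM.valid.cell_lt (h.cell_T k i hi)
    flipS_bot := fun i hi => (h.flipS i (by omega) hi).1
    flipS_top := fun i hi => (h.flipS i (by omega) hi).2.1
    flipT_bot := fun i hi => (h.flipT i (by omega) hi).1
    flipT_top := fun i hi => (h.flipT i (by omega) hi).2.1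
    flipS := ?_
    flipT := ?_ }
  · intro i s t hi hs ht h1 h2
    by_cases hc : M.cell i ∧ M.bot i ≤ s + 1 ∧ s ≤ M.top i
    · obtain ⟨hc, h3, h4⟩ := hc
      obtain ⟨h5, h6, p, h7, h8⟩ := h.flipS i (by omega) hc
      have h9 : M.bot i ≠ s + 1 := fun h => h1 (h ▸ h5)
      have h10 : M.top i ≠ s := fun h => h2 (h ▸ h6)
      have h11 : M.top i ≠ s + 1 := fun h => h1 (h ▸ h6)
      have h12 : p ≠ s + 1 := fun h => h1 (h ▸ h8)
      by_cases hit : i ∈ M.atHeight t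
      · rw [Bool.eq_iff_iff, hM.bad_iff (by omega) ht ⟨hc, by omega, by omega⟩ hit,
          hM.bad_iff hs ht ⟨hc, by omega, by omega⟩ hit]
        refine and_congr_right fun _ => and_congr_left fun _ => ?_
        rw [← not_iff_not, h7 s (by omega) (by omega), h7 (s + 1) (by omega) (by omega)]
        omega
      · rw [badAt_eq_false_of_right (mt (hM.right hi ht).1 hit),
          badAt_eq_false_of_right (mt (hM.right hi ht).1 hit)]
    · rw [badAt_eq_false_of_left (mt (hM.left hi (by omega)).1 fun h => hc ⟨h.1, by
        have := h.2.1; omega, h.2.2⟩), badAt_eq_false_of_left (mt (hM.left hi hs).1 fun h =>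
        hc ⟨h.1, h.2.1, by have := h.2.2; omega⟩)]
  · intro i s t hi hs ht h1 h2
    by_cases hc : M.cell i ∧ M.bot i ≤ t + 1 ∧ t ≤ M.top i
    · obtain ⟨hc, h3, h4⟩ := hc
      obtain ⟨h5, h6, p, h7, h8⟩ := h.flipT i (by omega) hc
      have h9 : M.bot i ≠ t + 1 := fun h => h1 (h ▸ h5)
      have h10 : M.top i ≠ t := fun h => h2 (h ▸ h6)
      have h11 : M.bot i ≠ t := fun h => h2 (h ▸ h5)
      have h12 : p ≠ t + 1 := fun h => h1 (h ▸ h8)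
      by_cases his : i ∈ M.atHeight s
      · rw [Bool.eq_iff_iff, hM.bad_iff hs (by omega) his ⟨hc, by omega, by omega⟩,
          hM.bad_iff hs ht his ⟨hc, by omega, by omega⟩]
        refine and_congr_right fun _ => and_congr_right fun _ => ?_
        rw [h7 t (by omega) (by omega), h7 (t + 1) (by omega) (by omega)]
        omega
      · rw [badAt_eq_false_of_left (mt (hM.left hi hs).1 his),
          badAt_eq_false_of_left (mt (hM.left hi hs).1 his)]
    · rw [badAt_eq_false_of_right (mt (hM.right hi (by omega)).1 fun h => hc ⟨h.1, by
        have := h.2.1; omega, h.2.2⟩), badAt_eq_false_of_right (mt (hM.right hi ht).1 fun h =>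
        hc ⟨h.1, h.2.1, by have := h.2.2; omega⟩)]

theorem computeEvents_spec (hM : Models I M) {c : ℕ}
    (hc : 1 + (Nat.clog 2 (I.numHeights + 1) + 1) + (Nat.clog 2 (I.numHeights + 1) + 1) +
      I.numCells * (52 * (Nat.clog 2 (I.numHeights + 1) + 1)) + 1 ≤ c) :
    (computeEvents I).Spec c fun ev =>
      (∃ D ≤ Nat.clog 2 (I.numHeights + 1), EventsOK I M D ev) ∧
      ∀ N, ∑ k ∈ Finset.range N, ev.weight k ≤ 10 * I.numCells := by
  refine .tick (by omega) <| .bind (depthFor_spec_one _) (by omega) fun D ⟨hD, hDc⟩ => ?_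
  refine .bind (Trie.empty_spec D) (by omega) fun E hE => ?_
  have hmul : I.numCells * (52 * (D + 1)) ≤
      I.numCells * (52 * (Nat.clog 2 (I.numHeights + 1) + 1)) :=
    Nat.mul_le_mul_left _ (by omega)
  have hlist : ∀ k, E.list k = [] := fun k => by simp [Trie.list, hE.2.2]
  have hempty : ∀ p : ℕ → ℕ → Prop, (∀ i k, p i k → i < I.numCells) →
      CollectsFrom E I.numCells p := fun p hp k => by
    unfold IsEventList
    rw [hlist]
    refine ⟨List.nodup_nil, fun i => ⟨fun h => by simp at h, fun h => ?_⟩⟩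
    have := hp i k h.2
    omega
  have hV := hM.valid
  refine (addAllEvents_spec hM hD le_rfl ⟨hE.1, hE.1, hE.1, hE.1, hE.1, hE.1,
    hempty _ fun i k h => hV.cell_lt h.1, hempty _ fun i k h => hV.cell_lt h.1,
    hempty _ fun i k h => (Nat.lt_succ_self _).trans (hV.gate_lt h.1),
    hempty _ fun i k h => (Nat.lt_succ_self _).trans (hV.gate_lt h.1),
    by simp [hlist], by simp [hlist], fun i h1 h2 => absurd (hV.cell_lt h2) (by omega),
    fun i h1 h2 => absurd (hV.cell_lt h2) (by omega),
    by simp [Events.weight, hlist]⟩).mono (by omega) fun ev h =>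
    ⟨⟨D, hDc, h.eventsOK hM⟩, fun N => (h.weight N).trans (by omega)⟩

end SubtrajSweep

namespace SubtrajSweep

/-! # The whole algorithm -/

theorem reverseOnto_spec {β : Type} (xs acc : List β) :
    (reverseOnto xs acc).Spec (xs.length + 1) fun r => r = xs.reverse ++ acc := by
  induction xs generalizing acc with
  | nil => exact .tick (by omega) (.pure rfl)
  | cons x xs ih =>
    exact .tick (by omega) ((ih _).mono (by simp) fun r h => by simp [h])

/-- A bound for the number of steps, for `n` cells, a sweep-sequence of length `L`, and binary
logarithms at most `ℓ` of the number of cells and at most `ℓ'` of the number of heights. -/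
def maintainBound (n L ℓ ℓ' : ℕ) : ℕ :=
  1 + (L + 1) + (1 + (ℓ' + 1) + (ℓ' + 1) + n * (52 * (ℓ' + 1)) + 1) +
    (ℓ + 1 + 200 * (ℓ + 1) * (4 * n + 1) + 8 * n + 5) +
    (L * (39 * (ℓ' + 1) + 1) + 1 + 40 * n * (200 * (ℓ + 1) + 1))

variable {K : Type} [LinearOrder K] {I : SweepInput K} {M : Diagram}

theorem maintain_spec (hM : Models I M) {𝔰 : List (ℕ × ℕ)} (hs : IsSweepSequence I.numHeights 𝔰)
    {a : ℕ} (ha : 𝔰.getLast? = some (a, a)) :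
    (maintain I 𝔰).Spec (maintainBound I.numCells 𝔰.length (Nat.clog 2 I.numCells)
        (Nat.clog 2 (I.numHeights + 1))) fun xs =>
      ∃ D, List.Forall₂ (fun p σ => p.1 ≤ p.2 ∧ p.2 < I.numHeights ∧ SweepInv I M D p.1 p.2 σ)
        ((a, a) :: 𝔰.reverse) xs := by
  obtain ⟨ps, rfl⟩ : ∃ ps, 𝔰 = ps ++ [(a, a)] := List.getLast?_eq_some_iff.1 ha
  unfold maintainBound
  refine .tick (by omega) <| .bind (reverseOnto_spec _ _) (by omega) fun rev hrev => ?_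
  have hrev' : rev = (a, a) :: ps.reverse := by simp [hrev]
  have hlast := hs.1 (a, a) (by simp)
  subst hrev'
  refine .bind (computeEvents_spec hM le_rfl) (by omega) fun ev ⟨⟨D', hD', hE⟩, hw⟩ => ?_
  refine .bind (initialState_spec hM hlast.2 le_rfl) (by omega) fun σ ⟨D, hD, hDc, hσ⟩ => ?_
  have hpot : ev.potential a ≤ 20 * I.numCells := by
    have h1 := hw a
    have h2 := hw (a + 1)
    unfold Events.potential
    omega
  have hchain : (ps ++ [(a, a)]).reverse.IsChain StepsDown := by
    rw [List.isChain_reverse]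
    exact hs.2.imp fun p q h => ⟨h.1.imp id id, h.2.imp id id⟩
  have hlen : ((a, a) :: ps.reverse).length = (ps ++ [(a, a)]).length := by simp
  rw [show (ps ++ [(a, a)]).reverse = (a, a) :: ps.reverse by simp] at hchain ⊢
  refine (mainLoop_spec hM hE hD _ hσ (hchain.cons_cons ⟨.inl rfl, .inl rfl⟩) ?_).mono ?_
    fun xs h => ⟨D, h⟩
  · intro p hp
    refine hs.1 p ?_
    simp only [List.mem_cons, List.mem_reverse] at hp
    simp only [List.mem_append, List.mem_singleton]
    tauto
  · have h1 : ((a, a) :: ps.reverse).length * (39 * (D' + 1) + 1) ≤ (ps ++ [(a, a)]).length *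
        (39 * (Nat.clog 2 (I.numHeights + 1) + 1) + 1) := by
      rw [hlen]
      exact Nat.mul_le_mul_left _ (by omega)
    have h2 : (ev.potential a + ev.potential a) * (200 * (D + 1) + 1) ≤
        40 * I.numCells * (200 * (Nat.clog 2 I.numCells + 1) + 1) :=
      Nat.mul_le_mul (by omega) (by omega)
    dsimp only
    omega

theorem clog_le_two_mul_logb {N : ℕ} (hN : 2 ≤ N) : (Nat.clog 2 N : ℝ) ≤ 2 * Real.logb 2 N := by
  have h1 : Nat.clog 2 N ≤ Nat.log 2 N + 1 := by
    refine Nat.clog_le_of_le_pow ?_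
    exact (Nat.lt_pow_succ_log_self (by omega) N).le
  have h2 : 1 ≤ Nat.log 2 N := Nat.log_pos (by omega) hN
  have h3 : (Nat.log 2 N : ℝ) ≤ Real.logb 2 N := by exact_mod_cast Real.natLog_le_logb N 2
  have h4 : (Nat.clog 2 N : ℝ) ≤ 2 * (Nat.log 2 N : ℝ) := by exact_mod_cast (by omega)
  linarith

/-- The number of steps is `O(n log n)`. -/
theorem exists_maintainBound_le (c : ℕ) : ∃ C : ℝ, ∀ n m L : ℕ, 0 < n → m ≤ c * (n + 1) →
    L ≤ c * (n + 1) → (maintainBound n L (Nat.clog 2 n) (Nat.clog 2 (m + 1)) : ℝ) ≤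
      C * (((n + 1 : ℕ) : ℝ) * Real.log ((n + 1 : ℕ) : ℝ)) := by
  set b := Nat.clog 2 (c + 1) + 2 with hb
  set k := 10 + c + 3 * b + 52 * b + 2 + 2000 + 13 + c * (39 * b + 1) + 1 + 40 * 401 with hk
  refine ⟨k * (2 / Real.log 2), fun n m L hn hm hL => ?_⟩
  set N := n + 1 with hN
  set X := Nat.clog 2 N with hX
  have hX1 : 1 ≤ X := Nat.clog_pos (by omega) (by omega)
  have h1 : Nat.clog 2 n + 1 ≤ 2 * X := by
    have : Nat.clog 2 n ≤ X := Nat.clog_mono_right _ (by omega)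
    omega
  have h2 : Nat.clog 2 (m + 1) + 1 ≤ b * X := by
    have h3 : Nat.clog 2 (m + 1) ≤ Nat.clog 2 (c + 1) + X := by
      refine Nat.clog_le_of_le_pow ?_
      rw [pow_add]
      have h4 : m + 1 ≤ (c + 1) * N := by
        rw [Nat.add_mul]
        omega
      exact h4.trans (Nat.mul_le_mul (Nat.le_pow_clog (by omega) _) (Nat.le_pow_clog (by omega) _))
    have h5 : Nat.clog 2 (c + 1) ≤ Nat.clog 2 (c + 1) * X := Nat.le_mul_of_pos_right _ hX1
    rw [hb, Nat.add_mul]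
    omega
  have hmain : maintainBound n L (Nat.clog 2 n) (Nat.clog 2 (m + 1)) ≤ k * (N * X) := by
    generalize Nat.clog 2 n = ℓ at h1
    generalize Nat.clog 2 (m + 1) = ℓ' at h2
    have hNX : N ≤ N * X := Nat.le_mul_of_pos_right _ hX1
    have hXN : X ≤ N * X := Nat.le_mul_of_pos_left _ (by omega)
    have hb1 : b * X ≤ b * (N * X) := Nat.mul_le_mul_left _ hXN
    have hLN : L ≤ c * (N * X) := hL.trans (Nat.mul_le_mul_left _ hNX)
    have e1 : n * (52 * (ℓ' + 1)) ≤ 52 * b * (N * X) :=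
      calc n * (52 * (ℓ' + 1)) ≤ N * (52 * (b * X)) :=
            Nat.mul_le_mul (by omega) (Nat.mul_le_mul_left _ h2)
        _ = _ := by ring
    have e2 : 200 * (ℓ + 1) * (4 * n + 1) ≤ 2000 * (N * X) :=
      calc 200 * (ℓ + 1) * (4 * n + 1) ≤ 200 * (2 * X) * (5 * N) :=
            Nat.mul_le_mul (Nat.mul_le_mul_left _ h1) (by omega)
        _ = _ := by ring
    have e3 : L * (39 * (ℓ' + 1) + 1) ≤ c * (39 * b + 1) * (N * X) :=
      calc L * (39 * (ℓ' + 1) + 1) ≤ (c * N) * (39 * (b * X) + X) :=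
            Nat.mul_le_mul hL (by omega)
        _ = _ := by ring
    have e4 : 40 * n * (200 * (ℓ + 1) + 1) ≤ 40 * 401 * (N * X) :=
      calc 40 * n * (200 * (ℓ + 1) + 1) ≤ 40 * N * (200 * (2 * X) + X) :=
            Nat.mul_le_mul (by omega) (by omega)
        _ = _ := by ring
    have e5 : k * (N * X) = 10 * (N * X) + c * (N * X) + 3 * (b * (N * X)) + 52 * b * (N * X) +
        2 * (N * X) + 2000 * (N * X) + 13 * (N * X) + c * (39 * b + 1) * (N * X) + N * X +
        40 * 401 * (N * X) := by
      rw [hk]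
      ring
    unfold maintainBound
    omega
  have hlog : (X : ℝ) ≤ 2 / Real.log 2 * Real.log N := by
    have := clog_le_two_mul_logb (N := N) (by omega)
    rw [← hX] at this
    calc (X : ℝ) ≤ 2 * Real.logb 2 N := this
      _ = _ := by
        unfold Real.logb
        ring
  calc (maintainBound n L (Nat.clog 2 n) (Nat.clog 2 (m + 1)) : ℝ) ≤ ((k * (N * X) : ℕ) : ℝ) := by
        exact_mod_cast hmain
    _ = k * (N * X) := by push_cast; ring
    _ ≤ k * (N * (2 / Real.log 2 * Real.log N)) := by gcongr
    _ = _ := by ring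

end SubtrajSweep

namespace SubtrajSweep

/-! # Monotone paths -/

theorem HasMonotonePath.segment {A C : Set (ℝ × ℝ)} (hC : Convex ℝ C) (hCA : C ⊆ A) {a b : ℝ × ℝ}
    (ha : a ∈ C) (hb : b ∈ C) (hab : a ≤ b) : HasMonotonePath A a b := by
  refine ⟨fun u => AffineMap.lineMap a b u, ?_, ?_, by simp, by simp, fun u hu => hCA ?_⟩
  · exact AffineMap.lineMap_continuous.continuousOn
  · intro u _ v _ huv
    exact AffineMap.lineMap_mono hab huv
  · exact hC.lineMap_mem ha hb hu

theorem HasMonotonePath.trans {A : Set (ℝ × ℝ)} {a b c : ℝ × ℝ} (h : HasMonotonePath A a b)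
    (h' : HasMonotonePath A b c) : HasMonotonePath A a c := by
  obtain ⟨γ, h1, h2, h3, h4, h5⟩ := h
  obtain ⟨δ, h1', h2', h3', h4', h5'⟩ := h'
  have hcont : ∀ {f : ℝ → ℝ × ℝ}, ContinuousOn f (Icc 0 1) →
      Continuous fun u : ℝ => f (projIcc 0 1 zero_le_one u) := fun hf =>
    hf.comp_continuous (f := fun u : ℝ => ((projIcc 0 1 zero_le_one u : Icc (0 : ℝ) 1) : ℝ))
      (continuous_subtype_val.comp continuous_projIcc) fun u => (projIcc 0 1 zero_le_one u).2
  have hmono : ∀ {f : ℝ → ℝ × ℝ}, MonotoneOn f (Icc 0 1) →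
      Monotone fun u : ℝ => f (projIcc 0 1 zero_le_one u) := fun hf u v huv =>
    hf (Subtype.coe_prop _) (Subtype.coe_prop _) (monotone_projIcc _ huv)
  have hlow : ∀ u : ℝ, u ≤ 0 → ((projIcc 0 1 zero_le_one u : Icc (0 : ℝ) 1) : ℝ) = 0 := fun u hu => by
    rw [projIcc_of_le_left _ hu]
  have hhigh : ∀ u : ℝ, 1 ≤ u → ((projIcc 0 1 zero_le_one u : Icc (0 : ℝ) 1) : ℝ) = 1 := fun u hu => by
    rw [projIcc_of_right_le _ hu]
  refine ⟨fun u => γ (projIcc 0 1 zero_le_one (2 * u)) + δ (projIcc 0 1 zero_le_one (2 * u - 1)) - b,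
    ?_, ?_, ?_, ?_, ?_⟩
  · exact ((((hcont h1).comp (continuous_const.mul continuous_id)).add
      ((hcont h1').comp ((continuous_const.mul continuous_id).sub continuous_const))).sub
      continuous_const).continuousOn
  · intro u _ v _ huv
    exact sub_le_sub_right (add_le_add (hmono h2 (by linarith)) (hmono h2' (by linarith))) b
  · simp only
    rw [hlow (2 * 0) (by norm_num), hlow (2 * 0 - 1) (by norm_num), h3, h3', add_sub_cancel_right]
  · simp only
    rw [hhigh (2 * 1) (by norm_num), hhigh (2 * 1 - 1) (by norm_num), h4, h4', add_sub_cancel_left]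
  · intro u _
    simp only
    rcases le_total u (1 / 2) with hu | hu
    · rw [hlow (2 * u - 1) (by linarith), h3', add_sub_cancel_right]
      exact h5 _ (Subtype.coe_prop _)
    · rw [hhigh (2 * u) (by linarith), h4, add_sub_cancel_left]
      exact h5' _ (Subtype.coe_prop _)

/-! # The geometry of the cells -/

variable {d : ℕ} {P : PolygonalCurve d} {A : Set (ℝ × ℝ)}

/-- `A` is a closed set with convex parts in all cells. -/
structure CellConvex (P : PolygonalCurve d) (A : Set (ℝ × ℝ)) : Prop where
  closed : IsClosed A
  subset : A ⊆ Icc 0 1 ×ˢ Icc 0 1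
  convex : ∀ i < P.numEdges, Convex ℝ (cellPart P A i)

theorem PolygonalCurve.isCompact_cell (P : PolygonalCurve d) (i : ℕ) : IsCompact (P.cell i) :=
  isCompact_Icc.prod isCompact_Icc

theorem PolygonalCurve.openCell_subset_cell (P : PolygonalCurve d) (i : ℕ) :
    P.openCell i ⊆ P.cell i := prod_mono Ioo_subset_Icc_self Ioo_subset_Icc_self

theorem PolygonalCurve.knot_lt (P : PolygonalCurve d) {i j : ℕ} (hij : i < j)
    (hj : j ≤ P.numEdges) : P.knot i < P.knot j :=
  P.knot_strictMono (mem_Iic.2 (by omega)) hj hij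

theorem PolygonalCurve.knot_le (P : PolygonalCurve d) {i j : ℕ} (hij : i ≤ j)
    (hj : j ≤ P.numEdges) : P.knot i ≤ P.knot j :=
  P.knot_strictMono.monotoneOn (mem_Iic.2 (by omega)) hj hij

theorem IsApproxFreeSpace.cellConvex {p q : EuclideanSpace ℝ (Fin d)} {α Δ : ℝ}
    (h : IsApproxFreeSpace p q P α Δ A) (hA : IsClosed A) : CellConvex P A where
  closed := hA
  subset z hz := ⟨(h.subset_freeSpace hz).1, (h.subset_freeSpace hz).2.1⟩
  convex i hi := by
    have : cellPart P A i = closure (A ∩ P.openCell i) := by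
      refine Subset.antisymm ?_ ?_
      · rintro z ⟨hz, hzi⟩
        by_cases ho : z ∈ P.openCell i
        · exact subset_closure ⟨hz, ho⟩
        · exact (h.boundary_iff z ⟨i, hi, hzi, ho⟩).1 hz i hi hzi
      · exact closure_minimal (inter_subset_inter_right _ (P.openCell_subset_cell i))
          (hA.inter (P.isCompact_cell i).isClosed)
    rw [this]
    exact (h.convex_cell i hi).closure

theorem mem_cellPart_left {x y : ℝ} {i : ℕ} (h : (x, y) ∈ cellPart P A i) : P.knot i ≤ x := h.2.1.1

theorem mem_cellPart_right {x y : ℝ} {i : ℕ} (h : (x, y) ∈ cellPart P A i) :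
    x ≤ P.knot (i + 1) := h.2.1.2

namespace CellConvex

variable (h : CellConvex P A) {i j k : ℕ}
include h

theorem isCompact (i : ℕ) : IsCompact (cellPart P A i) :=
  (P.isCompact_cell i).inter_left h.closed

theorem mem_cellPart {x y : ℝ} (hxy : (x, y) ∈ A) (hx : x ∈ Icc (P.knot i) (P.knot (i + 1))) :
    (x, y) ∈ cellPart P A i := ⟨hxy, hx, (h.subset hxy).2⟩

/-- The point at an intermediate height on a segment between two points of a cell. -/
theorem exists_between (hi : i < P.numEdges) {x₁ y₁ x₂ y₂ y : ℝ} (h₁ : (x₁, y₁) ∈ cellPart P A i)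
    (h₂ : (x₂, y₂) ∈ cellPart P A i) (hy₁ : y₁ ≤ y) (hy₂ : y ≤ y₂) :
    ∃ a b : ℝ, 0 ≤ a ∧ 0 ≤ b ∧ a + b = 1 ∧ a * y₁ + b * y₂ = y ∧
      (a * x₁ + b * x₂, y) ∈ cellPart P A i := by
  have hy : y ∈ segment ℝ y₁ y₂ := by
    rw [segment_eq_Icc (hy₁.trans hy₂)]
    exact ⟨hy₁, hy₂⟩
  obtain ⟨a, b, ha, hb, hab, rfl⟩ := hy
  exact ⟨a, b, ha, hb, hab, rfl, h.convex i hi h₁ h₂ ha hb hab⟩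

/-- The part of the gate `k` in the left cell. -/
theorem gate_left (hk : k < P.numEdges) {y : ℝ} (hy : (P.knot (k + 1), y) ∈ A) :
    (P.knot (k + 1), y) ∈ cellPart P A k :=
  h.mem_cellPart hy ⟨P.knot_le (by omega) hk, le_rfl⟩

/-- The part of the gate `k` in the right cell. -/
theorem gate_right (hk : k + 1 < P.numEdges) {y : ℝ} (hy : (P.knot (k + 1), y) ∈ A) :
    (P.knot (k + 1), y) ∈ cellPart P A (k + 1) :=
  h.mem_cellPart hy ⟨le_rfl, P.knot_le (by omega) hk⟩

theorem gate_ordConnected (hk : k < P.numEdges) : {y | (P.knot (k + 1), y) ∈ A}.OrdConnected := by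
  refine ⟨fun y₁ h₁ y₂ h₂ y hy => ?_⟩
  obtain ⟨a, b, -, -, hab, -, h3⟩ :=
    h.exists_between hk (h.gate_left hk h₁) (h.gate_left hk h₂) hy.1 hy.2
  rw [← add_mul, hab, one_mul] at h3
  exact h3.1

theorem gate_isCompact (k : ℕ) : IsCompact {y | (P.knot (k + 1), y) ∈ A} := by
  refine isCompact_Icc (a := (0 : ℝ)) (b := 1) |>.of_isClosed_subset
    (h.closed.preimage (by fun_prop)) fun y hy => (h.subset hy).2

theorem gate_isLeast (hne : ∃ y, (P.knot (k + 1), y) ∈ A) :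
    IsLeast {y | (P.knot (k + 1), y) ∈ A} (sInf {y | (P.knot (k + 1), y) ∈ A}) :=
  (h.gate_isCompact k).isLeast_sInf hne

theorem gate_isGreatest (hne : ∃ y, (P.knot (k + 1), y) ∈ A) :
    IsGreatest {y | (P.knot (k + 1), y) ∈ A} (sSup {y | (P.knot (k + 1), y) ∈ A}) :=
  (h.gate_isCompact k).isGreatest_sSup hne

theorem rows_isCompact (i : ℕ) : IsCompact (Prod.snd '' cellPart P A i) :=
  (h.isCompact i).image continuous_snd

theorem rows_isLeast (hne : (cellPart P A i).Nonempty) :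
    IsLeast (Prod.snd '' cellPart P A i) (sInf (Prod.snd '' cellPart P A i)) :=
  (h.rows_isCompact i).isLeast_sInf (hne.image _)

theorem rows_isGreatest (hne : (cellPart P A i).Nonempty) :
    IsGreatest (Prod.snd '' cellPart P A i) (sSup (Prod.snd '' cellPart P A i)) :=
  (h.rows_isCompact i).isGreatest_sSup (hne.image _)

/-- The heights at which a cell has a point. -/
theorem exists_mem_iff (hi : i < P.numEdges) (hne : (cellPart P A i).Nonempty) {y : ℝ} :
    (∃ x, (x, y) ∈ cellPart P A i) ↔
      sInf (Prod.snd '' cellPart P A i) ≤ y ∧ y ≤ sSup (Prod.snd '' cellPart P A i) := by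
  constructor
  · rintro ⟨x, hx⟩
    exact ⟨(h.rows_isLeast hne).2 ⟨_, hx, rfl⟩, (h.rows_isGreatest hne).2 ⟨_, hx, rfl⟩⟩
  · rintro ⟨h1, h2⟩
    obtain ⟨⟨x₁, y₁⟩, h3, h4⟩ := (h.rows_isLeast hne).1
    obtain ⟨⟨x₂, y₂⟩, h5, h6⟩ := (h.rows_isGreatest hne).1
    obtain ⟨a, b, -, -, -, -, h7⟩ := h.exists_between hi h3 h5 
      (h4.le.trans h1) (h2.trans h6.ge)
    exact ⟨_, h7⟩

theorem section_isCompact (i : ℕ) (y : ℝ) : IsCompact {x | (x, y) ∈ cellPart P A i} := by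
  refine isCompact_Icc (a := P.knot i) (b := P.knot (i + 1)) |>.of_isClosed_subset
    ((h.isCompact i).isClosed.preimage (by fun_prop)) fun x hx => hx.2.1

theorem cellLeft_eq_some {y x : ℝ} :
    cellLeft P A i y = (x : WithTop ℝ) ↔ IsLeast {x | (x, y) ∈ cellPart P A i} x := by
  unfold cellLeft
  split_ifs with hne
  · have hl := (h.section_isCompact i y).isLeast_sInf hne
    rw [WithTop.coe_inj]
    exact ⟨fun h => h ▸ hl, fun h => hl.unique h⟩
  · simp only [WithTop.top_ne_coe, false_iff]
    exact fun h => hne ⟨x, h.1⟩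

theorem cellRight_eq_some {y x : ℝ} :
    cellRight P A i y = (x : WithTop ℝ) ↔ IsGreatest {x | (x, y) ∈ cellPart P A i} x := by
  unfold cellRight
  split_ifs with hne
  · have hl := (h.section_isCompact i y).isGreatest_sSup hne
    rw [WithTop.coe_inj]
    exact ⟨fun h => h ▸ hl, fun h => hl.unique h⟩
  · simp only [WithTop.top_ne_coe, false_iff]
    exact fun h => hne ⟨x, h.1⟩

end CellConvex

theorem cellLeft_ne_top {i : ℕ} {y : ℝ} :
    cellLeft P A i y ≠ ⊤ ↔ ∃ x, (x, y) ∈ cellPart P A i := by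
  unfold cellLeft
  split_ifs with hne <;> simp [hne]

theorem cellRight_ne_top {i : ℕ} {y : ℝ} :
    cellRight P A i y ≠ ⊤ ↔ ∃ x, (x, y) ∈ cellPart P A i := by
  unfold cellRight
  split_ifs with hne <;> simp [hne]

namespace CellConvex

variable (h : CellConvex P A) {i j k : ℕ}
include h

theorem exists_cellLeft {y : ℝ} (hne : ∃ x, (x, y) ∈ cellPart P A i) :
    ∃ x : ℝ, cellLeft P A i y = (x : WithTop ℝ) ∧ IsLeast {x | (x, y) ∈ cellPart P A i} x :=
  ⟨_, h.cellLeft_eq_some.2 ((h.section_isCompact i y).isLeast_sInf hne),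
    (h.section_isCompact i y).isLeast_sInf hne⟩

theorem exists_cellRight {y : ℝ} (hne : ∃ x, (x, y) ∈ cellPart P A i) :
    ∃ x : ℝ, cellRight P A i y = (x : WithTop ℝ) ∧ IsGreatest {x | (x, y) ∈ cellPart P A i} x :=
  ⟨_, h.cellRight_eq_some.2 ((h.section_isCompact i y).isGreatest_sSup hne),
    (h.section_isCompact i y).isGreatest_sSup hne⟩

theorem mem_topmost_iff (hne : (cellPart P A i).Nonempty) {z : ℝ × ℝ} :
    z ∈ topmost P A i ↔ z ∈ cellPart P A i ∧ z.2 = sSup (Prod.snd '' cellPart P A i) := by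
  have hg := h.rows_isGreatest hne
  constructor
  · rintro ⟨h1, h2⟩
    refine ⟨h1, le_antisymm (hg.2 ⟨z, h1, rfl⟩) ?_⟩
    obtain ⟨w, h3, h4⟩ := hg.1
    exact h4 ▸ h2 w h3
  · rintro ⟨h1, h2⟩
    exact ⟨h1, fun w hw => h2 ▸ hg.2 ⟨w, hw, rfl⟩⟩

theorem mem_bottommost_iff (hne : (cellPart P A i).Nonempty) {z : ℝ × ℝ} :
    z ∈ bottommost P A i ↔ z ∈ cellPart P A i ∧ z.2 = sInf (Prod.snd '' cellPart P A i) := by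
  have hg := h.rows_isLeast hne
  constructor
  · rintro ⟨h1, h2⟩
    refine ⟨h1, le_antisymm ?_ (hg.2 ⟨z, h1, rfl⟩)⟩
    obtain ⟨w, h3, h4⟩ := hg.1
    exact h4 ▸ h2 w h3
  · rintro ⟨h1, h2⟩
    exact ⟨h1, fun w hw => h2 ▸ hg.2 ⟨w, hw, rfl⟩⟩

theorem topmost_isGreatest (hne : (cellPart P A i).Nonempty) :
    IsGreatest (Prod.fst '' topmost P A i) (sSup (Prod.fst '' topmost P A i)) := by
  have heq : Prod.fst '' topmost P A i =
      {x | (x, sSup (Prod.snd '' cellPart P A i)) ∈ cellPart P A i} := by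
    ext x
    simp only [mem_image, h.mem_topmost_iff hne, mem_ofPred_eq]
    constructor
    · rintro ⟨⟨x, y⟩, ⟨h1, h2⟩, rfl⟩
      exact h2 ▸ h1
    · exact fun h1 => ⟨_, ⟨h1, rfl⟩, rfl⟩
  obtain ⟨⟨x, y⟩, h1, h2⟩ := (h.rows_isGreatest hne).1
  rw [heq]
  exact (h.section_isCompact i _).isGreatest_sSup ⟨x, h2 ▸ h1⟩

theorem bottommost_isLeast (hne : (cellPart P A i).Nonempty) :
    IsLeast (Prod.fst '' bottommost P A i) (sInf (Prod.fst '' bottommost P A i)) := by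
  have heq : Prod.fst '' bottommost P A i =
      {x | (x, sInf (Prod.snd '' cellPart P A i)) ∈ cellPart P A i} := by
    ext x
    simp only [mem_image, h.mem_bottommost_iff hne, mem_ofPred_eq]
    constructor
    · rintro ⟨⟨x, y⟩, ⟨h1, h2⟩, rfl⟩
      exact h2 ▸ h1
    · exact fun h1 => ⟨_, ⟨h1, rfl⟩, rfl⟩
  obtain ⟨⟨x, y⟩, h1, h2⟩ := (h.rows_isLeast hne).1
  rw [heq]
  exact (h.section_isCompact i _).isLeast_sInf ⟨x, h2 ▸ h1⟩

/-- A good cell with points at both heights can be traversed. -/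
theorem reaches_self (hi : i < P.numEdges) {s t : ℝ} (hst : s ≤ t)
    (hs : ∃ x, (x, s) ∈ cellPart P A i) (ht : ∃ x, (x, t) ∈ cellPart P A i)
    (hgood : ¬ IsBad P A s t i) : Reaches P A s t i i := by
  obtain ⟨x, hx, hxl⟩ := h.exists_cellLeft hs
  obtain ⟨x', hx', hxr⟩ := h.exists_cellRight ht
  rcases le_or_gt x x' with hle | hlt
  · exact ⟨x, hxl.1.2.1, x', hxr.1.2.1, .segment (h.convex i hi) inter_subset_left hxl.1 hxr.1
      ⟨hle, hst⟩⟩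
  · refine absurd ⟨x, x', hx, hx', ?_, ?_⟩ hgood
    · rintro ⟨z₁, z₂⟩ ⟨h1, h2⟩
      have h3 : z₁ ≤ x' := by
        by_contra h3
        obtain ⟨a, b, ha, hb, hab, -, h4⟩ := h.exists_between hi hxl.1 h1 hst (h2 _ hxr.1)
        exact absurd (hxr.2 h4) (not_le.2 (convex_Ioi x' hlt (not_le.1 h3) ha hb hab))
      exact ⟨h3.trans hlt.le, h3⟩
    · rintro ⟨z₁, z₂⟩ ⟨h1, h2⟩
      have h3 : x ≤ z₁ := by
        by_contra h3
        obtain ⟨a, b, ha, hb, hab, -, h4⟩ := h.exists_between hi h1 hxr.1 (h2 _ hxl.1) hst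
        exact absurd (hxl.2 h4) (not_le.2 (convex_Iio x (not_le.1 h3) hlt ha hb hab))
      exact ⟨h3, hlt.le.trans h3⟩

/-- The monotone paths between different cells. -/
theorem reaches_iff {s t : ℝ} (hst : s ≤ t) (hij : i < j) (hj : j < P.numEdges) :
    Reaches P A s t i j ↔ (∃ x, (x, s) ∈ cellPart P A i) ∧ (∃ x, (x, t) ∈ cellPart P A j) ∧
      (∀ k, i ≤ k → k < j → (∃ y, (P.knot (k + 1), y) ∈ A) ∧
        sInf {y | (P.knot (k + 1), y) ∈ A} ≤ t ∧ s ≤ sSup {y | (P.knot (k + 1), y) ∈ A}) ∧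
      ∀ k l, i ≤ k → k < l → l < j →
        sInf {y | (P.knot (k + 1), y) ∈ A} ≤ sSup {y | (P.knot (l + 1), y) ∈ A} := by
  constructor
  · rintro ⟨x, hx, x', hx', γ, h1, h2, h3, h4, h5⟩
    have h0 : (x, s) ∈ A := h3 ▸ h5 0 (by simp)
    have h0' : (x', t) ∈ A := h4 ▸ h5 1 (by simp)
    have hcross : ∀ k, i ≤ k → k < j → ∃ u ∈ Icc (0 : ℝ) 1, (γ u).1 = P.knot (k + 1) := by
      intro k hk hkj
      have := intermediate_value_Icc (zero_le_one' ℝ) (continuous_fst.comp_continuousOn h1)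
      simp only [Function.comp_apply, h3, h4] at this
      exact this ⟨hx.2.trans (P.knot_le (by omega) (by omega)),
        (P.knot_le (by omega) (by omega)).trans hx'.1⟩
    choose! u hu hγ using hcross
    have hg : ∀ k, i ≤ k → k < j → (P.knot (k + 1), (γ (u k)).2) ∈ A := by
      intro k hk hkj
      rw [← hγ k hk hkj]
      exact h5 _ (hu k hk hkj)
    refine ⟨⟨x, h.mem_cellPart h0 hx⟩, ⟨x', h.mem_cellPart h0' hx'⟩, fun k hk hkj => ?_,
      fun k l hk hkl hl => ?_⟩
    · have hne : ∃ y, (P.knot (k + 1), y) ∈ A := ⟨_, hg k hk hkj⟩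
      refine ⟨hne, ((h.gate_isLeast hne).2 (hg k hk hkj)).trans ?_,
        le_trans ?_ ((h.gate_isGreatest hne).2 (hg k hk hkj))⟩
      · have := (h2 (hu k hk hkj) (by simp) (hu k hk hkj).2).2
        rwa [h4] at this
      · have := (h2 (by simp) (hu k hk hkj) (hu k hk hkj).1).2
        rwa [h3] at this
    · have hgk := hg k hk (by omega)
      have hgl := hg l (by omega) hl
      have huv : u k ≤ u l := by
        by_contra huv
        have := (h2 (hu l (by omega) hl) (hu k hk (by omega)) (not_le.1 huv).le).1
        rw [hγ l (by omega) hl, hγ k hk (by omega)] at this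
        exact absurd this (not_le.2 (P.knot_lt (by omega) (by omega)))
      exact ((h.gate_isLeast ⟨_, hgk⟩).2 hgk).trans <|
        ((h2 (hu k hk (by omega)) (hu l (by omega) hl) huv).2).trans
          ((h.gate_isGreatest ⟨_, hgl⟩).2 hgl)
  · rintro ⟨⟨x, hx⟩, ⟨x', hx'⟩, h1, h2⟩
    have hmem : ∀ k, i ≤ k → k < j → ∀ y, sInf {y | (P.knot (k + 1), y) ∈ A} ≤ y →
        y ≤ sSup {y | (P.knot (k + 1), y) ∈ A} → (P.knot (k + 1), y) ∈ A := by
      intro k hk hkj y hy hy'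
      exact (h.gate_ordConnected (by omega)).out (h.gate_isLeast (h1 k hk hkj).1).1
        (h.gate_isGreatest (h1 k hk hkj).1).1 ⟨hy, hy'⟩
    have hpath : ∀ k, i ≤ k → k < j → ∃ y, (P.knot (k + 1), y) ∈ A ∧
        HasMonotonePath A (x, s) (P.knot (k + 1), y) ∧ y ≤ t ∧
        ∀ l, k < l → l < j → y ≤ sSup {y | (P.knot (l + 1), y) ∈ A} := by
      intro k hk
      induction k, hk using Nat.le_induction with
      | base =>
        intro hkj
        obtain ⟨h3, h4, h5⟩ := h1 i le_rfl hkj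
        have h6 := hmem i le_rfl hkj _ (le_max_right s _)
          (max_le h5 ((h.gate_isLeast h3).2 (h.gate_isGreatest h3).1))
        refine ⟨_, h6, .segment (h.convex i (by omega)) inter_subset_left hx
          (h.gate_left (by omega) h6) ⟨mem_cellPart_right hx, le_max_left _ _⟩, max_le hst h4,
          fun l hl hlj => max_le (h1 l (by omega) hlj).2.2 (h2 i l le_rfl hl hlj)⟩
      | succ k hk ih =>
        intro hkj
        obtain ⟨y, hy1, hy2, hy3, hy4⟩ := ih (by omega)
        obtain ⟨h3, h4, h5⟩ := h1 (k + 1) (by omega) hkj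
        have h6 := hmem (k + 1) (by omega) hkj _ (le_max_right y _)
          (max_le (hy4 (k + 1) (by omega) hkj) ((h.gate_isLeast h3).2 (h.gate_isGreatest h3).1))
        refine ⟨_, h6, hy2.trans (.segment (h.convex (k + 1) (by omega)) inter_subset_left
          (h.gate_right (by omega) hy1) (h.gate_left (by omega) h6)
          ⟨P.knot_le (by omega) (by omega), le_max_left _ _⟩), max_le hy3 h4,
          fun l hl hlj => max_le (hy4 l (by omega) hlj) (h2 (k + 1) l (by omega) hl hlj)⟩
    obtain ⟨j, rfl⟩ : ∃ j', j = j' + 1 := ⟨j - 1, by omega⟩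
    obtain ⟨y, hy1, hy2, hy3, -⟩ := hpath j (by omega) (by omega)
    exact ⟨x, hx.2.1, x', hx'.2.1, hy2.trans (.segment (h.convex (j + 1) hj) inter_subset_left
      (h.gate_right hj hy1) hx' ⟨mem_cellPart_left hx', hy3⟩)⟩

end CellConvex

end SubtrajSweep

namespace SubtrajSweep

/-! # The combinatorial structure of a free space -/

variable {d : ℕ} (P : PolygonalCurve d) (A : Set (ℝ × ℝ)) (m : ℕ) (ε : ℕ → ℝ)

/-- The combinatorial structure of `A`, with the heights replaced by their indices. -/
noncomputable def diagram : Diagram where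
  cell i := i < P.numEdges ∧ (cellPart P A i).Nonempty
  bot i := Function.invFunOn ε (Iio m) (sInf (Prod.snd '' cellPart P A i))
  top i := Function.invFunOn ε (Iio m) (sSup (Prod.snd '' cellPart P A i))
  gate k := k + 1 < P.numEdges ∧ ∃ y, (P.knot (k + 1), y) ∈ A
  lo k := Function.invFunOn ε (Iio m) (sInf {y | (P.knot (k + 1), y) ∈ A})
  hi k := Function.invFunOn ε (Iio m) (sSup {y | (P.knot (k + 1), y) ∈ A})

variable {P A m ε}

namespace CellConvex

variable (h : CellConvex P A) (hext : extremalHeights P A ⊆ ε '' Iio m) {i k : ℕ}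
include h hext

theorem bot_spec (hi : (diagram P A m ε).cell i) : (diagram P A m ε).bot i < m ∧
    ε ((diagram P A m ε).bot i) = sInf (Prod.snd '' cellPart P A i) := by
  have hex : sInf (Prod.snd '' cellPart P A i) ∈ ε '' Iio m := by
    refine hext ⟨i, hi.1, .inr (.inl ?_)⟩
    obtain ⟨z, h1, h2⟩ := (h.rows_isLeast hi.2).1
    exact ⟨z, (h.mem_bottommost_iff hi.2).2 ⟨h1, h2⟩, h2⟩
  exact ⟨Function.invFunOn_mem hex, Function.invFunOn_eq hex⟩

theorem top_spec (hi : (diagram P A m ε).cell i) : (diagram P A m ε).top i < m ∧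
    ε ((diagram P A m ε).top i) = sSup (Prod.snd '' cellPart P A i) := by
  have hex : sSup (Prod.snd '' cellPart P A i) ∈ ε '' Iio m := by
    refine hext ⟨i, hi.1, .inl ?_⟩
    obtain ⟨z, h1, h2⟩ := (h.rows_isGreatest hi.2).1
    exact ⟨z, (h.mem_topmost_iff hi.2).2 ⟨h1, h2⟩, h2⟩
  exact ⟨Function.invFunOn_mem hex, Function.invFunOn_eq hex⟩

omit hext in
theorem gate_eq_rightmost (hk : (diagram P A m ε).gate k) :
    Prod.snd '' rightmost P A k = {y | (P.knot (k + 1), y) ∈ A} := by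
  obtain ⟨hk, y₀, hy₀⟩ := hk
  have h0 := h.gate_left (by omega) hy₀
  ext y
  constructor
  · rintro ⟨⟨x, y⟩, ⟨h1, h2⟩, rfl⟩
    have h3 : x = P.knot (k + 1) := le_antisymm (mem_cellPart_right h1) (h2 _ h0)
    exact h3 ▸ h1.1
  · intro hy
    exact ⟨_, ⟨h.gate_left (by omega) hy, fun w hw => hw.2.1.2⟩, rfl⟩

theorem lo_spec (hk : (diagram P A m ε).gate k) : (diagram P A m ε).lo k < m ∧
    ε ((diagram P A m ε).lo k) = sInf {y | (P.knot (k + 1), y) ∈ A} := by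
  have hex : sInf {y | (P.knot (k + 1), y) ∈ A} ∈ ε '' Iio m := by
    refine hext ⟨k, (Nat.lt_succ_self k).trans hk.1, .inr (.inr (.inr (.inr (.inl ?_))))⟩
    rw [h.gate_eq_rightmost hk]
    exact h.gate_isLeast hk.2
  exact ⟨Function.invFunOn_mem hex, Function.invFunOn_eq hex⟩

theorem hi_spec (hk : (diagram P A m ε).gate k) : (diagram P A m ε).hi k < m ∧
    ε ((diagram P A m ε).hi k) = sSup {y | (P.knot (k + 1), y) ∈ A} := by
  have hex : sSup {y | (P.knot (k + 1), y) ∈ A} ∈ ε '' Iio m := by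
    refine hext ⟨k, (Nat.lt_succ_self k).trans hk.1, .inr (.inr (.inr (.inr (.inr ?_))))⟩
    rw [h.gate_eq_rightmost hk]
    exact h.gate_isGreatest hk.2
  exact ⟨Function.invFunOn_mem hex, Function.invFunOn_eq hex⟩

variable (hε : StrictMonoOn ε (Iio m))
include hε

theorem mem_atHeight_iff (hi : i < P.numEdges) {y : ℕ} (hy : y < m) :
    i ∈ (diagram P A m ε).atHeight y ↔ ∃ x, (x, ε y) ∈ cellPart P A i := by
  constructor
  · rintro ⟨h1, h2, h3⟩
    obtain ⟨h4, h5⟩ := h.bot_spec hext h1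
    obtain ⟨h6, h7⟩ := h.top_spec hext h1
    rw [h.exists_mem_iff hi h1.2, ← h5, ← h7, hε.le_iff_le h4 hy, hε.le_iff_le hy h6]
    exact ⟨h2, h3⟩
  · rintro ⟨x, hx⟩
    have h1 : (diagram P A m ε).cell i := ⟨hi, _, hx⟩
    obtain ⟨h4, h5⟩ := h.bot_spec hext h1
    obtain ⟨h6, h7⟩ := h.top_spec hext h1
    have h8 := (h.exists_mem_iff hi h1.2).1 ⟨x, hx⟩
    rw [← h5, ← h7, hε.le_iff_le h4 hy, hε.le_iff_le hy h6] at h8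
    exact ⟨h1, h8⟩

theorem diagram_valid : (diagram P A m ε).Valid P.numEdges m where
  cell_lt hi := hi.1
  bot_le {i} hi := by
    obtain ⟨h4, h5⟩ := h.bot_spec hext hi
    obtain ⟨h6, h7⟩ := h.top_spec hext hi
    rw [← hε.le_iff_le h4 h6, h5, h7]
    exact (h.rows_isLeast hi.2).2 (h.rows_isGreatest hi.2).1
  top_lt hi := (h.top_spec hext hi).1
  gate_lt hk := hk.1
  lo_le {k} hk := by
    obtain ⟨h4, h5⟩ := h.lo_spec hext hk
    obtain ⟨h6, h7⟩ := h.hi_spec hext hk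
    rw [← hε.le_iff_le h4 h6, h5, h7]
    exact (h.gate_isLeast hk.2).2 (h.gate_isGreatest hk.2).1
  cell_left {k} hk := by
    obtain ⟨h4, h5⟩ := h.lo_spec hext hk
    obtain ⟨h6, h7⟩ := h.hi_spec hext hk
    have hkn : k < P.numEdges := (Nat.lt_succ_self k).trans hk.1
    have h1 := h.gate_left hkn (h.gate_isLeast hk.2).1
    have h2 := h.gate_left hkn (h.gate_isGreatest hk.2).1
    rw [← h5] at h1
    rw [← h7] at h2
    have h3 := (h.mem_atHeight_iff hext hε hkn h4).2 ⟨_, h1⟩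
    exact ⟨h3.1, h3.2.1, ((h.mem_atHeight_iff hext hε hkn h6).2 ⟨_, h2⟩).2.2⟩
  cell_right {k} hk := by
    obtain ⟨h4, h5⟩ := h.lo_spec hext hk
    obtain ⟨h6, h7⟩ := h.hi_spec hext hk
    have h1 := h.gate_right hk.1 (h.gate_isLeast hk.2).1
    have h2 := h.gate_right hk.1 (h.gate_isGreatest hk.2).1
    rw [← h5] at h1
    rw [← h7] at h2
    have h3 := (h.mem_atHeight_iff hext hε hk.1 h4).2 ⟨_, h1⟩
    exact ⟨h3.1, h3.2.1, ((h.mem_atHeight_iff hext hε hk.1 h6).2 ⟨_, h2⟩).2.2⟩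

omit hext hε

theorem topX_mem (hne : (cellPart P A i).Nonempty) :
    (sSup (Prod.fst '' topmost P A i), sSup (Prod.snd '' cellPart P A i)) ∈ cellPart P A i := by
  obtain ⟨⟨x, y⟩, h1, h2⟩ := (h.topmost_isGreatest hne).1
  obtain ⟨h3, h4⟩ := (h.mem_topmost_iff hne).1 h1
  rw [← h2, ← h4]
  exact h3

theorem botX_mem (hne : (cellPart P A i).Nonempty) :
    (sInf (Prod.fst '' bottommost P A i), sInf (Prod.snd '' cellPart P A i)) ∈ cellPart P A i := by
  obtain ⟨⟨x, y⟩, h1, h2⟩ := (h.bottommost_isLeast hne).1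
  obtain ⟨h3, h4⟩ := (h.mem_bottommost_iff hne).1 h1
  rw [← h2, ← h4]
  exact h3

/-- The algorithm correctly recognizes bad indices. -/
theorem badAt_iff {s t : ℕ} :
    badAt (sweepInput P A m ε) s t i = true ↔ IsBad P A (ε s) (ε t) i := by
  have hs : (sweepInput P A m ε).left i ((sweepInput P A m ε).height s) = cellLeft P A i (ε s) := rfl
  have ht : (sweepInput P A m ε).right i ((sweepInput P A m ε).height t) = cellRight P A i (ε t) :=
    rfl
  unfold badAt IsBad
  rw [hs, ht]
  rcases hl : cellLeft P A i (ε s) with _ | x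
  · simp only [Bool.false_eq_true, false_iff]
    rintro ⟨x, x', h1, -⟩
    cases h1
  rcases hr : cellRight P A i (ε t) with _ | x'
  · simp only [Bool.false_eq_true, false_iff]
    rintro ⟨x, x', -, h1, -⟩
    cases h1
  have hne : (cellPart P A i).Nonempty := ⟨_, (h.cellLeft_eq_some.1 hl).1⟩
  have h1 := h.topmost_isGreatest hne
  have h2 := h.bottommost_isLeast hne
  have h3 : ∀ y, sSup (Prod.fst '' topmost P A i) ≤ y ↔ ∀ z ∈ topmost P A i, z.1 ≤ y := fun y => by
    rw [isLUB_le_iff h1.isLUB, mem_upperBounds, forall_mem_image]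
  have h4 : ∀ y, y ≤ sInf (Prod.fst '' bottommost P A i) ↔ ∀ z ∈ bottommost P A i, y ≤ z.1 :=
    fun y => by rw [le_isGLB_iff h2.isGLB, mem_lowerBounds, forall_mem_image]
  simp only [Bool.and_eq_true, decide_eq_true_eq]
  change ((sSup (Prod.fst '' topmost P A i) ≤ x ∧ sSup (Prod.fst '' topmost P A i) ≤ x') ∧
    x ≤ sInf (Prod.fst '' bottommost P A i)) ∧ x' ≤ sInf (Prod.fst '' bottommost P A i) ↔ _
  rw [h3, h3, h4, h4]
  constructor
  · rintro ⟨⟨⟨h5, h6⟩, h7⟩, h8⟩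
    exact ⟨x, x', rfl, rfl, fun z hz => ⟨h5 z hz, h6 z hz⟩, fun z hz => ⟨h7 z hz, h8 z hz⟩⟩
  · rintro ⟨y, y', h5, h6, h7, h8⟩
    obtain rfl : x = y := WithTop.coe_inj.1 h5
    obtain rfl : x' = y' := WithTop.coe_inj.1 h6
    exact ⟨⟨⟨fun z hz => (h7 z hz).1, fun z hz => (h7 z hz).2⟩, fun z hz => (h8 z hz).1⟩,
      fun z hz => (h8 z hz).2⟩

include hext hε

/-- The input of the algorithm describes the combinatorial structure of `A`. -/
theorem models : Models (sweepInput P A m ε) (diagram P A m ε) where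
  valid := h.diagram_valid hext hε
  left {i y} hi hy := cellLeft_ne_top.trans (h.mem_atHeight_iff hext hε hi hy).symm
  right {i y} hi hy := cellRight_ne_top.trans (h.mem_atHeight_iff hext hε hi hy).symm
  strictMono ha hb := hε.le_iff_le ha hb
  range_some {i} hi := by
    refine (if_pos hi).trans ?_
    rw [← (h.bot_spec hext hi).2, ← (h.top_spec hext hi).2]
    rfl
  range_none hi hc := if_neg hc
  gate_some {k} hk := by
    refine (if_pos hk).trans ?_
    rw [← (h.lo_spec hext hk).2, ← (h.hi_spec hext hk).2]
    rfl
  gate_none hk hg := if_neg hg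
  top_le {i a b} hi hba hab hbt hlt := by
    obtain ⟨h6, h7⟩ := h.top_spec hext hi
    have ha : ∃ x, (x, ε a) ∈ cellPart P A i :=
      (h.mem_atHeight_iff hext hε hi.1 (by omega)).1 ⟨hi, by omega, by omega⟩
    have hb : ∃ x, (x, ε b) ∈ cellPart P A i :=
      (h.mem_atHeight_iff hext hε hi.1 (by omega)).1 ⟨hi, by omega, by omega⟩
    obtain ⟨x, hx, hxl⟩ := h.exists_cellLeft ha
    obtain ⟨x', hx', hxl'⟩ := h.exists_cellLeft hb
    have hbt' : ε b < sSup (Prod.snd '' cellPart P A i) := by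
      rw [← h7]
      exact hε (by exact hbt.trans h6) h6 hbt
    have hab' : ε a ≤ ε b := (hε.le_iff_le (by exact (by omega : a < m)) (by exact hbt.trans h6)).2 hab
    change cellLeft P A i (ε a) < _ at hlt
    change cellLeft P A i (ε b) < _
    rw [hx] at hlt
    rw [hx']
    have hlt' : x < sSup (Prod.fst '' topmost P A i) := WithTop.coe_lt_coe.1 hlt
    refine WithTop.coe_lt_coe.2 ?_
    obtain ⟨u, v, hu, hv, huv, h8, h9⟩ := h.exists_between hi.1 hxl.1 (h.topX_mem hi.2) hab' hbt'.le
    refine (hxl'.2 h9).trans_lt ?_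
    rcases hu.eq_or_lt with rfl | hu'
    · obtain rfl : v = 1 := by linarith
      linarith
    · obtain rfl : v = 1 - u := by linarith
      have := mul_lt_mul_of_pos_left hlt' hu'
      change _ < sSup (Prod.fst '' topmost P A i)
      linarith
  le_bot {i a b} hi hba hab hbt hle := by
    obtain ⟨h4, h5⟩ := h.bot_spec hext hi
    obtain ⟨h6, h7⟩ := h.top_spec hext hi
    have ham : a < m := by omega
    have ha : ∃ x, (x, ε a) ∈ cellPart P A i :=
      (h.mem_atHeight_iff hext hε hi.1 ham).1 ⟨hi, by omega, by omega⟩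
    have hb : ∃ x, (x, ε b) ∈ cellPart P A i :=
      (h.mem_atHeight_iff hext hε hi.1 (by omega)).1 ⟨hi, by omega, by omega⟩
    obtain ⟨x, hx, hxr⟩ := h.exists_cellRight ha
    obtain ⟨x', hx', hxr'⟩ := h.exists_cellRight hb
    have hba' : sInf (Prod.snd '' cellPart P A i) < ε a := by
      rw [← h5]
      exact hε h4 ham hba
    have hab' : ε a ≤ ε b := (hε.le_iff_le ham (by exact (by omega : b < m))).2 hab
    change cellRight P A i (ε a) ≤ _ at hle
    change cellRight P A i (ε b) ≤ _
    rw [hx] at hle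
    rw [hx']
    have hle' : x ≤ sInf (Prod.fst '' bottommost P A i) := WithTop.coe_le_coe.1 hle
    refine WithTop.coe_le_coe.2 ?_
    change x' ≤ sInf (Prod.fst '' bottommost P A i)
    by_contra hlt
    obtain ⟨u, v, hu, hv, huv, h8, h9⟩ := h.exists_between hi.1 (h.botX_mem hi.2) hxr'.1 hba'.le hab'
    have h10 := (hxr.2 h9).trans hle'
    rcases hv.eq_or_lt with rfl | hv'
    · obtain rfl : u = 1 := by linarith
      linarith
    · obtain rfl : u = 1 - v := by linarith
      have := mul_lt_mul_of_pos_left (not_le.1 hlt) hv'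
      linarith
  bad_iff {i s t} hs ht his hit := by
    have hi := his.1
    obtain ⟨h4, h5⟩ := h.bot_spec hext hi
    obtain ⟨h6, h7⟩ := h.top_spec hext hi
    obtain ⟨x, hx, hxl⟩ := h.exists_cellLeft ((h.mem_atHeight_iff hext hε hi.1 hs).1 his)
    obtain ⟨x', hx', hxr⟩ := h.exists_cellRight ((h.mem_atHeight_iff hext hε hi.1 ht).1 hit)
    have hl : (sweepInput P A m ε).left i ((sweepInput P A m ε).height s) = (x : WithTop ℝ) := hx
    have hr : (sweepInput P A m ε).right i ((sweepInput P A m ε).height t) = (x' : WithTop ℝ) := hx'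
    set X := (sweepInput P A m ε).topX i with hX
    set Y := (sweepInput P A m ε).botX i with hY
    have hbad : badAt (sweepInput P A m ε) s t i = true ↔ ((X ≤ x ∧ X ≤ x') ∧ x ≤ Y) ∧ x' ≤ Y := by
      unfold badAt
      rw [hl, hr]
      simp only [Bool.and_eq_true, decide_eq_true_eq, hX, hY]
    have hbetween : ∀ z, i ∈ (diagram P A m ε).atHeight z → z < m → X ≤ Y →
        ∃ w, X ≤ w ∧ w ≤ Y ∧ (w, ε z) ∈ cellPart P A i := by
      rintro z ⟨-, h8, h9⟩ hz hXY
      obtain ⟨u, v, hu, hv, huv, -, h10⟩ := h.exists_between hi.1 (h.botX_mem hi.2) (h.topX_mem hi.2)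
        (y := ε z) (h5 ▸ (hε.le_iff_le h4 hz).2 h8) (h7 ▸ (hε.le_iff_le hz h6).2 h9)
      obtain ⟨h11, h12⟩ := convex_Icc X Y (right_mem_Icc.2 hXY) (left_mem_Icc.2 hXY) hu hv huv
      exact ⟨_, h11, h12, h10⟩
    rw [hbad, hl, hr, WithTop.coe_le_coe, WithTop.coe_le_coe]
    constructor
    · rintro ⟨⟨⟨h8, h9⟩, h10⟩, h11⟩
      exact ⟨h8.trans h10, h8, h11⟩
    · rintro ⟨h8, h9, h10⟩
      obtain ⟨w, h11, h12, h13⟩ := hbetween s his hs h8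
      obtain ⟨w', h14, h15, h16⟩ := hbetween t hit ht h8
      exact ⟨⟨⟨h9, h14.trans (hxr.2 h16)⟩, (hxl.2 h13).trans h12⟩, h10⟩

/-- The monotone paths between different cells, in terms of the combinatorial structure. -/
theorem reaches_iff_pass {s t i j : ℕ} (hst : s ≤ t) (ht : t < m) (hij : i < j)
    (hj : j < P.numEdges) :
    Reaches P A (ε s) (ε t) i j ↔ i ∈ (diagram P A m ε).atHeight s ∧
      j ∈ (diagram P A m ε).atHeight t ∧
      (diagram P A m ε).pass ((diagram P A m ε).opened s t) i j := by
  have hs : s < m := by omega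
  rw [h.reaches_iff ((hε.le_iff_le hs ht).2 hst) hij hj,
    h.mem_atHeight_iff hext hε (by omega) hs, h.mem_atHeight_iff hext hε hj ht]
  refine and_congr_right fun _ => and_congr_right fun _ => ?_
  have hgate : ∀ k, k < j → ((∃ y, (P.knot (k + 1), y) ∈ A) ∧
      sInf {y | (P.knot (k + 1), y) ∈ A} ≤ ε t ∧ ε s ≤ sSup {y | (P.knot (k + 1), y) ∈ A} ↔
      k ∈ (diagram P A m ε).opened s t) := by
    intro k hk
    by_cases hg : (diagram P A m ε).gate k
    · obtain ⟨h4, h5⟩ := h.lo_spec hext hg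
      obtain ⟨h6, h7⟩ := h.hi_spec hext hg
      rw [← h5, ← h7, hε.le_iff_le h4 ht, hε.le_iff_le hs h6]
      exact ⟨fun h8 => ⟨hg, h8.2⟩, fun h8 => ⟨hg.2, h8.2⟩⟩
    · exact ⟨fun h8 => absurd ⟨by omega, h8.1⟩ hg, fun h8 => absurd h8.1 hg⟩
  have hle : ∀ k l, k ∈ (diagram P A m ε).opened s t → l ∈ (diagram P A m ε).opened s t →
      (sInf {y | (P.knot (k + 1), y) ∈ A} ≤ sSup {y | (P.knot (l + 1), y) ∈ A} ↔
        (diagram P A m ε).lo k ≤ (diagram P A m ε).hi l) := by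
    intro k l hk hl
    obtain ⟨h4, h5⟩ := h.lo_spec hext hk.1
    obtain ⟨h6, h7⟩ := h.hi_spec hext hl.1
    rw [← h5, ← h7, hε.le_iff_le h4 h6]
  constructor
  · rintro ⟨h1, h2⟩
    have h3 : ∀ k, i ≤ k → k < j → k ∈ (diagram P A m ε).opened s t := fun k hk hkj =>
      (hgate k hkj).1 (h1 k hk hkj)
    exact ⟨hij.le, h3, fun k l hk hkl hl =>
      (hle k l (h3 k hk (by omega)) (h3 l (by omega) hl)).1 (h2 k l hk hkl hl)⟩
  · rintro ⟨-, h3, h2⟩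
    exact ⟨fun k hk hkj => (hgate k hkj).2 (h3 k hk hkj), fun k l hk hkl hl =>
      (hle k l (h3 k hk (by omega)) (h3 l (by omega) hl)).2 (h2 k l hk hkl hl)⟩

end CellConvex

end SubtrajSweep

namespace SubtrajSweep

/-! # The groups -/

/-- Two consecutive or overlapping entries of `G` are to be merged. -/
def Merges (bad : ℕ → Bool) (G : ℕ → Option ℕ) (p q : ℕ × ℕ) : Prop :=
  G p.1 = some p.2 ∧ G q.1 = some q.2 ∧
    ((p.1 < q.1 ∧ q.1 < p.2 ∧ p.2 < q.2) ∨ (p.2 = q.1 ∧ bad q.1 = false))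

/-- The run of `a` starts at `x`. -/
def IsHead (H : ℕ → Option ℕ) (x a : ℕ) : Prop :=
  x ≤ a ∧ H x ≠ none ∧ ∀ w, x < w → w ≤ a → H w = none

theorem IsHead.unique {H : ℕ → Option ℕ} {x y a : ℕ} (h : IsHead H x a) (h' : IsHead H y a) :
    x = y := by
  rcases lt_trichotomy x y with h1 | h1 | h1
  · exact absurd (h.2.2 y h1 h'.1) h'.2.1
  · exact h1
  · exact absurd (h'.2.2 x h1 h.1) h.2.1

section Runs

variable {bad : ℕ → Bool} {G H : ℕ → Option ℕ}
  (hG : ∀ {a a' b b'}, G a = some b → G a' = some b' → a < a' → b < b')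
  (hlt : ∀ {a b}, G a = some b → a < b) (hr : IsRunMap G H) (hl : LinkOK bad ∅ G H)

/-- The entry preceding an entry. -/
theorem exists_pred {G : ℕ → Option ℕ} {a c : ℕ} (hc : G c ≠ none) (hca : c < a) :
    ∃ c' d, c ≤ c' ∧ c' < a ∧ G c' = some d ∧ ∀ w, c' < w → w < a → G w = none := by
  induction a with
  | zero => omega
  | succ a ih =>
    by_cases ha : G a = none
    · obtain ⟨c', d, h1, h2, h3, h4⟩ := ih (by
        rcases Nat.lt_succ_iff_lt_or_eq.1 hca with h | rfl
        · exact h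
        · exact absurd ha hc)
      refine ⟨c', d, h1, by omega, h3, fun w h5 h6 => ?_⟩
      rcases Nat.lt_succ_iff_lt_or_eq.1 h6 with h7 | rfl
      · exact h4 w h5 h7
      · exact ha
    · obtain ⟨d, hd⟩ := Option.ne_none_iff_exists'.1 ha
      exact ⟨a, d, by omega, by omega, hd, fun w h5 h6 => by omega⟩

include hG hlt hr hl

theorem Merges.isHead_iff {p q : ℕ × ℕ} (h : Merges bad G p q) (x : ℕ) :
    IsHead H x p.1 ↔ IsHead H x q.1 := by
  obtain ⟨c, d⟩ := p
  obtain ⟨a, b⟩ := q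
  obtain ⟨hc, ha, h⟩ := h
  dsimp only at hc ha h ⊢
  have hca : c < a := by
    have := hlt hc
    omega
  have hno : ∀ w, c < w → w ≤ a → H w = none := by
    intro w h1 h2
    by_contra hw
    obtain ⟨c', d', h3, h4, h5, h6⟩ := exists_pred (G := G) (by simp [hc]) h1
    have h7 := (hl c' d' w h5 (hr.sub w hw) h4 h6 (by simp)).not.1 hw
    have h8 : d ≤ d' := by
      rcases h3.eq_or_lt with rfl | h9
      · rw [hc] at h5
        exact (Option.some.inj h5).le
      · exact (hG hc h5 h9).le
    rw [not_or, not_and] at h7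
    rcases h with h | ⟨h9, h10⟩
    · omega
    · obtain rfl : w = a := by omega
      exact h7.2 (by omega) h10
  constructor
  · rintro ⟨h1, h2, h3⟩
    refine ⟨by omega, h2, fun w h4 h5 => ?_⟩
    rcases le_or_gt w c with h6 | h6
    · exact h3 w h4 h6
    · exact hno w h6 h5
  · rintro ⟨h1, h2, h3⟩
    refine ⟨?_, h2, fun w h4 h5 => h3 w h4 (by omega)⟩
    by_contra h4
    exact h2 (hno x (by omega) h1)

theorem eqvGen_merges {p q : ℕ × ℕ} (h : Relation.EqvGen (Merges bad G) p q) :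
    (G p.1 = some p.2 ↔ G q.1 = some q.2) ∧ ∀ x, IsHead H x p.1 ↔ IsHead H x q.1 := by
  induction h with
  | rel p q h => exact ⟨iff_of_true h.1 h.2.1, h.isHead_iff hG hlt hr hl⟩
  | refl p => exact ⟨Iff.rfl, fun _ => Iff.rfl⟩
  | symm p q _ ih => exact ⟨ih.1.symm, fun x => (ih.2 x).symm⟩
  | trans p q r _ _ ih₁ ih₂ => exact ⟨ih₁.1.trans ih₂.1, fun x => (ih₁.2 x).trans (ih₂.2 x)⟩

theorem eqvGen_head {a b : ℕ} (hab : G a = some b) :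
    ∃ x y, IsHead H x a ∧ G x = some y ∧ Relation.EqvGen (Merges bad G) (x, y) (a, b) := by
  induction a using Nat.strong_induction_on generalizing b with
  | _ a ih =>
    by_cases ha : H a = none
    · obtain ⟨c₀, hc₀, hne⟩ : ∃ c < a, G c ≠ none := by
        by_contra hcon
        push Not at hcon
        exact hr.first a (by simp [hab]) hcon ha
      obtain ⟨c, d, -, h2, h3, h4⟩ := exists_pred hne hc₀
      obtain ⟨x, y, h5, h6, h7⟩ := ih c h2 h3
      have h8 : Merges bad G (c, d) (a, b) := by
        refine ⟨h3, hab, ?_⟩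
        rcases (hl c d a h3 (by simp [hab]) h2 h4 (by simp)).1 ha with h9 | ⟨h9, h10⟩
        · exact .inl ⟨h2, h9, hG h3 hab h2⟩
        · exact .inr ⟨h9.symm, h10⟩
      exact ⟨x, y, (h8.isHead_iff hG hlt hr hl x).1 h5, h6, h7.trans _ _ _ (.rel _ _ h8)⟩
    · exact ⟨a, b, ⟨le_rfl, ha, fun w h1 h2 => by omega⟩, hab, .refl _⟩

/-- The runs are the merged classes. -/
theorem IsRunMap.eq_some_iff (x z : ℕ) :
    H x = some z ↔ ∃ p : ℕ × ℕ, G p.1 = some p.2 ∧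
      IsLeast (Prod.fst '' {q | Relation.EqvGen (Merges bad G) p q}) x ∧
      IsGreatest (Prod.snd '' {q | Relation.EqvGen (Merges bad G) p q}) z := by
  have main : ∀ x z, H x = some z → ∃ y, G x = some y ∧
      IsLeast (Prod.fst '' {q | Relation.EqvGen (Merges bad G) (x, y) q}) x ∧
      IsGreatest (Prod.snd '' {q | Relation.EqvGen (Merges bad G) (x, y) q}) z := by
    intro x z hx
    obtain ⟨y, hy⟩ := Option.ne_none_iff_exists'.1 (hr.sub x (by simp [hx]))
    have hself : IsHead H x x := ⟨le_rfl, by simp [hx], fun w h1 h2 => by omega⟩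
    refine ⟨y, hy, ⟨⟨(x, y), .refl _, rfl⟩, ?_⟩, ?_, ?_⟩
    · rintro _ ⟨⟨a, b⟩, h1, rfl⟩
      exact (((eqvGen_merges hG hlt hr hl h1).2 x).1 hself).1
    · obtain ⟨a, h1, h2, h3, -⟩ := hr.val x z hx
      obtain ⟨x', y', h4, h5, h6⟩ := eqvGen_head hG hlt hr hl h2
      obtain rfl : x' = x := h4.unique ⟨h1, by simp [hx], h3⟩
      obtain rfl : y' = y := Option.some.inj (h5.symm.trans hy)
      exact ⟨_, h6, rfl⟩
    · rintro _ ⟨⟨a, b⟩, h1, rfl⟩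
      obtain ⟨h2, h3⟩ := eqvGen_merges hG hlt hr hl h1
      obtain ⟨h4, -, h5⟩ := (h3 x).1 hself
      have hab := h2.1 hy
      obtain ⟨a', h6, h7, h8, h9⟩ := hr.val x z hx
      rcases lt_trichotomy a a' with h10 | rfl | h10
      · exact (hG hab h7 h10).le
      · exact (Option.some.inj (hab.symm.trans h7)).le
      · obtain ⟨w, h11, h12, h13⟩ := h9 a h10 (by simp [show G a = some b from hab])
        exact absurd (h5 w (by omega) h12) h13
  constructor
  · intro hx
    obtain ⟨y, h1, h2, h3⟩ := main x z hx
    exact ⟨(x, y), h1, h2, h3⟩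
  · rintro ⟨⟨a, b⟩, h1, h2, h3⟩
    obtain ⟨x', y', h4, h5, h6⟩ := eqvGen_head hG hlt hr hl h1
    obtain ⟨z', h7⟩ := Option.ne_none_iff_exists'.1 h4.2.1
    obtain ⟨y'', h8, h9, h10⟩ := main x' z' h7
    obtain rfl : y' = y'' := Option.some.inj (h5.symm.trans h8)
    have hclass : {q | Relation.EqvGen (Merges bad G) (x', y') q} =
        {q | Relation.EqvGen (Merges bad G) (a, b) q} := by
      ext q
      exact ⟨fun h => (h6.symm _ _).trans _ _ _ h, fun h => h6.trans _ _ _ h⟩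
    rw [hclass] at h9 h10
    rw [h2.unique h9, h3.unique h10, h7]

end Runs

theorem Trie.mem_pairs {D : ℕ} {T : Trie ℕ} (hT : T.WF D) (p : ℕ × ℕ) :
    p ∈ T.pairs ↔ T.fn p.1 = some p.2 := by
  rw [← (Trie.find_spec hT p.1).1]
  rfl

variable {d : ℕ} {P : PolygonalCurve d} {A : Set (ℝ × ℝ)} {m D s t : ℕ} {ε : ℕ → ℝ} {σ : State}

theorem CellConvex.pairs_iff (h : CellConvex P A) (hext : extremalHeights P A ⊆ ε '' Iio m)
    (hε : StrictMonoOn ε (Iio m)) (hst : s ≤ t) (ht : t < m) (i j : ℕ) :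
    Pairs 1 ((diagram P A m ε).atHeight s) ((diagram P A m ε).atHeight t)
      ((diagram P A m ε).pass ((diagram P A m ε).opened s t)) i j ↔
      i < j ∧ j < P.numEdges ∧ Reaches P A (ε s) (ε t) i j := by
  constructor
  · rintro ⟨h1, h2, h3, h4⟩
    have hj : j < P.numEdges := h2.1.1
    exact ⟨h4, hj, (h.reaches_iff_pass hext hε hst ht h4 hj).2 ⟨h1, h2, h3⟩⟩
  · rintro ⟨h1, h2, h3⟩
    obtain ⟨h4, h5, h6⟩ := (h.reaches_iff_pass hext hε hst ht h1 h2).1 h3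
    exact ⟨h4, h5, h6, h1⟩

section Correctness

variable (hσ : SweepInv (sweepInput P A m ε) (diagram P A m ε) D s t σ)
  (h : CellConvex P A) (hext : extremalHeights P A ⊆ ε '' Iio m) (hε : StrictMonoOn ε (Iio m))
  (hst : s ≤ t) (ht : t < m)
include hσ h hext hε hst ht

theorem SweepInv.G_iff (i j : ℕ) :
    σ.G.fn i = some j ↔ (i, j) ∈ globalGroup P A (ε s) (ε t) := by
  rw [hσ.G.iff_max]
  simp only [h.pairs_iff hext hε hst ht]
  constructor
  · rintro ⟨⟨h1, h2, h3⟩, h4⟩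
    refine ⟨⟨h1.trans h2, h2, h3, ?_⟩, h1⟩
    rintro ⟨i', j'⟩ - h5 h6 ⟨h7, h8⟩
    dsimp only at h5 h6 h7 h8
    obtain ⟨rfl, rfl⟩ := h4 i' j' ⟨by omega, h5, h6⟩ h7 h8
    rfl
  · rintro ⟨⟨-, h2, h3, h4⟩, h1⟩
    refine ⟨⟨h1, h2, h3⟩, fun i' j' ⟨h5, h6, h7⟩ h8 h9 => ?_⟩
    have := h4 (i', j') (h5.trans h6) h6 h7 ⟨h8, h9⟩
    exact ⟨congrArg Prod.fst this, congrArg Prod.snd this⟩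

theorem SweepInv.Gr_pairs : σ.Gr.pairs = reducedGlobalGroup P A (ε s) (ε t) := by
  have hlink := hσ.gr.link
  rw [hσ.s_eq, hσ.t_eq] at hlink
  have hmerge : ShouldMerge P A (ε s) (ε t) =
      Merges (badAt (sweepInput P A m ε) s t) σ.G.fn := by
    ext ⟨a, b⟩ ⟨a', b'⟩
    unfold ShouldMerge Merges
    rw [← hσ.G_iff h hext hε hst ht, ← hσ.G_iff h hext hε hst ht, ← h.badAt_iff (m := m),
      Bool.not_eq_true]
  ext ⟨x, z⟩
  rw [Trie.mem_pairs hσ.wf.Gr, hσ.gr.run.eq_some_iff (fun h1 h2 h3 => hσ.G.inc h1 h2 h3)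
    (fun h1 => (hσ.G.sound h1).2.2.2) hlink]
  unfold reducedGlobalGroup mergeClass
  rw [hmerge]
  refine exists_congr fun p => ?_
  rw [← hσ.G_iff h hext hε hst ht p.1 p.2]

theorem SweepInv.L_pairs : σ.L.pairs = goodLocalGroup P A (ε s) (ε t) := by
  have hs : s < m := by omega
  ext ⟨i, j⟩
  rw [Trie.mem_pairs hσ.wf.L]
  dsimp only
  have hmem : σ.L.fn i = some j ↔ i = j ∧ i < P.numEdges ∧ σ.L.fn i ≠ none := by
    constructor
    · intro h1
      obtain ⟨h2, h3⟩ := hσ.L.eq i j h1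
      exact ⟨h3.symm, h2, by simp [h1]⟩
    · rintro ⟨rfl, -, h2⟩
      obtain ⟨k, hk⟩ := Option.ne_none_iff_exists'.1 h2
      rw [hk, (hσ.L.eq i k hk).2]
  rw [hmem]
  constructor
  · rintro ⟨rfl, hi, h1⟩
    obtain ⟨⟨h2, h3, h4⟩, h5⟩ := (hσ.L.iff i hi (by simp)).1 h1
    rw [hσ.s_eq] at h2
    rw [hσ.t_eq] at h3
    rw [hσ.s_eq, hσ.t_eq] at h4
    have hgood : ¬ IsBad P A (ε s) (ε t) i := by
      rw [← h.badAt_iff (m := m), h4]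
      simp
    refine ⟨⟨⟨hi, hi, h.reaches_self hi ((hε.le_iff_le hs ht).2 hst) (cellLeft_ne_top.1 h2)
      (cellRight_ne_top.1 h3) hgood, ?_⟩, rfl⟩, hgood⟩
    rintro ⟨i', j'⟩ - h6 h7 ⟨h8, h9⟩
    dsimp only at h6 h7 h8 h9
    by_contra hne
    have hlt : i' < j' := by
      by_contra h10
      exact hne (by rw [show i' = i by omega, show j' = i by omega])
    exact h5 ((hσ.G.covered_iff i).2 ⟨i', j', (h.pairs_iff hext hε hst ht _ _).2 ⟨hlt, h6, h7⟩, h8, h9⟩)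
  · rintro ⟨⟨⟨hi, -, h1, h2⟩, hij⟩, hgood⟩
    dsimp only at hi h1 hij hgood
    subst hij
    refine ⟨rfl, hi, (hσ.L.iff i hi (by simp)).2 ⟨⟨?_, ?_, ?_⟩, fun hc => ?_⟩⟩
    · obtain ⟨x, hx, x', hx', γ, h3, h4, h5, h6, h7⟩ := h1
      rw [hσ.s_eq]
      exact cellLeft_ne_top.2 ⟨x, h.mem_cellPart (h5 ▸ h7 0 (by simp)) hx⟩
    · obtain ⟨x, hx, x', hx', γ, h3, h4, h5, h6, h7⟩ := h1
      rw [hσ.t_eq]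
      exact cellRight_ne_top.2 ⟨x', h.mem_cellPart (h6 ▸ h7 1 (by simp)) hx'⟩
    · rw [hσ.s_eq, hσ.t_eq, ← Bool.not_eq_true, h.badAt_iff]
      exact hgood
    · obtain ⟨a, b, h3, h4, h5⟩ := (hσ.G.covered_iff i).1 hc
      obtain ⟨h6, h7, h8⟩ := (h.pairs_iff hext hε hst ht _ _).1 h3
      have := h2 (a, b) (h6.trans h7) h7 h8 ⟨h4, h5⟩
      simp only [Prod.mk.injEq] at this
      omega

end Correctness

end SubtrajSweep

theorem mainTheorem9 (c : ℕ) :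
    ∃ C : ℝ, ∀ (d : ℕ) (p q : EuclideanSpace ℝ (Fin d)) (P : PolygonalCurve d) (α Δ : ℝ)
      (A : Set (ℝ × ℝ)) (m : ℕ) (ε : ℕ → ℝ) (𝔰 : List (ℕ × ℕ)),
      1 ≤ α → 0 ≤ Δ → IsApproxFreeSpace p q P α Δ A → IsClosed A →
      StrictMonoOn ε (Set.Iio m) → (∀ k < m, ε k ∈ Set.Icc (0 : ℝ) 1) →
      extremalHeights P A ⊆ ε '' Set.Iio m →
      IsSweepSequence m 𝔰 → (∃ a : ℕ, 𝔰.getLast? = some (a, a)) →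
      m ≤ c * P.complexity → 𝔰.length ≤ c * P.complexity →
      (maintain (sweepInput P A m ε) 𝔰).val.length = 𝔰.length + 1 ∧
      (∀ (k : ℕ) (σ : State), (maintain (sweepInput P A m ε) 𝔰).val[k]? = some σ →
        𝔰.reverse[k - 1]? = some (σ.s, σ.t) ∧
        σ.Gr.pairs = reducedGlobalGroup P A (ε σ.s) (ε σ.t) ∧
        σ.L.pairs = goodLocalGroup P A (ε σ.s) (ε σ.t)) ∧
      ((maintain (sweepInput P A m ε) 𝔰).steps : ℝ) ≤
        C * (P.complexity * Real.log P.complexity) := by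
  obtain ⟨C, hC⟩ := exists_maintainBound_le c
  refine ⟨C, ?_⟩
  intro d p q P α Δ A m ε 𝔰 _ _ hfree hclosed hε _ hext hs ⟨a, ha⟩ hm hL
  have hA := hfree.cellConvex hclosed
  obtain ⟨⟨D, hD⟩, hsteps⟩ := maintain_spec (hA.models hext hε) hs ha
  refine ⟨?_, fun k σ hk => ?_, ?_⟩
  · rw [← hD.length_eq]
    simp
  · obtain ⟨b, hb, h1, h2, h3⟩ : ∃ b, ((a, a) :: 𝔰.reverse)[k]? = some b ∧ b.1 ≤ b.2 ∧ b.2 < m ∧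
        SweepInv (sweepInput P A m ε) (diagram P A m ε) D b.1 b.2 σ := by
      obtain ⟨hk', rfl⟩ := List.getElem?_eq_some_iff.1 hk
      have hk'' : k < ((a, a) :: 𝔰.reverse).length := by rwa [hD.length_eq]
      exact ⟨_, List.getElem?_eq_getElem hk'', (List.forall₂_iff_get.1 hD).2 k hk'' hk'⟩
    rw [h3.s_eq, h3.t_eq]
    refine ⟨?_, h3.Gr_pairs hA hext hε h1 h2, h3.L_pairs hA hext hε h1 h2⟩
    rcases k with _ | k
    · obtain rfl : (a, a) = b := by simpa using hb
      rw [← ha, ← List.head?_reverse, List.head?_eq_getElem?]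
    · simpa using hb
  · exact (Nat.cast_le.2 hsteps).trans (hC P.numEdges m 𝔰.length P.numEdges_pos hm hL)
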